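/- Let $k$ be a field of characteristic different from $2$ and $3$. For a unital (not necessarily associative) $k$-algebra $A$ with involution $x\mapsto\bar x$ put $$V_{x,y}(z)=(x\bar y)z+(z\bar y)x-(z\bar x)y,\qquad U_x(y)=V_{x,y}(x),\qquad \psi(x,y)=x\bar y-y\bar x,$$ and $S=\mathrm{Skew}(A,-)=\{s\in A:\bar s=-s\}$. An element $x$ is called conjugate-invertible if $V_{x,y}=\mathrm{id}$ for some $y\in A$. Let $(A,-)$ be a bi-octonion algebra over $k$, i.e. an algebra with involution such that for some field extension $L/k$ the algebra with involution $(A\otimes_kL,-)$ is isomorphic to a tensor product $C_1\otimes_LC_2$ of two octonion $L$-algebras with its canonical involution. Then $\dim_kA=64$ and $\dim_kS=14$. The norm $N_A$ of $(A,-)$ is the homogeneous polynomial of minimal degree on $A$ such that, for every field extension $K/k$, an element $x\in A\otimes_kK$ is conjugate-invertible if and only if $N_A(x)\neq0$, normalised by $N_A(1)=1$. It exists, is unique, and has degree $8$. Define a linear map $\natural:S\to S$ and a scalar $d\in k^\times$ as follows. If $(A,-)=C_1\otimes_kC_2$ for octonion $k$-algebras $C_1,C_2$, then $(s_1+s_2)^\natural=s_1-s_2$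 for skew elements $s_i\in C_i$, and $d=1$. Otherwise there are a quadratic field extension $E=k(\sqrt d)$, with $d\in k$ a non-square, and octonion $E$-algebras $C_1,C_2$ such that $(A\otimes_kE,-)=C_1\otimes_EC_2$ and such that the map $s_1+s_2\mapsto\sqrt d\,(s_1-s_2)$ on the skew elements of $A\otimes_kE$ restricts to a $k$-linear map $\natural:S\to S$. Thus in all cases $\natural^2=d\cdot\mathrm{id}_S$. Such $\natural$ and $d$ exist for every bi-octonion algebra. For $x\in A$ let $M_x\in\mathrm{End}_k(S)$ be the linear map $$M_x(s)=\tfrac16\,\psi\bigl(x,U_x(s^\natural x)\bigr).$$ Then, for every such choice of $\natural$ and $d$, $$M_x^2=d\,N_A(x)\cdot\mathrm{id}_S\qquad\text{for all }x\in A;$$ in particular $M_x^2=N_A(x)\cdot\mathrm{id}_S$ if $(A,-)$ is a tensor product of two octonion $k$-algebras. Moreover, this is a $14\times14$ matrix factorisation of the octic norm over $k$: with respect to any bases of $A$ and $S$, the maps $M_x$ are given by a $14\times14$ matrix $P$ whose entries are homogeneous polynomials of degree $4$ over $k$ in the coordinates of $x$, and $(d^{-1}P)\,P=N_A\cdot\mathrm{id}$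 as matrices of polynomials. -/

import Mathlib

open scoped TensorProduct

universe u

/-- The hypothesis that a `k`-linear map `σ` on a `k`-algebra is an involution. -/
structure IsInvolution {k A : Type*} [Field k] [NonAssocRing A] [Module k A]
    (σ : A →ₗ[k] A) : Prop where
  involutive : ∀ x, σ (σ x) = x
  map_mul : ∀ x y, σ (x * y) = σ y * σ x

/-- An octonion algebra over `F`: a (not necessarily associative) unital algebra of dimension `8`
with a quadratic form `norm` which has a nondegenerate polar form and is multiplicative. -/
structure OctonionAlgebra (F : Type u) [Field F] where
  carrier : Type u
  [ring : NonAssocRing carrier]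
  [module : Module F carrier]
  [smulComm : SMulCommClass F carrier carrier]
  [tower : IsScalarTower F carrier carrier]
  norm : QuadraticForm F carrier
  finrank_eq : Module.finrank F carrier = 8
  nondegenerate : (QuadraticMap.polarBilin norm).Nondegenerate
  norm_mul : ∀ x y, norm (x * y) = norm x * norm y

namespace OctonionAlgebra

instance (F : Type u) [Field F] : CoeSort (OctonionAlgebra F) (Type u) := ⟨carrier⟩

attribute [instance] ring module smulComm tower

/-- The standard involution `x ↦ n(x, 1) 1 - x` of an octonion algebra. -/
def conj {F : Type u} [Field F] (C : OctonionAlgebra F) : C →ₗ[F] C :=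
  ((QuadraticMap.polarBilin C.norm).flip 1).smulRight (1 : C) - LinearMap.id

end OctonionAlgebra

/-- An isomorphism from the algebra with involution `(B, τ)` over `F` to a tensor product of two
octonion `F`-algebras with its canonical involution. -/
structure BioctonionDecomposition {F : Type u} [Field F] {B : Type u} [NonAssocRing B]
    [Module F B] (τ : B →ₗ[F] B) where
  C₁ : OctonionAlgebra F
  C₂ : OctonionAlgebra F
  iso : B ≃ₗ[F] (C₁ ⊗[F] C₂)
  map_mul : ∀ x y, iso (x * y) = iso x * iso y
  map_conj : ∀ x, iso (τ x) = TensorProduct.map C₁.conj C₂.conj (iso x)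

/-- `D.Signs δ x y`: under the decomposition `D` one has `x = s₁ + s₂` and `y = δ (s₁ - s₂)`, where
`sᵢ` is a skew element of the `i`-th octonion factor. -/
def BioctonionDecomposition.Signs {F : Type u} [Field F] {B : Type u} [NonAssocRing B]
    [Module F B] {τ : B →ₗ[F] B} (D : BioctonionDecomposition τ) (δ : F) (x y : B) : Prop :=
  ∃ (s₁ : D.C₁) (s₂ : D.C₂), D.C₁.conj s₁ = -s₁ ∧ D.C₂.conj s₂ = -s₂ ∧
    D.iso x = s₁ ⊗ₜ[F] (1 : D.C₂) + (1 : D.C₁) ⊗ₜ[F] s₂ ∧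
    D.iso y = δ • (s₁ ⊗ₜ[F] (1 : D.C₂) - (1 : D.C₁) ⊗ₜ[F] s₂)

section AlgebraWithInvolution

variable {k : Type u} [Field k] {A : Type u} [NonAssocRing A] [Module k A]

/-- The operator `V_{x,y} z = (x ȳ) z + (z ȳ) x - (z x̄) y`. -/
def opV (σ : A →ₗ[k] A) (x y z : A) : A :=
  (x * σ y) * z + (z * σ y) * x - (z * σ x) * y

/-- The operator `U_x y = V_{x,y} x`. -/
def opU (σ : A →ₗ[k] A) (x y : A) : A := opV σ x y x

/-- The bilinear map `ψ(x, y) = x ȳ - y x̄`. -/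
def opPsi (σ : A →ₗ[k] A) (x y : A) : A := x * σ y - y * σ x

/-- The element `x` has a conjugate inverse. -/
def ConjInvertible (σ : A →ₗ[k] A) (x : A) : Prop := ∃ y, ∀ z, opV σ x y z = z

/-- The skew elements `{s | s̄ = -s}`. -/
def skew (σ : A →ₗ[k] A) : Submodule k A where
  carrier := {s | σ s = -s}
  add_mem' {x y} hx hy := by
    simp only [Set.mem_ofPred_eq] at *
    rw [map_add, hx, hy, neg_add]
  zero_mem' := by simp
  smul_mem' c x hx := by
    simp only [Set.mem_ofPred_eq] at *
    rw [map_smul, hx, smul_neg]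

theorem opPsi_mem_skew {σ : A →ₗ[k] A} (hσ : IsInvolution σ) (x y : A) :
    opPsi σ x y ∈ skew σ := by
  change σ (x * σ y - y * σ x) = -(x * σ y - y * σ x)
  rw [map_sub, hσ.map_mul, hσ.map_mul, hσ.involutive, hσ.involutive, neg_sub]

variable [SMulCommClass k A A] [IsScalarTower k A A]

/-- The linear map `M_x(s) = (1/6) ψ(x, U_x(f(s) x))` on the skew elements, where `f` is a linear
endomorphism of the space of skew elements. -/
def opM {σ : A →ₗ[k] A} (hσ : IsInvolution σ) (f : skew σ →ₗ[k] skew σ) (x : A) :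
    skew σ →ₗ[k] skew σ where
  toFun s := (6 : k)⁻¹ • ⟨opPsi σ x (opU σ x ((f s : A) * x)), opPsi_mem_skew hσ _ _⟩
  map_add' s t := by
    rw [← smul_add]
    congr 1
    apply Subtype.ext
    simp only [opPsi, opU, opV, map_add, map_sub, Submodule.coe_add, add_mul, mul_add, mul_sub,
      sub_mul]
    abel
  map_smul' c s := by
    rw [RingHom.id_apply, smul_comm]
    congr 1
    apply Subtype.ext
    simp only [opPsi, opU, opV, map_add, map_sub, map_smul, Submodule.coe_smul, smul_mul_assoc,
      mul_smul_comm, mul_add, mul_sub, add_mul, sub_mul, smul_add, smul_sub]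

/-- `(A, σ)` is a bi-octonion algebra: an algebra with involution which becomes isomorphic, over
some field extension, to a tensor product of two octonion algebras. -/
def IsBioctonion (σ : A →ₗ[k] A) : Prop :=
  IsInvolution σ ∧ ∃ (L : Type u) (_ : Field L) (_ : Algebra k L),
    Nonempty (BioctonionDecomposition (σ.baseChange L))

/-- `IsNatural σ f d`: the map `f` is the `♮`-map on the skew elements of `(A, σ)`, and `d` is its
multiplier. If `A = C₁ ⊗ C₂` over `k`, then `(s₁ + s₂)^♮ = s₁ - s₂` and `d = 1`. Otherwise there are
a quadratic field extension `E = k(√d)` and octonion algebras over `E` with `A_E = C₁ ⊗_E C₂`, and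
`♮` is the restriction to the skew elements of `A` of the map `s₁ + s₂ ↦ √d (s₁ - s₂)`. -/
inductive IsNatural (σ : A →ₗ[k] A) : (skew σ →ₗ[k] skew σ) → k → Prop
  | decomposable (f : skew σ →ₗ[k] skew σ) (D : BioctonionDecomposition σ)
      (hf : ∀ s : skew σ, D.Signs 1 (s : A) (f s : A)) : IsNatural σ f 1
  | quadratic (f : skew σ →ₗ[k] skew σ) (d : k) (E : Type u) [Field E] [Algebra k E]
      (hd : ¬ IsSquare d) (hE : Module.finrank k E = 2) (δ : E) (hδ : δ ^ 2 = algebraMap k E d)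
      (D : BioctonionDecomposition (σ.baseChange E))
      (hf : ∀ s : skew σ, D.Signs δ ((1 : E) ⊗ₜ[k] (s : A)) ((1 : E) ⊗ₜ[k] (f s : A))) :
      IsNatural σ f d

/-- The polynomial `N`, in the coordinates of the basis `b` of `A`, detects conjugate-invertibility:
over every extension field `K` of `k`, the conjugate-invertible elements of `A_K` are the ones
at which `N` does not vanish. -/
def DetectsInvertibility (σ : A →ₗ[k] A) {ι : Type*} [Fintype ι] (b : Module.Basis ι k A)
    (N : MvPolynomial ι k) : Prop :=
  ∀ (K : Type u) [Field K] [Algebra k K] (x : ι → K),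
    MvPolynomial.aeval x N ≠ 0 ↔ ConjInvertible (σ.baseChange K) (∑ i, x i ⊗ₜ[k] b i)

/-- `N` is the norm of `(A, σ)`, written in the coordinates of the basis `b`: a homogeneous
polynomial of minimal degree that detects conjugate-invertibility, with value `1` at `1`. -/
def IsNorm (σ : A →ₗ[k] A) {ι : Type*} [Fintype ι] (b : Module.Basis ι k A)
    (N : MvPolynomial ι k) : Prop :=
  (∃ n, N.IsHomogeneous n ∧
    ∀ (n' : ℕ) (N' : MvPolynomial ι k), N'.IsHomogeneous n' → DetectsInvertibility σ b N' → n ≤ n') ∧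
  DetectsInvertibility σ b N ∧ MvPolynomial.eval (b.repr 1) N = 1

end AlgebraWithInvolution

/-!
Over an extension field a bi-octonion algebra is a tensor product `C₁ ⊗ C₂`. For a skew element
`s = s₁ + s₂` of it let `J s = s₁ - s₂`, and let `q(s) = n(s₂) - n(s₁)`. The theorem rests on two
facts about the left multiplications `L_s` by skew elements, both consequences of the Moufang
identities (`tensor_mul_mul`, `tensor_opV_mul_tmul`) and collected, together with some auxiliary
identities, in the structure `SkewClifford`:

* `L_s L_{J s} = q(s) id`, so that the operators `L_s` behave as the generators of a Clifford
  algebra;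
* `V_{s x, y} (s z) = -s V_{x, s y} z`, so that `L_s` is a similarity of the triple product.

Consequently the quartic map `M_x` is covariant: passing from `x` to `s x` conjugates it, up to
scalars, by a reflection of the quadratic space `(S, q)` (`quarticMap_mul`). Hence the relation
`M_x² = ν(x) id` is inherited by `s x`, with `ν(s x) = q(s)⁴ ν(x)`, and it holds at `x = 1`
(`NormValue.mul`, `normValue_one`). The products of two skew elements span the algebra, so the orbit
of `1` under the `L_s` contains curves through `1` in every direction, and a polynomial relation
that holds on the orbit holds everywhere (`eq_zero_of_forall_mem`). This gives `M_x² = ν(x) id` for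
all `x` (`exists_normValue`), with an octic form `ν`. The same argument shows that
`J(M_x s) U_x(J(s) x)` is, up to the factor `-3 ν(x) q(s)`, a conjugate inverse of `x`, so `x` is
conjugate-invertible if `ν(x) ≠ 0`. Conversely, the identities of `SkewClifford` imply
`[V_{x,y}, V_{z,w}] = V_{V_{x,y} z, w} - V_{z, V_{y,x} w}`, the defining identity of structurable
algebras (`isTriplePair_opV`), by which `M_x` is injective if `x` is conjugate-invertible
(`eq_zero_of_quarticMap_eq_zero`).

If a map `f` on the skew elements over `k` is `δ` times the sign change `J` over an extension field,
with `δ² = d`, then the entries of the matrix of `M_x` are quartic forms over `k`, and its square is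
`d ν`; so `ν` is defined over `k` (`exists_detecting_form`).

That `ν` is the form of minimal degree, and the only one of degree eight, follows from its zeros on
one line. Over an algebraically closed field both octonion algebras contain multiplicative bases of
the same structure, generated by triples `i, j, l` and `i', j', l'`. The elements `i ⊗ i'`,
`j ⊗ j'`, `l ⊗ l'` are simultaneously diagonalized by linear forms, for all eight systems of signs
as eigenvalues (`exists_eigenforms`). A suitable combination of the three, shifted by the eight
values which these forms take on it, gives eight elements that are not conjugate-invertible on a
line in the direction of `1` (`exists_line`). A form that detects conjugate-invertibility therefore
has degree at least eight. If it has degree eight, its restriction to a generic line in the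
direction of `1` is separable, so its values are determined by its zeros
(`IsHomogeneous.eq_of_zeros`).

For the existence of a `♮`-map: the sign change `J` is determined up to a scalar by the property
that every `L_s L_{J s}` is scalar (`SkewClifford.exists_eq_smul`). This is a linear condition after
polarization, so some multiple `δ J` is defined over `k`, with `δ² ∈ k` (`exists_rational_natural`).
Over `k(δ)` the map `J` itself is rational; so are its eigenspaces, which generate the two octonion
factors, and the decomposition descends to `k(δ)` (`BioctonionDecomposition.exists_descent`).
-/

/-! ### Identities in octonion algebras -/

namespace OctonionAlgebra

variable {F : Type u} [Field F] (C : OctonionAlgebra F)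

/-- The polar form `n(x, y) = n(x + y) - n(x) - n(y)` of the norm, as a bilinear form. -/
def bil : LinearMap.BilinForm F C := QuadraticMap.polarBilin C.norm

theorem bil_def (x y : C) : C.bil x y = C.norm (x + y) - C.norm x - C.norm y := rfl

theorem bil_comm (x y : C) : C.bil x y = C.bil y x := by
  rw [bil_def, bil_def, add_comm x y]; ring

theorem norm_add (x y : C) : C.norm (x + y) = C.norm x + C.norm y + C.bil x y := by
  rw [bil_def]; ring

theorem bil_self (x : C) : C.bil x x = 2 * C.norm x := by
  rw [bil_def, ← two_smul F x, QuadraticMap.map_smul]; simp only [smul_eq_mul]; ring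

theorem eq_of_bil_eq {x y : C} (h : ∀ z, C.bil x z = C.bil y z) : x = y := by
  rw [← sub_eq_zero]
  apply C.nondegenerate.1
  intro z
  change C.bil (x - y) z = 0
  rw [map_sub, LinearMap.sub_apply, h, sub_self]

theorem exists_norm_ne_zero : ∃ x : C, C.norm x ≠ 0 := by
  by_contra! h
  have : ∀ x : C, x = 0 := fun x ↦ C.eq_of_bil_eq fun z ↦ by simp [bil_def, h]
  have h8 := C.finrank_eq
  have : Subsingleton C := ⟨fun a b ↦ by rw [this a, this b]⟩
  rw [Module.finrank_zero_of_subsingleton] at h8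
  omega

@[simp] theorem norm_one : C.norm 1 = 1 := by
  obtain ⟨x, hx⟩ := C.exists_norm_ne_zero
  have := C.norm_mul 1 x
  rw [one_mul] at this
  exact (mul_eq_right₀ hx).1 this.symm

theorem conj_apply (x : C) : C.conj x = C.bil x 1 • 1 - x := rfl

@[simp] theorem conj_one : C.conj 1 = 1 := by
  rw [conj_apply, bil_self, norm_one, mul_one, two_smul, add_sub_cancel_right]

theorem bil_mul_left (x y z : C) : C.bil (x * y) (x * z) = C.norm x * C.bil y z := by
  rw [bil_def, bil_def, ← mul_add, C.norm_mul, C.norm_mul, C.norm_mul]; ring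

theorem bil_mul_right (x y z : C) : C.bil (y * x) (z * x) = C.bil y z * C.norm x := by
  rw [bil_def, bil_def, ← add_mul, C.norm_mul, C.norm_mul, C.norm_mul]; ring

/-- The linearization of the composition law `n(x y) = n(x) n(y)` in both variables. -/
theorem bil_mul_add (x y z w : C) :
    C.bil (x * y) (z * w) + C.bil (z * y) (x * w) = C.bil x z * C.bil y w := by
  have h := C.bil_mul_left (x + z) y w
  rw [norm_add, add_mul, add_mul, map_add, map_add, LinearMap.add_apply, LinearMap.add_apply,
    bil_mul_left, bil_mul_left] at h
  linear_combination h

theorem bil_mul_add' (x y z w : C) :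
    C.bil (x * y) (z * w) + C.bil (x * w) (z * y) = C.bil x z * C.bil y w := by
  have h := C.bil_mul_right (y + w) x z
  rw [norm_add, mul_add, mul_add, map_add, map_add, LinearMap.add_apply, LinearMap.add_apply,
    bil_mul_right, bil_mul_right] at h
  linear_combination h

theorem bil_mul_adj_left (x y z : C) : C.bil (x * y) z = C.bil y (C.conj x * z) := by
  have h := C.bil_mul_add x y 1 z
  rw [one_mul, one_mul] at h
  rw [conj_apply, sub_mul, smul_mul_assoc, one_mul, map_sub, map_smul, smul_eq_mul]
  linear_combination h

theorem bil_mul_adj_right (x y z : C) : C.bil (x * y) z = C.bil x (z * C.conj y) := by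
  have h := C.bil_mul_add' x y z 1
  rw [mul_one, mul_one] at h
  rw [conj_apply, mul_sub, mul_smul_comm, mul_one, map_sub, map_smul, smul_eq_mul]
  linear_combination h

@[simp] theorem conj_conj (x : C) : C.conj (C.conj x) = x := by
  rw [conj_apply C x, map_sub, map_smul, conj_one, conj_apply, sub_sub_cancel]

theorem bil_conj (x y : C) : C.bil (C.conj x) y = C.bil x (C.conj y) := by
  have h1 := C.bil_mul_adj_left x 1 y
  have h2 := C.bil_mul_adj_left (C.conj x) 1 (C.conj y)
  rw [mul_one] at h1 h2
  simp only [conj_apply, map_sub, map_smul, LinearMap.sub_apply, LinearMap.smul_apply,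
    smul_eq_mul]
  rw [C.bil_comm 1 y]; ring

theorem bil_conj_conj (x y : C) : C.bil (C.conj x) (C.conj y) = C.bil x y := by
  rw [bil_conj, conj_conj]

@[simp] theorem norm_conj (x : C) : C.norm (C.conj x) = C.norm x := by
  rw [conj_apply, sub_eq_add_neg, norm_add, QuadraticMap.map_smul, QuadraticMap.map_neg, norm_one,
    map_neg, map_smul, LinearMap.smul_apply, C.bil_comm 1 x]
  simp only [smul_eq_mul]; ring

theorem conj_mul_mul (x y : C) : C.conj x * (x * y) = C.norm x • y := by
  apply C.eq_of_bil_eq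
  intro z
  rw [bil_mul_adj_left, conj_conj, bil_mul_left, map_smul, LinearMap.smul_apply, smul_eq_mul]

theorem mul_mul_conj (x y : C) : (y * x) * C.conj x = C.norm x • y := by
  apply C.eq_of_bil_eq
  intro z
  rw [bil_mul_adj_right, conj_conj, bil_mul_right, map_smul, LinearMap.smul_apply, smul_eq_mul,
    mul_comm]

theorem mul_conj_mul (x y : C) : x * (C.conj x * y) = C.norm x • y := by
  have := C.conj_mul_mul (C.conj x) y
  rwa [conj_conj, norm_conj] at this

theorem mul_conj_mul' (x y : C) : (y * C.conj x) * x = C.norm x • y := by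
  have := C.mul_mul_conj (C.conj x) y
  rwa [conj_conj, norm_conj] at this

theorem mul_conj_self (x : C) : x * C.conj x = C.norm x • 1 := by
  have := C.mul_conj_mul x 1
  rwa [mul_one] at this

theorem conj_mul (x y : C) : C.conj (x * y) = C.conj y * C.conj x := by
  apply C.eq_of_bil_eq
  intro z
  rw [bil_conj, bil_mul_adj_left, bil_mul_adj_left, conj_conj, bil_comm C _ (y * z),
    bil_mul_adj_right, ← bil_conj_conj]

/-- The linearization of `x (x̄ z) = n(x) z`. -/
theorem mul_conj_mul_add (x y z : C) :
    x * (C.conj y * z) + y * (C.conj x * z) = C.bil x y • z := by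
  have h := C.mul_conj_mul (x + y) z
  rw [map_add, add_mul, add_mul, mul_add, mul_add, mul_conj_mul, mul_conj_mul, norm_add, add_smul,
    add_smul] at h
  rw [← sub_eq_zero] at h ⊢
  rw [← h]; abel

/-- The linearization of `(z x̄) x = n(x) z`. -/
theorem mul_conj_mul_add' (x y z : C) :
    (z * C.conj x) * y + (z * C.conj y) * x = C.bil x y • z := by
  have h := C.mul_conj_mul' (x + y) z
  rw [map_add, mul_add, mul_add, add_mul, add_mul, mul_conj_mul', mul_conj_mul', norm_add, add_smul,
    add_smul] at h
  rw [← sub_eq_zero] at h ⊢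
  rw [← h]; abel

theorem mul_conj_add (x y : C) : x * C.conj y + y * C.conj x = C.bil x y • 1 := by
  have := C.mul_conj_mul_add x y 1
  rwa [mul_one, mul_one] at this

/-- The linearized left alternative law. -/
theorem mul_mul_add (x y z : C) : x * (y * z) + y * (x * z) = (x * y + y * x) * z := by
  have h := C.mul_conj_mul_add x y z
  have h' := congrArg (· * z) (C.mul_conj_add x y)
  simp only [smul_mul_assoc, one_mul] at h'
  rw [← h] at h'
  simp only [conj_apply, mul_sub, sub_mul, add_mul, mul_smul_comm, smul_mul_assoc, one_mul,
    mul_one] at h' ⊢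
  rw [← sub_eq_zero] at h' ⊢
  rw [← h']; abel

/-- The linearized right alternative law. -/
theorem mul_mul_add' (x y z : C) : (z * x) * y + (z * y) * x = z * (x * y + y * x) := by
  have h := C.mul_conj_mul_add' x y z
  have h' := congrArg (z * ·) (C.mul_conj_add x y)
  simp only [mul_smul_comm, mul_one] at h'
  rw [← h] at h'
  simp only [conj_apply, mul_sub, sub_mul, mul_add, mul_smul_comm, smul_mul_assoc, mul_one] at h' ⊢
  rw [← sub_eq_zero] at h' ⊢
  rw [← h']; abel

theorem assoc_swap_left (x y z : C) : (x * y) * z - x * (y * z) = y * (x * z) - (y * x) * z := by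
  have h := C.mul_mul_add x y z
  rw [add_mul] at h
  rw [← sub_eq_zero] at h ⊢
  rw [← neg_eq_zero, ← h]; abel

theorem assoc_swap_right (x y z : C) : (x * y) * z - x * (y * z) = x * (z * y) - (x * z) * y := by
  have h := C.mul_mul_add' y z x
  rw [mul_add] at h
  rw [← sub_eq_zero] at h ⊢
  rw [← h]; abel

theorem assoc_cycle (x y z : C) : (x * y) * z - x * (y * z) = (y * z) * x - y * (z * x) := by
  rw [assoc_swap_left, ← neg_sub, assoc_swap_right, neg_sub]

/-- A form of the middle Moufang identity. -/
theorem mul_mul_middle (s x y : C) :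
    (s * x) * (y * s) = C.bil s (C.conj (x * y)) • s - C.norm s • C.conj (x * y) := by
  apply C.eq_of_bil_eq
  intro w
  have h := C.bil_mul_add s x w (C.conj s * C.conj y)
  rw [mul_conj_mul, map_smul, smul_eq_mul] at h
  rw [bil_mul_adj_right, conj_mul]
  have h1 : C.bil (w * x) (C.conj y) = C.bil (C.conj (x * y)) w := by
    rw [bil_mul_adj_right, conj_mul, bil_comm]
  have h2 : C.bil x (C.conj s * C.conj y) = C.bil s (C.conj (x * y)) := by
    rw [bil_comm, bil_mul_adj_right, conj_conj, bil_conj]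
  simp only [map_sub, map_smul, LinearMap.sub_apply, LinearMap.smul_apply, smul_eq_mul]
  rw [← h1, ← h2]
  linear_combination h

/-- The expression `(x (ȳ s)) z - (x ȳ) (s z)`. For `s` skew it is an alternating function of `x`,
`y`, `z`, which reduces the products that occur in the triple product to few of them. -/
def defect (s x y z : C) : C := (x * (C.conj y * s)) * z - (x * C.conj y) * (s * z)

theorem defect_swap_left (s x y z : C) : C.defect s y x z = -C.defect s x y z := by
  have h1 := congrArg (· * z) (C.mul_conj_mul_add x y s)
  have h2 := congrArg (· * (s * z)) (C.mul_conj_add x y)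
  simp only [smul_mul_assoc, one_mul] at h1 h2
  rw [← h2, add_mul, add_mul, ← sub_eq_zero] at h1
  rw [defect, defect, ← sub_eq_zero, ← h1]; abel

theorem mul_mul_sum (s x y z : C) : s * ((x * C.conj y) * z) + (x * C.conj y) * (s * z) =
    ((s * x) * C.conj y) * z + (x * (C.conj y * s)) * z := by
  rw [mul_mul_add, ← add_mul]
  congr 1
  have := C.assoc_cycle s x (C.conj y)
  rw [sub_eq_sub_iff_add_eq_add] at this
  rw [this]; abel

theorem mul_mul_sub (s x y z : C) : s * ((x * C.conj y) * z) - ((s * x) * C.conj y) * z =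
    C.defect s x y z := by
  rw [defect, sub_eq_sub_iff_add_eq_add, mul_mul_sum]; abel

section Skew

variable {C} {s : C} (hs : C.conj s = -s)
include hs

theorem bil_one_of_skew : C.bil s 1 = 0 := by
  have h : C.bil s 1 • (1 : C) = 0 := by
    have := C.conj_apply s
    rw [hs] at this
    rw [eq_add_of_sub_eq this.symm, neg_add_cancel]
  rcases smul_eq_zero.1 h with h | h
  · exact h
  · have h1 := C.norm_one
    rw [h, QuadraticMap.map_zero] at h1
    exact absurd h1 zero_ne_one

theorem skew_mul_mul (x : C) : s * (s * x) = -(C.norm s • x) := by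
  have := C.conj_mul_mul s x
  rw [hs, neg_mul] at this
  rw [← this, neg_neg]

theorem bil_skew_mul (x y : C) : C.bil (s * x) y = -C.bil x (s * y) := by
  rw [bil_mul_adj_left, hs, neg_mul, map_neg]

theorem skew_anticomm (x : C) : s * x + x * s = C.bil x 1 • s - C.bil x s • 1 := by
  have := C.mul_conj_add x s
  rw [hs, conj_apply, mul_sub, mul_smul_comm, mul_one] at this
  rw [← this, mul_neg]; abel

theorem skew_mul_mul_sum (x y z : C) : s * ((x * C.conj y) * z) + (x * C.conj y) * (s * z) =
    C.bil x y • (s * z) - C.bil x (s * y) • z := by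
  rw [mul_mul_add, skew_anticomm hs, bil_mul_adj_right, bil_mul_adj_right, conj_conj, one_mul,
    sub_mul, smul_mul_assoc, smul_mul_assoc, one_mul]

theorem defect_swap_outer (x y z : C) : C.defect s z y x = -C.defect s x y z := by
  have h1 : ∀ a b c : C, (a * C.conj b) * c + (c * C.conj b) * a =
      C.bil a b • c + C.bil b c • a - C.bil a c • b := by
    intro a b c
    have e1 := C.mul_conj_mul_add' b a c
    have e2 := congrArg (· * b) (C.mul_conj_add a c)
    have e3 := C.mul_conj_mul_add' b c a
    simp only [smul_mul_assoc, one_mul, add_mul] at e2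
    rw [C.bil_comm a b, ← e1, ← e2, ← e3]; abel
  have e1 := h1 x (-(s * y)) z
  have e2 := C.mul_conj_mul_add' y (s * z) x
  have e3 := C.mul_conj_mul_add' y (s * x) z
  have e5 := congrArg (· * y) (C.mul_conj_mul_add x z s)
  have c1 : C.bil y (s * z) = - C.bil (s * y) z := by rw [bil_skew_mul hs, neg_neg]
  have c2 : C.bil y (s * x) = - C.bil x (s * y) := by rw [bil_comm, bil_skew_mul hs]
  simp only [smul_mul_assoc, add_mul, c1, c2, conj_mul, hs, mul_neg, neg_mul, map_neg,
    LinearMap.neg_apply, neg_neg] at e1 e2 e3 e5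
  rw [defect, defect]
  linear_combination (norm := module) e1 - e2 - e3 - e5

/-- A consequence of the Moufang identities: two factors `s` on the left-hand side are absorbed into
the product `(s x) ȳ` and the factor `s z`. -/
theorem skew_moufang_left (x y z : C) :
    s * ((x * (C.conj y * s)) * z) = ((s * x) * C.conj y) * (s * z) := by
  have h1 := C.mul_mul_sum s (s * x) y z
  have h2 := C.mul_mul_middle s x (C.conj y)
  have h3 := skew_anticomm hs (x * C.conj y)
  have h4 := C.assoc_cycle s x (C.conj y)
  have e1 : (s * x) * C.conj y =
      C.bil (x * C.conj y) 1 • s - C.bil (x * C.conj y) s • 1 - x * (C.conj y * s) := by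
    rw [← h3]
    linear_combination (norm := module) h4
  have e2 : s * ((x * (C.conj y * s)) * z) =
    s * ((C.bil (x * C.conj y) 1 • s - C.bil (x * C.conj y) s • 1) * z) -
      s * (((s * x) * C.conj y) * z) := by
    rw [← mul_sub, ← sub_mul, e1, sub_sub_cancel]
  have e3 := C.bil_conj (x * C.conj y) s
  rw [hs, map_neg] at e3
  rw [h2, skew_mul_mul hs] at h1
  rw [C.bil_comm s, e3, conj_apply C (x * C.conj y)] at h1
  rw [e2]
  simp only [mul_sub, sub_mul, mul_smul_comm, smul_mul_assoc, one_mul, neg_mul,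
    skew_mul_mul hs] at h1 ⊢
  linear_combination (norm := module) -h1

/-- The counterpart of `skew_moufang_left` for the other two terms of the triple product. -/
theorem skew_moufang_right (x y z : C) :
    ((s * z) * (C.conj x * s)) * y = s * ((z * C.conj x) * (s * y)) := by
  have h2 := C.mul_mul_middle s z (C.conj x)
  have h1 := C.mul_mul_add s (z * C.conj x) y
  have h3 := skew_anticomm hs (z * C.conj x)
  have e3 := C.bil_conj (z * C.conj x) s
  rw [hs, map_neg] at e3
  rw [h2, C.bil_comm s, e3, conj_apply C (z * C.conj x)]
  rw [h3] at h1
  rw [eq_sub_of_add_eq' h1]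
  simp only [mul_sub, sub_mul, mul_smul_comm, smul_mul_assoc, one_mul,
    skew_mul_mul hs]
  module

end Skew
end OctonionAlgebra

/-! ### Tensor products of two octonion algebras -/

namespace OctonionAlgebra

variable {F : Type u} [Field F] (C₁ C₂ : OctonionAlgebra F)

section Pure
variable {C : OctonionAlgebra F} {s : C} (hs : C.conj s = -s)
include hs

theorem skew_mul_sub_mul (x y z : C) :
    ((s * z) * C.conj x) * y - (z * C.conj x) * (s * y) =
      (s * ((x * C.conj y) * z) + (x * C.conj y) * (s * z)) -
      (s * ((z * C.conj y) * x) + (z * C.conj y) * (s * x)) := by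
  have e1 := C.mul_conj_mul_add' x y (s * z)
  have e2 := C.mul_conj_mul_add' x (s * y) z
  simp only [conj_mul, hs, mul_neg, neg_mul] at e2
  rw [skew_mul_mul_sum hs x y z, mul_mul_sum]
  linear_combination (norm := module) e1 - e2

/-- The eight products in one octonion factor which occur in the expansion of
`V_{s x, y} (s z) + s V_{x, s y} z`, reduced to five of them. -/
theorem skew_products (x y z : C) :
    ∃ P S S' : C,
      (x * (C.conj y * s)) * z = (x * C.conj y) * (s * z) + P ∧
      ((s * x) * C.conj y) * z = S - (x * C.conj y) * (s * z) - P ∧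
      s * ((x * C.conj y) * z) = S - (x * C.conj y) * (s * z) ∧
      (z * (C.conj y * s)) * x = (z * C.conj y) * (s * x) - P ∧
      ((s * z) * C.conj y) * x = S' - (z * C.conj y) * (s * x) + P ∧
      s * ((z * C.conj y) * x) = S' - (z * C.conj y) * (s * x) ∧
      (z * (C.conj x * s)) * y = (z * C.conj x) * (s * y) + P ∧
      ((s * z) * C.conj x) * y = (z * C.conj x) * (s * y) + S - S' ∧
      s * ((z * C.conj x) * y) = (z * C.conj x) * (s * y) + P + S - S' := by
  have a1 : C.defect s z y x = -C.defect s x y z := defect_swap_outer hs x y z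
  have a2 : C.defect s z x y = C.defect s x y z := by
    rw [C.defect_swap_left s x z y, defect_swap_outer hs y z x, C.defect_swap_left s z y x, a1,
      neg_neg, neg_neg]
  have b1 := mul_mul_sub C s x y z
  have b2 := mul_mul_sub C s z y x
  have b3 := mul_mul_sub C s z x y
  have b4 := skew_mul_sub_mul hs x y z
  rw [a1] at b2
  rw [a2] at b3
  rw [defect] at a1 a2
  refine ⟨C.defect s x y z, s * ((x * C.conj y) * z) + (x * C.conj y) * (s * z),
    s * ((z * C.conj y) * x) + (z * C.conj y) * (s * x), ?_, ?_, ?_, ?_, ?_, ?_, ?_, ?_, ?_⟩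
  · rw [defect]; abel
  · rw [← b1]; abel
  · abel
  · rw [← neg_neg (C.defect s x y z), ← a1]; abel
  · rw [← neg_neg (C.defect s x y z), ← b2]; abel
  · abel
  · rw [← a2]; abel
  · linear_combination (norm := module) b4
  · linear_combination (norm := module) b3 + b4

/-- The products in one octonion factor which occur in the expansion of
`V_{x, y} (s z) + s V_{y, x} z + ψ(x, s y) z`, expressed through few of them. -/
theorem skew_products_add (x y z : C) :
    ∃ P : C,
      (x * (C.conj y * s)) * z = (x * C.conj y) * (s * z) + P ∧
      ((s * z) * C.conj y) * x = s * ((z * C.conj y) * x) + P ∧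
      ((s * z) * C.conj x) * y = s * ((z * C.conj x) * y) - P ∧
      ((s * y) * C.conj x) * z = s * ((y * C.conj x) * z) + P ∧
      (z * C.conj x) * y = C.bil x y • z - (z * C.conj y) * x ∧
      (y * C.conj x) * z = C.bil x y • z - (x * C.conj y) * z := by
  obtain ⟨P, S, S', a1, a2, a3, a4, a5, a6, a7, a8, a9⟩ := skew_products hs x y z
  have b1 := mul_mul_sub C s y x z
  have b2 : C.defect s x y z = P := by rw [defect, a1]; abel
  rw [C.defect_swap_left s x y z, b2] at b1
  refine ⟨P, a1, ?_, ?_, ?_, ?_, ?_⟩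
  · rw [a5, a6]
  · rw [a8, a9]; abel
  · linear_combination (norm := abel) -b1
  · rw [← C.mul_conj_mul_add' x y z]; abel
  · have := congrArg (· * z) (C.mul_conj_add x y)
    simp only [add_mul, smul_mul_assoc, one_mul] at this
    rw [← this]; abel

end Pure

/-- The canonical involution of the tensor product of two octonion algebras. -/
abbrev tensorConj : C₁ ⊗[F] C₂ →ₗ[F] C₁ ⊗[F] C₂ := TensorProduct.map C₁.conj C₂.conj

theorem isInvolution_tensorConj : IsInvolution (tensorConj C₁ C₂) where
  involutive x := by
    induction x using TensorProduct.induction_on with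
    | zero => simp
    | tmul a b => simp
    | add x y hx hy => rw [map_add, map_add, hx, hy]
  map_mul x y := by
    induction x using TensorProduct.induction_on with
    | zero => simp
    | add x y hx hy => rw [add_mul, map_add, map_add, mul_add, hx, hy]
    | tmul a b =>
      induction y using TensorProduct.induction_on with
      | zero => simp
      | add x y hx hy => rw [mul_add, map_add, map_add, add_mul, hx, hy]
      | tmul c d => simp [conj_mul]

variable {C₁ C₂}

/-- The skew elements of a tensor product of two octonion algebras are the sums of skew elements of
the factors. -/
theorem exists_of_tensorConj_eq_neg (h2 : (2 : F) ≠ 0) {x : C₁ ⊗[F] C₂}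
    (hx : tensorConj C₁ C₂ x = -x) :
    ∃ (s₁ : C₁) (s₂ : C₂), C₁.conj s₁ = -s₁ ∧ C₂.conj s₂ = -s₂ ∧
      x = s₁ ⊗ₜ[F] (1 : C₂) + (1 : C₁) ⊗ₜ[F] s₂ := by
  -- from `a + ā = t(a)` and `b + b̄ = t(b)` one has
  -- `2 (a ⊗ b - ā ⊗ b̄) = t(b) (a - ā) ⊗ 1 + t(a) 1 ⊗ (b - b̄)`
  have key : ∀ y : C₁ ⊗[F] C₂, ∃ (s₁ : C₁) (s₂ : C₂), C₁.conj s₁ = -s₁ ∧ C₂.conj s₂ = -s₂ ∧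
      (2 : F) • (y - tensorConj C₁ C₂ y) = s₁ ⊗ₜ[F] (1 : C₂) + (1 : C₁) ⊗ₜ[F] s₂ := by
    intro y
    induction y using TensorProduct.induction_on with
    | zero => exact ⟨0, 0, by simp, by simp, by simp⟩
    | add x y hx hy =>
      obtain ⟨s₁, s₂, h1, h2, h3⟩ := hx
      obtain ⟨t₁, t₂, k1, k2, k3⟩ := hy
      refine ⟨s₁ + t₁, s₂ + t₂, ?_, ?_, ?_⟩
      · rw [map_add, h1, k1]; abel
      · rw [map_add, h2, k2]; abel
      · rw [map_add, TensorProduct.add_tmul, TensorProduct.tmul_add]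
        linear_combination (norm := module) h3 + k3
    | tmul a b =>
      refine ⟨C₂.bil b 1 • (a - C₁.conj a), C₁.bil a 1 • (b - C₂.conj b), ?_, ?_, ?_⟩
      · rw [map_smul, map_sub, conj_conj, ← smul_neg, neg_sub]
      · rw [map_smul, map_sub, conj_conj, ← smul_neg, neg_sub]
      · have ha : C₁.conj a = C₁.bil a 1 • 1 - a := rfl
        have hb : C₂.conj b = C₂.bil b 1 • 1 - b := rfl
        rw [TensorProduct.map_tmul, ha, hb]
        simp only [TensorProduct.sub_tmul, TensorProduct.tmul_sub, ← TensorProduct.smul_tmul',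
          TensorProduct.tmul_smul, smul_sub]
        module
  obtain ⟨s₁, s₂, h1, h3, h4⟩ := key x
  refine ⟨(4 : F)⁻¹ • s₁, (4 : F)⁻¹ • s₂, by rw [map_smul, h1, smul_neg],
    by rw [map_smul, h3, smul_neg], ?_⟩
  rw [TensorProduct.tmul_smul, ← TensorProduct.smul_tmul', ← smul_add, ← h4, hx]
  have h4 : (4 : F) ≠ 0 := by
    have : (4 : F) = 2 * 2 := by norm_num
    rw [this]; exact mul_ne_zero h2 h2
  rw [eq_inv_smul_iff₀ h4]
  module

/-- The elements `s₁ ⊗ 1 + 1 ⊗ s₂` associate with all others in an alternating way, since each of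
them involves one octonion factor at a time. -/
theorem tensor_assoc_swap (s₁ : C₁) (s₂ : C₂) (x y : C₁ ⊗[F] C₂) :
    ((s₁ ⊗ₜ[F] (1 : C₂) + (1 : C₁) ⊗ₜ[F] s₂) * x) * y -
      (s₁ ⊗ₜ[F] (1 : C₂) + (1 : C₁) ⊗ₜ[F] s₂) * (x * y) =
    x * ((s₁ ⊗ₜ[F] (1 : C₂) + (1 : C₁) ⊗ₜ[F] s₂) * y) -
      (x * (s₁ ⊗ₜ[F] (1 : C₂) + (1 : C₁) ⊗ₜ[F] s₂)) * y := by
  induction x using TensorProduct.induction_on with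
  | zero => simp
  | add x x' hx hy =>
    generalize s₁ ⊗ₜ[F] (1 : C₂) + (1 : C₁) ⊗ₜ[F] s₂ = s at *
    simp only [mul_add, add_mul] at hx hy ⊢
    linear_combination (norm := abel) hx + hy
  | tmul a b =>
    induction y using TensorProduct.induction_on with
    | zero => simp
    | add x x' hx hy =>
      generalize s₁ ⊗ₜ[F] (1 : C₂) + (1 : C₁) ⊗ₜ[F] s₂ = s at *
      simp only [mul_add] at hx hy ⊢
      linear_combination (norm := abel) hx + hy
    | tmul c d =>
      have e1 := congrArg (· ⊗ₜ[F] (b * d)) (C₁.assoc_swap_left s₁ a c)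
      have e2 := congrArg ((a * c) ⊗ₜ[F] ·) (C₂.assoc_swap_left s₂ b d)
      simp only [TensorProduct.sub_tmul, TensorProduct.tmul_sub] at e1 e2
      simp only [add_mul, mul_add, Algebra.TensorProduct.tmul_mul_tmul, one_mul, mul_one]
      linear_combination (norm := abel) e1 + e2

theorem tensor_assoc_cycle (s₁ : C₁) (s₂ : C₂) (x y : C₁ ⊗[F] C₂) :
    ((s₁ ⊗ₜ[F] (1 : C₂) + (1 : C₁) ⊗ₜ[F] s₂) * x) * y -
      (s₁ ⊗ₜ[F] (1 : C₂) + (1 : C₁) ⊗ₜ[F] s₂) * (x * y) =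
    (x * y) * (s₁ ⊗ₜ[F] (1 : C₂) + (1 : C₁) ⊗ₜ[F] s₂) -
      x * (y * (s₁ ⊗ₜ[F] (1 : C₂) + (1 : C₁) ⊗ₜ[F] s₂)) := by
  induction x using TensorProduct.induction_on with
  | zero => simp
  | add x x' hx hy =>
    generalize s₁ ⊗ₜ[F] (1 : C₂) + (1 : C₁) ⊗ₜ[F] s₂ = s at *
    simp only [mul_add, add_mul] at hx hy ⊢
    linear_combination (norm := abel) hx + hy
  | tmul a b =>
    induction y using TensorProduct.induction_on with
    | zero => simp
    | add x x' hx hy =>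
      generalize s₁ ⊗ₜ[F] (1 : C₂) + (1 : C₁) ⊗ₜ[F] s₂ = s at *
      simp only [mul_add, add_mul] at hx hy ⊢
      linear_combination (norm := abel) hx + hy
    | tmul c d =>
      have e1 := congrArg (· ⊗ₜ[F] (b * d)) (C₁.assoc_cycle s₁ a c)
      have e2 := congrArg ((a * c) ⊗ₜ[F] ·) (C₂.assoc_cycle s₂ b d)
      simp only [TensorProduct.sub_tmul, TensorProduct.tmul_sub] at e1 e2
      simp only [add_mul, mul_add, Algebra.TensorProduct.tmul_mul_tmul, one_mul, mul_one]
      linear_combination (norm := abel) e1 + e2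

section
variable {s₁ : C₁} {s₂ : C₂} (h₁ : C₁.conj s₁ = -s₁) (h₂ : C₂.conj s₂ = -s₂)
include h₁ h₂

/-- The Clifford relation of the left multiplications by `s₁ + s₂` and `s₁ - s₂`: the mixed terms
cancel. -/
theorem tensor_mul_mul (x : C₁ ⊗[F] C₂) :
    (s₁ ⊗ₜ[F] (1 : C₂) + (1 : C₁) ⊗ₜ[F] s₂) * ((s₁ ⊗ₜ[F] (1 : C₂) - (1 : C₁) ⊗ₜ[F] s₂) * x) =
      (C₂.norm s₂ - C₁.norm s₁) • x := by
  induction x using TensorProduct.induction_on with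
  | zero => simp
  | add x y hx hy => rw [mul_add, mul_add, hx, hy, smul_add]
  | tmul a b =>
    simp only [sub_mul, add_mul, mul_sub, Algebra.TensorProduct.tmul_mul_tmul, one_mul,
      skew_mul_mul h₁, skew_mul_mul h₂, TensorProduct.neg_tmul, TensorProduct.tmul_neg,
      ← TensorProduct.smul_tmul', TensorProduct.tmul_smul]
    module

/-- Left multiplication by a skew element is a similarity of the triple product, on pure tensors.
The terms in which both factors `s` come from the same octonion algebra agree by the Moufang
identities, and the mixed terms cancel by `skew_products`. -/
theorem tensor_opV_mul_tmul (x₁ y₁ z₁ : C₁) (x₂ y₂ z₂ : C₂) :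
    opV (tensorConj C₁ C₂) ((s₁ ⊗ₜ[F] (1 : C₂) + (1 : C₁) ⊗ₜ[F] s₂) * (x₁ ⊗ₜ[F] x₂))
      (y₁ ⊗ₜ[F] y₂) ((s₁ ⊗ₜ[F] (1 : C₂) + (1 : C₁) ⊗ₜ[F] s₂) * (z₁ ⊗ₜ[F] z₂)) =
    -((s₁ ⊗ₜ[F] (1 : C₂) + (1 : C₁) ⊗ₜ[F] s₂) * opV (tensorConj C₁ C₂) (x₁ ⊗ₜ[F] x₂)
      ((s₁ ⊗ₜ[F] (1 : C₂) + (1 : C₁) ⊗ₜ[F] s₂) * (y₁ ⊗ₜ[F] y₂)) (z₁ ⊗ₜ[F] z₂)) := by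
  obtain ⟨P, S, S', a1, a2, a3, a4, a5, a6, a7, a8, a9⟩ := skew_products h₁ x₁ y₁ z₁
  obtain ⟨Q, T, T', b1, b2, b3, b4, b5, b6, b7, b8, b9⟩ := skew_products h₂ x₂ y₂ z₂
  have m1 := skew_moufang_left h₁ x₁ y₁ z₁
  have m2 := skew_moufang_left h₁ z₁ y₁ x₁
  have m3 := skew_moufang_right h₁ x₁ y₁ z₁
  have n1 := skew_moufang_left h₂ x₂ y₂ z₂
  have n2 := skew_moufang_left h₂ z₂ y₂ x₂
  have n3 := skew_moufang_right h₂ x₂ y₂ z₂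
  simp only [opV, add_mul, mul_add, map_add, mul_sub, Algebra.TensorProduct.tmul_mul_tmul, one_mul,
    TensorProduct.map_tmul, conj_mul, h₁, h₂, mul_neg, neg_mul, TensorProduct.neg_tmul,
    TensorProduct.tmul_neg]
  rw [m1, m2, m3, n1, n2, n3]
  rw [a1, a2, a3, a4, a5, a6, a7, a8, a9, b1, b2, b3, b4, b5, b6, b7, b8, b9]
  simp only [TensorProduct.add_tmul, TensorProduct.tmul_add, TensorProduct.sub_tmul,
    TensorProduct.tmul_sub]
  abel

theorem tensor_opV_add_tmul (x₁ y₁ z₁ : C₁) (x₂ y₂ z₂ : C₂) :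
    opV (tensorConj C₁ C₂) (x₁ ⊗ₜ[F] x₂) (y₁ ⊗ₜ[F] y₂)
        ((s₁ ⊗ₜ[F] (1 : C₂) + (1 : C₁) ⊗ₜ[F] s₂) * (z₁ ⊗ₜ[F] z₂)) +
      (s₁ ⊗ₜ[F] (1 : C₂) + (1 : C₁) ⊗ₜ[F] s₂) *
        opV (tensorConj C₁ C₂) (y₁ ⊗ₜ[F] y₂) (x₁ ⊗ₜ[F] x₂) (z₁ ⊗ₜ[F] z₂) =
    -(opPsi (tensorConj C₁ C₂) (x₁ ⊗ₜ[F] x₂)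
      ((s₁ ⊗ₜ[F] (1 : C₂) + (1 : C₁) ⊗ₜ[F] s₂) * (y₁ ⊗ₜ[F] y₂)) * (z₁ ⊗ₜ[F] z₂)) := by
  obtain ⟨P, a1, a2, a3, a4, a5, a6⟩ := skew_products_add h₁ x₁ y₁ z₁
  obtain ⟨Q, b1, b2, b3, b4, b5, b6⟩ := skew_products_add h₂ x₂ y₂ z₂
  simp only [opV, opPsi, add_mul, mul_add, map_add, sub_mul, mul_sub,
    Algebra.TensorProduct.tmul_mul_tmul, one_mul,
    TensorProduct.map_tmul, conj_mul, h₁, h₂, mul_neg, neg_mul, TensorProduct.neg_tmul,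
    TensorProduct.tmul_neg]
  rw [a1, a2, a3, a4, b1, b2, b3, b4, a5, a6, b5, b6]
  simp only [TensorProduct.add_tmul, TensorProduct.tmul_add, TensorProduct.sub_tmul,
    TensorProduct.tmul_sub, mul_sub, mul_smul_comm, ← TensorProduct.smul_tmul',
    TensorProduct.tmul_smul]
  module

theorem tensor_opV_mul (x y z : C₁ ⊗[F] C₂) :
    opV (tensorConj C₁ C₂) ((s₁ ⊗ₜ[F] (1 : C₂) + (1 : C₁) ⊗ₜ[F] s₂) * x) y
      ((s₁ ⊗ₜ[F] (1 : C₂) + (1 : C₁) ⊗ₜ[F] s₂) * z) =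
    -((s₁ ⊗ₜ[F] (1 : C₂) + (1 : C₁) ⊗ₜ[F] s₂) * opV (tensorConj C₁ C₂) x
      ((s₁ ⊗ₜ[F] (1 : C₂) + (1 : C₁) ⊗ₜ[F] s₂) * y) z) := by
  have key := tensor_opV_mul_tmul h₁ h₂
  generalize s₁ ⊗ₜ[F] (1 : C₂) + (1 : C₁) ⊗ₜ[F] s₂ = s at *
  generalize tensorConj C₁ C₂ = τ at *
  simp only [opV] at key ⊢
  induction x using TensorProduct.induction_on with
  | zero => simp
  | add x x' hx hy =>
    simp only [mul_add, add_mul, map_add, mul_sub] at hx hy ⊢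
    linear_combination (norm := abel) hx + hy
  | tmul x₁ x₂ =>
    induction y using TensorProduct.induction_on with
    | zero => simp
    | add x x' hx hy =>
      simp only [mul_add, add_mul, map_add, mul_sub] at hx hy ⊢
      linear_combination (norm := abel) hx + hy
    | tmul y₁ y₂ =>
      induction z using TensorProduct.induction_on with
      | zero => simp
      | add x x' hx hy =>
        simp only [mul_add, add_mul, mul_sub] at hx hy ⊢
        linear_combination (norm := abel) hx + hy
      | tmul z₁ z₂ => exact key _ _ _ _ _ _

theorem tensor_opV_add (x y z : C₁ ⊗[F] C₂) :
    opV (tensorConj C₁ C₂) x y ((s₁ ⊗ₜ[F] (1 : C₂) + (1 : C₁) ⊗ₜ[F] s₂) * z) +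
      (s₁ ⊗ₜ[F] (1 : C₂) + (1 : C₁) ⊗ₜ[F] s₂) * opV (tensorConj C₁ C₂) y x z =
    -(opPsi (tensorConj C₁ C₂) x ((s₁ ⊗ₜ[F] (1 : C₂) + (1 : C₁) ⊗ₜ[F] s₂) * y) * z) := by
  have key := tensor_opV_add_tmul h₁ h₂
  generalize s₁ ⊗ₜ[F] (1 : C₂) + (1 : C₁) ⊗ₜ[F] s₂ = s at *
  generalize tensorConj C₁ C₂ = τ at *
  simp only [opV, opPsi] at key ⊢
  induction x using TensorProduct.induction_on with
  | zero => simp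
  | add x x' hx hy =>
    simp only [mul_add, add_mul, map_add, mul_sub, sub_mul] at hx hy ⊢
    linear_combination (norm := abel) hx + hy
  | tmul x₁ x₂ =>
    induction y using TensorProduct.induction_on with
    | zero => simp
    | add x x' hx hy =>
      simp only [mul_add, add_mul, map_add, mul_sub, sub_mul] at hx hy ⊢
      linear_combination (norm := abel) hx + hy
    | tmul y₁ y₂ =>
      induction z using TensorProduct.induction_on with
      | zero => simp
      | add x x' hx hy =>
        simp only [mul_add, add_mul, mul_sub] at hx hy ⊢
        linear_combination (norm := abel) hx + hy
      | tmul z₁ z₂ => exact key _ _ _ _ _ _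

end

end OctonionAlgebra

/-! ### Skew elements and the Clifford identities -/

namespace OctonionAlgebra

variable {F : Type u} [Field F] (C : OctonionAlgebra F)

/-- An orthogonal family of fewer than eight anisotropic vectors can be extended. -/
theorem exists_orthogonal (h2 : (2 : F) ≠ 0) {ι : Type*} [Fintype ι] (e : ι → C)
    (hn : ∀ i, C.norm (e i) ≠ 0) (ho : ∀ i j, i ≠ j → C.bil (e i) (e j) = 0)
    (hc : Fintype.card ι < 8) : ∃ l : C, (∀ i, C.bil l (e i) = 0) ∧ C.norm l ≠ 0 := by
  by_contra! h
  let π : C → C := fun x ↦ x - ∑ i, (C.bil x (e i) / C.bil (e i) (e i)) • e i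
  have hee : ∀ i, C.bil (e i) (e i) ≠ 0 := fun i ↦ by
    rw [bil_self]; exact mul_ne_zero h2 (hn i)
  have hπ : ∀ x i, C.bil (π x) (e i) = 0 := by
    intro x i
    simp only [π, map_sub, map_sum, map_smul, LinearMap.sub_apply, LinearMap.sum_apply,
      LinearMap.smul_apply, smul_eq_mul]
    rw [Finset.sum_eq_single i (fun j _ hj ↦ by rw [ho j i hj, mul_zero]) (by simp),
      div_mul_cancel₀ _ (hee i), sub_self]
  have h0 : ∀ x, π x = 0 := by
    intro x
    apply C.eq_of_bil_eq
    intro y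
    have hy : y = π y + ∑ i, (C.bil y (e i) / C.bil (e i) (e i)) • e i := by
      simp only [π, sub_add_cancel]
    have h1 : C.bil (π x) (π y) = 0 := by
      rw [bil_def, h _ (hπ x), h _ (hπ y), h _ fun i ↦ by
        rw [map_add, LinearMap.add_apply, hπ, hπ, add_zero]]
      ring
    rw [hy, map_add, h1, map_sum]
    simp [hπ]
  have hspan : Submodule.span F (Set.range e) = ⊤ := by
    rw [eq_top_iff]
    rintro x -
    have := h0 x
    rw [sub_eq_zero] at this
    rw [this]
    exact Submodule.sum_mem _ fun i _ ↦ Submodule.smul_mem _ _ (Submodule.subset_span ⟨i, rfl⟩)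
  have := finrank_range_le_card (R := F) e
  rw [Set.finrank, hspan, finrank_top, C.finrank_eq] at this
  omega

variable {C} in
theorem conj_eq_neg_iff {s : C} : C.conj s = -s ↔ C.bil s 1 = 0 :=
  ⟨bil_one_of_skew, fun h ↦ by rw [conj_apply, h, zero_smul, zero_sub]⟩

/-- There are two orthogonal anisotropic skew octonions. -/
theorem exists_skew_pair (h2 : (2 : F) ≠ 0) : ∃ e f : C, C.conj e = -e ∧ C.conj f = -f ∧
    C.bil e f = 0 ∧ C.norm e ≠ 0 ∧ C.norm f ≠ 0 := by
  obtain ⟨e, he, hne⟩ := C.exists_orthogonal h2 (ι := Fin 1) (fun _ ↦ 1) (by simp)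
    (fun i j h ↦ absurd (Subsingleton.elim i j) h) (by simp)
  have he1 := he 0
  obtain ⟨f, hf, hnf⟩ := C.exists_orthogonal h2 (ι := Fin 2) ![1, e]
    (fun i ↦ by fin_cases i <;> simp [hne])
    (fun i j h ↦ by fin_cases i <;> fin_cases j <;> simp_all [C.bil_comm 1 e]) (by simp)
  exact ⟨e, f, conj_eq_neg_iff.2 he1, conj_eq_neg_iff.2 (hf 0),
    by rw [bil_comm]; exact hf 1, hne, hnf⟩

/-- Octonions orthogonal to an anisotropic skew octonion `g` are products of a skew octonion with
`g`. Hence the products of skew octonions span. -/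
theorem mem_span_skew_mul_skew (h2 : (2 : F) ≠ 0) (x : C) :
    x ∈ Submodule.span F {x | ∃ s t : C, C.conj s = -s ∧ C.conj t = -t ∧ x = s * t} := by
  obtain ⟨e, f, he, hf, hef, hne, hnf⟩ := C.exists_skew_pair h2
  have key : ∀ (g : C), C.conj g = -g → C.norm g ≠ 0 → ∀ y, C.bil y g = 0 →
      y ∈ Submodule.span F {x | ∃ s t : C, C.conj s = -s ∧ C.conj t = -t ∧ x = s * t} := by
    intro g hg hng y hy
    apply Submodule.subset_span
    refine ⟨-((C.norm g)⁻¹ • (y * g)), g, ?_, hg, ?_⟩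
    · rw [conj_eq_neg_iff, map_neg, map_smul, LinearMap.neg_apply, LinearMap.smul_apply,
        bil_mul_adj_right, hg, one_mul, map_neg, hy]
      simp
    · have := C.mul_mul_conj g y
      rw [hg, mul_neg] at this
      rw [neg_mul, smul_mul_assoc, ← smul_neg, this, inv_smul_smul₀ hng]
  have hx : x = (x - (C.bil x e / C.bil e e) • e) + (C.bil x e / C.bil e e) • e := by abel
  rw [hx]
  refine Submodule.add_mem _ (key e he hne _ ?_) (Submodule.smul_mem _ _ (key f hf hnf _ hef))
  rw [map_sub, map_smul, LinearMap.sub_apply, LinearMap.smul_apply, smul_eq_mul,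
    div_mul_cancel₀, sub_self]
  rw [bil_self]; exact mul_ne_zero h2 hne

theorem exists_add_skew (h2 : (2 : F) ≠ 0) (x : C) :
    ∃ (a : F) (s : C), C.conj s = -s ∧ x = a • 1 + s := by
  refine ⟨C.bil x 1 / 2, x - (C.bil x 1 / 2) • 1, ?_, by abel⟩
  rw [conj_eq_neg_iff, map_sub, map_smul, LinearMap.sub_apply, LinearMap.smul_apply, bil_self,
    norm_one, smul_eq_mul, mul_one, div_mul_cancel₀ _ h2, sub_self]

end OctonionAlgebra

/-- The identities of an algebra with involution `(B, τ)` from which the matrix factorization is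
derived. The skew elements act by left multiplications, and `q` is a quadratic form on them with
`L_s L_{J s} = q(s) id`, so that `s ↦ (L_s, L_{J s})` generates a Clifford algebra on `B ⊕ B`. The
identity `opV_mul` says that `L_s` is a similarity of the triple product for `s` skew. The values of
`J` and `q` outside the skew elements are immaterial. -/
structure SkewClifford {F : Type u} [Field F] {B : Type u} [NonAssocRing B] [Module F B]
    (τ J : B →ₗ[F] B) (q : B → F) : Prop where
  inv : IsInvolution τ
  map_mem : ∀ s ∈ skew τ, J s ∈ skew τ
  map_map : ∀ s ∈ skew τ, J (J s) = s
  mul_mul : ∀ s ∈ skew τ, ∀ x, s * (J s * x) = q s • x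
  assoc_swap : ∀ s ∈ skew τ, ∀ x y, (s * x) * y - s * (x * y) = x * (s * y) - (x * s) * y
  assoc_cycle : ∀ s ∈ skew τ, ∀ x y, (s * x) * y - s * (x * y) = (x * y) * s - x * (y * s)
  opV_mul : ∀ s ∈ skew τ, ∀ x y z, opV τ (s * x) y (s * z) = -(s * opV τ x (s * y) z)
  opV_add : ∀ s ∈ skew τ, ∀ x y z,
    opV τ x y (s * z) + s * opV τ y x z = -(opPsi τ x (s * y) * z)
  span : Submodule.span F {x | ∃ s ∈ skew τ, ∃ t ∈ skew τ, x = s * t} = ⊤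
  exists_ne_zero : ∃ p ∈ skew τ, q p ≠ 0

namespace BioctonionDecomposition

variable {F : Type u} [Field F] {B : Type u} [NonAssocRing B] [Module F B] {τ : B →ₗ[F] B}
  (D : BioctonionDecomposition τ)

/-- The map `s₁ + s₂ ↦ s₁ - s₂` on the skew elements, extended to the whole algebra as
`x₁ ⊗ x₂ ↦ x₁ ⊗ x̄₂`. -/
def natural : B →ₗ[F] B :=
  D.iso.symm.toLinearMap ∘ₗ TensorProduct.map LinearMap.id D.C₂.conj ∘ₗ D.iso.toLinearMap

theorem iso_natural (x : B) :
    D.iso (D.natural x) = TensorProduct.map LinearMap.id D.C₂.conj (D.iso x) := by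
  simp [natural]

theorem iso_one : D.iso 1 = 1 := by
  have h := D.map_mul (D.iso.symm 1) 1
  rw [mul_one, LinearEquiv.apply_symm_apply, one_mul] at h
  exact h.symm

theorem iso_opV (x y z : B) : D.iso (opV τ x y z) =
    opV (OctonionAlgebra.tensorConj D.C₁ D.C₂) (D.iso x) (D.iso y) (D.iso z) := by
  simp only [opV, map_add, map_sub, D.map_mul, D.map_conj]

theorem iso_opPsi (x y : B) : D.iso (opPsi τ x y) =
    opPsi (OctonionAlgebra.tensorConj D.C₁ D.C₂) (D.iso x) (D.iso y) := by
  simp only [opPsi, map_sub, D.map_mul, D.map_conj]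

theorem mem_skew_iff (x : B) :
    x ∈ skew τ ↔ OctonionAlgebra.tensorConj D.C₁ D.C₂ (D.iso x) = -D.iso x := by
  rw [← D.map_conj, ← map_neg, D.iso.injective.eq_iff]; rfl

theorem exists_of_mem_skew (h2 : (2 : F) ≠ 0) {x : B} (hx : x ∈ skew τ) :
    ∃ (s₁ : D.C₁) (s₂ : D.C₂), D.C₁.conj s₁ = -s₁ ∧ D.C₂.conj s₂ = -s₂ ∧
      D.iso x = s₁ ⊗ₜ[F] (1 : D.C₂) + (1 : D.C₁) ⊗ₜ[F] s₂ :=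
  OctonionAlgebra.exists_of_tensorConj_eq_neg h2 ((D.mem_skew_iff x).1 hx)

theorem mem_skew_of_eq {x : B} {s₁ : D.C₁} {s₂ : D.C₂} (h₁ : D.C₁.conj s₁ = -s₁)
    (h₂ : D.C₂.conj s₂ = -s₂) (h : D.iso x = s₁ ⊗ₜ[F] (1 : D.C₂) + (1 : D.C₁) ⊗ₜ[F] s₂) :
    x ∈ skew τ := by
  rw [D.mem_skew_iff, h, map_add, TensorProduct.map_tmul, TensorProduct.map_tmul, h₁, h₂,
    OctonionAlgebra.conj_one, OctonionAlgebra.conj_one, TensorProduct.neg_tmul,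
    TensorProduct.tmul_neg, neg_add]

theorem iso_natural_eq {x : B} {s₁ : D.C₁} {s₂ : D.C₂} (h₂ : D.C₂.conj s₂ = -s₂)
    (h : D.iso x = s₁ ⊗ₜ[F] (1 : D.C₂) + (1 : D.C₁) ⊗ₜ[F] s₂) :
    D.iso (D.natural x) = s₁ ⊗ₜ[F] (1 : D.C₂) - (1 : D.C₁) ⊗ₜ[F] s₂ := by
  rw [D.iso_natural, h, map_add, TensorProduct.map_tmul, TensorProduct.map_tmul, h₂,
    OctonionAlgebra.conj_one, TensorProduct.tmul_neg, sub_eq_add_neg]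
  rfl

theorem natural_mem_skew (h2 : (2 : F) ≠ 0) {x : B} (hx : x ∈ skew τ) :
    D.natural x ∈ skew τ := by
  obtain ⟨s₁, s₂, h₁, h₂, h⟩ := D.exists_of_mem_skew h2 hx
  refine D.mem_skew_of_eq h₁ (s₂ := -s₂) (by rw [map_neg, h₂]) ?_
  rw [D.iso_natural_eq h₂ h, TensorProduct.tmul_neg, sub_eq_add_neg]

theorem natural_natural (x : B) : D.natural (D.natural x) = x := by
  apply D.iso.injective
  rw [D.iso_natural, D.iso_natural, ← LinearMap.comp_apply, ← TensorProduct.map_comp]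
  have : D.C₂.conj ∘ₗ D.C₂.conj = LinearMap.id := by ext y; simp
  rw [this]; simp

theorem natural_skew_mul (h2 : (2 : F) ≠ 0) {s : B} (hs : s ∈ skew τ) :
    ∃ c : F, ∀ x : B, s * (D.natural s * x) = c • x := by
  obtain ⟨s₁, s₂, h₁, h₂, h⟩ := D.exists_of_mem_skew h2 hs
  refine ⟨D.C₂.norm s₂ - D.C₁.norm s₁, fun x ↦ D.iso.injective ?_⟩
  rw [D.map_mul, D.map_mul, D.iso_natural_eq h₂ h, h, map_smul,
    OctonionAlgebra.tensor_mul_mul h₁ h₂]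

/-- The products of two skew elements span the algebra. -/
theorem span_skew_mul_skew (D : BioctonionDecomposition τ) (h2 : (2 : F) ≠ 0) :
    Submodule.span F {x | ∃ s ∈ skew τ, ∃ t ∈ skew τ, x = s * t} = ⊤ := by
  set W := Submodule.span F {x | ∃ s ∈ skew τ, ∃ t ∈ skew τ, x = s * t} with hW
  have hmem : ∀ {s₁ t₁ : D.C₁} {s₂ t₂ : D.C₂}, D.C₁.conj s₁ = -s₁ → D.C₁.conj t₁ = -t₁ →
      D.C₂.conj s₂ = -s₂ → D.C₂.conj t₂ = -t₂ →
      D.iso.symm ((s₁ ⊗ₜ[F] (1 : D.C₂) + (1 : D.C₁) ⊗ₜ[F] s₂) *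
        (t₁ ⊗ₜ[F] (1 : D.C₂) + (1 : D.C₁) ⊗ₜ[F] t₂)) ∈ W := by
    intro s₁ t₁ s₂ t₂ a b c d
    apply Submodule.subset_span
    refine ⟨D.iso.symm (s₁ ⊗ₜ[F] (1 : D.C₂) + (1 : D.C₁) ⊗ₜ[F] s₂),
      D.mem_skew_of_eq a c (LinearEquiv.apply_symm_apply _ _),
      D.iso.symm (t₁ ⊗ₜ[F] (1 : D.C₂) + (1 : D.C₁) ⊗ₜ[F] t₂),
      D.mem_skew_of_eq b d (LinearEquiv.apply_symm_apply _ _), D.iso.injective ?_⟩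
    rw [D.map_mul]
    simp
  have hl : ∀ a : D.C₁, D.iso.symm (a ⊗ₜ[F] (1 : D.C₂)) ∈ W := by
    intro a
    refine Submodule.span_induction (p := fun a _ ↦ D.iso.symm (a ⊗ₜ[F] (1 : D.C₂)) ∈ W)
      ?_ ?_ ?_ ?_ (D.C₁.mem_span_skew_mul_skew h2 a)
    · rintro _ ⟨s, t, hs, ht, rfl⟩
      simpa using hmem hs ht (s₂ := 0) (t₂ := 0) (by simp) (by simp)
    · simp
    · intro x y _ _ hx hy
      rw [TensorProduct.add_tmul, map_add]; exact W.add_mem hx hy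
    · intro c x _ hx
      rw [← TensorProduct.smul_tmul', map_smul]; exact W.smul_mem _ hx
  have hr : ∀ a : D.C₂, D.iso.symm ((1 : D.C₁) ⊗ₜ[F] a) ∈ W := by
    intro a
    refine Submodule.span_induction (p := fun a _ ↦ D.iso.symm ((1 : D.C₁) ⊗ₜ[F] a) ∈ W)
      ?_ ?_ ?_ ?_ (D.C₂.mem_span_skew_mul_skew h2 a)
    · rintro _ ⟨s, t, hs, ht, rfl⟩
      simpa using hmem (s₁ := 0) (t₁ := 0) (by simp) (by simp) hs ht
    · simp
    · intro x y _ _ hx hy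
      rw [TensorProduct.tmul_add, map_add]; exact W.add_mem hx hy
    · intro c x _ hx
      rw [TensorProduct.tmul_smul, map_smul]; exact W.smul_mem _ hx
  rw [eq_top_iff]
  rintro x -
  rw [← D.iso.symm_apply_apply x]
  induction D.iso x using TensorProduct.induction_on with
  | zero => simp
  | add x y hx hy => rw [map_add]; exact W.add_mem hx hy
  | tmul a b =>
    obtain ⟨α, s, hs, rfl⟩ := D.C₁.exists_add_skew h2 a
    obtain ⟨β, t, ht, rfl⟩ := D.C₂.exists_add_skew h2 b
    have h3 := hmem hs (t₁ := 0) (by simp) (s₂ := 0) (by simp) ht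
    simp only [TensorProduct.tmul_zero, TensorProduct.zero_tmul, add_zero, zero_add,
      Algebra.TensorProduct.tmul_mul_tmul, mul_one, one_mul] at h3
    rw [TensorProduct.add_tmul, TensorProduct.tmul_add s, TensorProduct.tmul_smul,
      ← TensorProduct.smul_tmul', map_add, map_add, map_smul, map_smul]
    exact W.add_mem (W.smul_mem _ (hr _)) (W.add_mem (W.smul_mem _ (hl _)) h3)

/-- A decomposition as a tensor product of octonion algebras provides the identities
`SkewClifford`. -/
theorem exists_skewClifford (h2 : (2 : F) ≠ 0) : ∃ q, SkewClifford τ D.natural q := by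
  classical
  choose! q hq using fun (s : B) (hs : s ∈ skew τ) ↦ D.natural_skew_mul h2 hs
  refine ⟨q, ⟨⟨?_, ?_⟩, fun s hs ↦ D.natural_mem_skew h2 hs, fun s _ ↦ D.natural_natural s,
    hq, ?_, ?_, ?_, ?_, D.span_skew_mul_skew h2, ?_⟩⟩
  · intro x
    apply D.iso.injective
    rw [D.map_conj, D.map_conj]
    exact (OctonionAlgebra.isInvolution_tensorConj _ _).involutive _
  · intro x y
    apply D.iso.injective
    rw [D.map_conj, D.map_mul, D.map_mul, D.map_conj, D.map_conj]
    exact (OctonionAlgebra.isInvolution_tensorConj _ _).map_mul _ _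
  · intro s hs x y
    obtain ⟨s₁, s₂, h₁, h₂, h⟩ := D.exists_of_mem_skew h2 hs
    apply D.iso.injective
    simp only [map_sub, D.map_mul, h]
    exact OctonionAlgebra.tensor_assoc_swap _ _ _ _
  · intro s hs x y
    obtain ⟨s₁, s₂, h₁, h₂, h⟩ := D.exists_of_mem_skew h2 hs
    apply D.iso.injective
    simp only [map_sub, D.map_mul, h]
    exact OctonionAlgebra.tensor_assoc_cycle _ _ _ _
  · intro s hs x y z
    obtain ⟨s₁, s₂, h₁, h₂, h⟩ := D.exists_of_mem_skew h2 hs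
    apply D.iso.injective
    simp only [map_neg, D.map_mul, h, iso_opV]
    exact OctonionAlgebra.tensor_opV_mul h₁ h₂ _ _ _
  · intro s hs x y z
    obtain ⟨s₁, s₂, h₁, h₂, h⟩ := D.exists_of_mem_skew h2 hs
    apply D.iso.injective
    simp only [map_neg, map_add, D.map_mul, h, iso_opV, iso_opPsi]
    exact OctonionAlgebra.tensor_opV_add h₁ h₂ _ _ _
  · obtain ⟨e, f, he, -, -, hne, -⟩ := D.C₁.exists_skew_pair h2
    have h : D.iso (D.iso.symm (e ⊗ₜ[F] (1 : D.C₂))) =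
        e ⊗ₜ[F] (1 : D.C₂) + (1 : D.C₁) ⊗ₜ[F] (0 : D.C₂) := by simp
    have hm := D.mem_skew_of_eq he (by simp) h
    refine ⟨_, hm, fun h0 ↦ ?_⟩
    have h1 := congrArg D.iso (hq _ hm 1)
    rw [h0, zero_smul, map_zero, D.map_mul, D.map_mul, D.iso_natural_eq (by simp) h, h,
      OctonionAlgebra.tensor_mul_mul he (by simp), QuadraticMap.map_zero, zero_sub] at h1
    rw [smul_eq_zero, neg_eq_zero, or_iff_right hne] at h1
    have h3 : (1 : B) = 0 := by simpa using h1
    have h4 := D.iso_one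
    rw [h3, map_zero] at h4
    have h5 := congrArg (TensorProduct.lift (LinearMap.mk₂ F (fun a b ↦ D.C₁.bil a 1 *
      D.C₂.bil b 1) (by intros; simp [add_mul]) (by intros; simp [mul_assoc])
      (by intros; simp [mul_add]) (by intros; simp; ring))) h4
    rw [Algebra.TensorProduct.one_def] at h5
    simp [OctonionAlgebra.bil_self, h2] at h5

end BioctonionDecomposition

/-! ### Covariance of the quartic map -/

theorem IsInvolution.map_one {F : Type u} [Field F] {B : Type u} [NonAssocRing B]
    [Module F B] {τ : B →ₗ[F] B} (h : IsInvolution τ) : τ 1 = 1 := by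
  have := h.map_mul (τ 1) 1
  rwa [mul_one, h.involutive, mul_one, eq_comm] at this

section Trilinear

variable {F : Type u} [Field F] {B : Type u} [NonAssocRing B] [Module F B] (τ : B →ₗ[F] B)

section
variable (x x' y y' z z' : B)

theorem opV_add_left : opV τ (x + x') y z = opV τ x y z + opV τ x' y z := by
  simp only [opV, map_add, mul_add, add_mul]; abel

theorem opV_add_middle : opV τ x (y + y') z = opV τ x y z + opV τ x y' z := by
  simp only [opV, map_add, mul_add, add_mul]; abel

theorem opV_add_right : opV τ x y (z + z') = opV τ x y z + opV τ x y z' := by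
  simp only [opV, mul_add, add_mul]; abel

theorem opV_neg_left : opV τ (-x) y z = -opV τ x y z := by
  simp only [opV, map_neg, mul_neg, neg_mul]; abel

theorem opV_neg_middle : opV τ x (-y) z = -opV τ x y z := by
  simp only [opV, map_neg, mul_neg, neg_mul]; abel

theorem opV_neg_right : opV τ x y (-z) = -opV τ x y z := by
  simp only [opV, mul_neg, neg_mul]; abel

theorem opV_sub_left : opV τ (x - x') y z = opV τ x y z - opV τ x' y z := by
  rw [sub_eq_add_neg, opV_add_left, opV_neg_left, sub_eq_add_neg]

theorem opV_sub_middle : opV τ x (y - y') z = opV τ x y z - opV τ x y' z := by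
  rw [sub_eq_add_neg, opV_add_middle, opV_neg_middle, sub_eq_add_neg]

theorem opV_sub_right : opV τ x y (z - z') = opV τ x y z - opV τ x y z' := by
  rw [sub_eq_add_neg, opV_add_right, opV_neg_right, sub_eq_add_neg]

theorem opV_zero_left : opV τ 0 y z = 0 := by simp [opV]

theorem opV_zero_middle : opV τ x 0 z = 0 := by simp [opV]

theorem opV_zero_right : opV τ x y 0 = 0 := by simp [opV]

theorem opPsi_mul_eq : opPsi τ x z * y = opV τ x y z - opV τ z y x := by
  simp only [opV, opPsi, sub_mul]; abel

theorem opPsi_neg_right : opPsi τ x (-y) = -opPsi τ x y := by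
  simp only [opPsi, map_neg, mul_neg, neg_mul]; abel

end

variable [SMulCommClass F B B] [IsScalarTower F B B] (c : F) (x y z : B)

theorem opV_smul_left : opV τ (c • x) y z = c • opV τ x y z := by
  simp only [opV, map_smul, mul_smul_comm, smul_mul_assoc, smul_add, smul_sub]

theorem opV_smul_middle : opV τ x (c • y) z = c • opV τ x y z := by
  simp only [opV, map_smul, mul_smul_comm, smul_mul_assoc, smul_add, smul_sub]

theorem opV_smul_right : opV τ x y (c • z) = c • opV τ x y z := by
  simp only [opV, mul_smul_comm, smul_mul_assoc, smul_add, smul_sub]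

theorem opPsi_smul_right : opPsi τ x (c • y) = c • opPsi τ x y := by
  simp only [opPsi, map_smul, mul_smul_comm, smul_mul_assoc, smul_sub]

/-- The operator `V_{x,y}` as a linear map. -/
def opVLin : B →ₗ[F] B where
  toFun := opV τ x y
  map_add' := opV_add_right τ x y
  map_smul' c z := opV_smul_right τ c x y z

@[simp] theorem opVLin_apply : opVLin τ x y z = opV τ x y z := rfl

end Trilinear

namespace SkewClifford

variable {F : Type u} [Field F] {B : Type u} [NonAssocRing B] [Module F B]
  {τ J : B →ₗ[F] B} {q : B → F} (h : SkewClifford τ J q)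
include h

theorem ne_zero_of_q_ne_zero (h1 : (1 : B) ≠ 0) {p : B} (hp : p ∈ skew τ) (hq : q p ≠ 0) :
    p ≠ 0 := by
  rintro rfl
  have := h.mul_mul 0 hp 1
  rw [zero_mul, eq_comm, smul_eq_zero] at this
  exact this.elim hq h1

theorem mul_mul' {s : B} (hs : s ∈ skew τ) (x : B) : J s * (s * x) = q (J s) • x := by
  have := h.mul_mul (J s) (h.map_mem s hs) x
  rwa [h.map_map s hs] at this

/-- The linearization of `L_s L_{J s} = q(s) id`. -/
theorem polar_mul {s t : B} (hs : s ∈ skew τ) (ht : t ∈ skew τ) (x : B) :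
    s * (J t * x) + t * (J s * x) = (q (s + t) - q s - q t) • x := by
  have h1 := h.mul_mul _ (add_mem hs ht) x
  rw [map_add, add_mul, add_mul, mul_add, mul_add, h.mul_mul s hs, h.mul_mul t ht] at h1
  rw [sub_smul, sub_smul, ← h1]; abel

/-- The covariance of `ψ` under left multiplication by a skew element. -/
theorem opPsi_mul_mul {s : B} (hs : s ∈ skew τ) (x z : B) :
    opPsi τ (s * x) (s * z) = -(s * (opPsi τ x z * s)) := by
  have h1 := opPsi_mul_eq τ (s * x) 1 (s * z)
  rw [mul_one, h.opV_mul s hs, h.opV_mul s hs] at h1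
  have h2 := opPsi_mul_eq τ x (s * 1) z
  rw [mul_one] at h2
  rw [h1, h2, mul_sub, mul_one]
  abel

theorem opU_mul {s : B} (hs : s ∈ skew τ) (x y : B) :
    opU τ (s * x) y = -(s * opU τ x (s * y)) :=
  h.opV_mul s hs x y x

variable [SMulCommClass F B B]

theorem q_map {s : B} (hs : s ∈ skew τ) : q (J s) = q s := by
  by_cases h0 : s = 0
  · rw [h0, map_zero]
  · have h1 := h.mul_mul s hs (s * 1)
    rw [h.mul_mul' hs, mul_smul_comm, mul_one, ← sub_eq_zero, ← sub_smul] at h1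
    exact sub_eq_zero.1 ((smul_eq_zero.1 h1).resolve_right h0)

/-- Up to sign and the factor `q(s)`, the map `u ↦ s (J(u) s)` is the reflection in the vector `s`
of the quadratic space of skew elements. -/
theorem reflection_eq {s u : B} (hs : s ∈ skew τ) (hu : u ∈ skew τ) :
    s * (J u * s) = (q (s + u) - q s - q u) • s - q s • u := by
  have h1 := h.polar_mul hs hu (s * 1)
  rw [h.mul_mul' hs, h.q_map hs, mul_smul_comm, mul_one, mul_one] at h1
  rw [← h1]; abel

theorem reflection_mem {s u : B} (hs : s ∈ skew τ) (hu : u ∈ skew τ) :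
    s * (J u * s) ∈ skew τ := by
  rw [h.reflection_eq hs hu]
  exact sub_mem ((skew τ).smul_mem _ hs) ((skew τ).smul_mem _ hu)

theorem map_reflection {s u : B} (hs : s ∈ skew τ) (hu : u ∈ skew τ) :
    J (s * (J u * s)) = J s * (u * J s) := by
  have h1 := h.reflection_eq (h.map_mem s hs) (h.map_mem u hu)
  rw [h.map_map u hu, h.q_map hs, h.q_map hu, ← map_add, h.q_map (add_mem hs hu)] at h1
  rw [h.reflection_eq hs hu, h1, map_sub, map_smul, map_smul]

variable [IsScalarTower F B B]

theorem reflection_mul {s u : B} (hs : s ∈ skew τ) (hu : u ∈ skew τ) (x : B) :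
    (s * (J u * s)) * x = s * (J u * (s * x)) := by
  have h1 := h.polar_mul hs hu (s * x)
  rw [h.mul_mul' hs, h.q_map hs, mul_smul_comm] at h1
  rw [h.reflection_eq hs hu, sub_mul, smul_mul_assoc, smul_mul_assoc, ← h1]; abel

theorem map_reflection_mul {s u : B} (hs : s ∈ skew τ) (hu : u ∈ skew τ) (x : B) :
    J (s * (J u * s)) * x = J s * (u * (J s * x)) := by
  have h1 := h.reflection_mul (h.map_mem s hs) (h.map_mem u hu) x
  rw [h.map_map u hu] at h1
  rw [h.map_reflection hs hu, h1]

theorem reflection_reflection {s u : B} (hs : s ∈ skew τ) (hu : u ∈ skew τ) :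
    s * (J (s * (J u * s)) * s) = (q s) ^ 2 • u := by
  have h1 := h.map_reflection_mul hs hu s
  have h2 := h.mul_mul' hs 1
  rw [mul_one, h.q_map hs] at h2
  rw [h1, h.mul_mul s hs, h2, mul_smul_comm, mul_one, smul_smul, sq]

/-- The reflections are similarities of `q`. The scalars are compared through their action, which
avoids the assumption that the algebra is nonzero. -/
theorem q_reflection_mul {s u : B} (hs : s ∈ skew τ) (hu : u ∈ skew τ) (x : B) :
    q (s * (J u * s)) • x = (q s ^ 2 * q u) • x := by
  rw [← h.mul_mul _ (h.reflection_mem hs hu), h.map_reflection_mul hs hu, h.reflection_mul hs hu,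
    h.mul_mul s hs, mul_smul_comm, h.mul_mul' hu, mul_smul_comm, mul_smul_comm, h.mul_mul _ hs,
    smul_smul, smul_smul, h.q_map hu]
  ring_nf

end SkewClifford

/-- The map `u ↦ 6 M_x(u) = ψ(x, U_x(J(u) x))`. -/
def quarticMap {F : Type u} [Field F] {B : Type u} [NonAssocRing B] [Module F B]
    (τ J : B →ₗ[F] B) (x u : B) : B :=
  opPsi τ x (opU τ x (J u * x))

namespace SkewClifford

variable {F : Type u} [Field F] {B : Type u} [NonAssocRing B] [Module F B]
  {τ J : B →ₗ[F] B} {q : B → F} (h : SkewClifford τ J q)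
include h

theorem quarticMap_mem (x u : B) : quarticMap τ J x u ∈ skew τ := opPsi_mem_skew h.inv _ _

theorem quarticMap_one {u : B} (hu : u ∈ skew τ) : quarticMap τ J 1 u = (6 : F) • J u := by
  have h1 : τ (J u) = -J u := h.map_mem u hu
  have h2 := h.inv.map_one
  simp only [quarticMap, opPsi, opU, opV, mul_one, one_mul, h1, h2, map_add, map_sub, map_neg]
  module

variable [SMulCommClass F B B] [IsScalarTower F B B]

omit h in
theorem quarticMap_smul (c : F) (x u : B) :
    quarticMap τ J x (c • u) = c • quarticMap τ J x u := by
  rw [quarticMap, opU, map_smul, smul_mul_assoc, opV_smul_middle, opPsi_smul_right]; rfl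

/-- The covariance of the quartic map: left multiplication by a skew element `s` conjugates it by
the reflection `u ↦ s (J(u) s)`. -/
theorem quarticMap_mul {s u : B} (hs : s ∈ skew τ) (hu : u ∈ skew τ) (x : B) :
    quarticMap τ J (s * x) u = s * (J (J (quarticMap τ J x (J (s * (J u * s))))) * s) := by
  rw [h.map_map _ (h.quarticMap_mem _ _), quarticMap, h.opU_mul hs, opPsi_neg_right,
    h.opPsi_mul_mul hs, neg_neg, ← h.reflection_mul hs hu]
  rw [quarticMap, h.map_map _ (h.reflection_mem hs hu)]

/-- If the square of the quartic map is the scalar `36 ν` at `x`, then it is the scalar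
`36 q(s)⁴ ν` at `s x`. -/
theorem quarticMap_quarticMap_mul {x : B} {ν : F}
    (hx : ∀ u ∈ skew τ, quarticMap τ J x (quarticMap τ J x u) = (36 * ν) • u) {s u : B}
    (hs : s ∈ skew τ) (hu : u ∈ skew τ) :
    quarticMap τ J (s * x) (quarticMap τ J (s * x) u) = (36 * (q s ^ 4 * ν)) • u := by
  have hr := h.reflection_mem hs hu
  rw [h.quarticMap_mul hs (h.quarticMap_mem _ _), h.quarticMap_mul hs hu,
    h.reflection_reflection hs (h.map_mem _ (h.quarticMap_mem _ _)), map_smul,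
    h.map_map _ (h.quarticMap_mem _ _), quarticMap_smul, h.map_map _ (h.quarticMap_mem _ _),
    hx _ (h.map_mem _ hr), smul_mul_assoc, smul_mul_assoc, mul_smul_comm, mul_smul_comm,
    h.reflection_reflection hs hu, smul_smul, smul_smul]
  ring_nf

/-- At `x` the quartic map squares to `36 ν`, and a multiple of the conjugate inverse of `x` is
given by a polynomial expression whose normalization is `ν`. In terms of `M_x`, the two properties
are `M_x² = ν id` and `V_{x, y} = -3 ν q(s) id` for `y = J(M_x s) U_x(J(s) x)`. -/
structure _root_.NormValue (τ J : B →ₗ[F] B) (q : B → F) (x : B) (ν : F) : Prop where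
  sq : ∀ u ∈ skew τ, quarticMap τ J x (quarticMap τ J x u) = (36 * ν) • u
  inverse : ∀ s ∈ skew τ, ∀ z,
    opV τ x (J (quarticMap τ J x s) * opU τ x (J s * x)) z = (-18 * (ν * q s)) • z

theorem normValue_one : NormValue τ J q 1 1 where
  sq u hu := by
    rw [h.quarticMap_one hu, quarticMap_smul, h.quarticMap_one (h.map_mem u hu), h.map_map u hu]
    module
  inverse s hs z := by
    have h1 : τ (J s) = -J s := h.map_mem s hs
    have h2 := h.inv.map_one
    have h3 : opU τ 1 (J s * 1) = (-3 : F) • J s := by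
      simp only [opU, opV, mul_one, one_mul, h1, h2]; module
    have h4 := h.mul_mul s hs 1
    rw [mul_one] at h4
    rw [h.quarticMap_one hs, map_smul, h.map_map s hs, h3, smul_mul_assoc, mul_smul_comm, h4,
      opV_smul_middle, opV_smul_middle, opV_smul_middle, smul_smul, smul_smul]
    have h5 : opV τ 1 1 z = z := by simp [opV, h2]
    rw [h5]
    ring_nf

/-- The relations of `NormValue` propagate along the action of the Clifford algebra, with
`ν(t x) = q(t)⁴ ν(x)`. -/
theorem NormValue.mul {x : B} {ν : F} (hx : NormValue τ J q x ν) {t : B} (ht : t ∈ skew τ) :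
    NormValue τ J q (t * x) (q t ^ 4 * ν) where
  sq u hu := h.quarticMap_quarticMap_mul hx.sq ht hu
  inverse s hs z := by
    have hr := h.reflection_mem ht hs
    have hm : quarticMap τ J x (J (t * (J s * t))) ∈ skew τ := h.quarticMap_mem _ _
    -- the reflection `R` in `t` transforms the expression at `(t x, s)` into that at `(x, J R s)`
    have key : J (quarticMap τ J (t * x) s) * opU τ (t * x) (J s * (t * x)) =
        -(q t • (J t * (J (quarticMap τ J x (J (t * (J s * t)))) *
          opU τ x (J (J (t * (J s * t))) * x)))) := by
      rw [h.quarticMap_mul ht hs, h.map_reflection_mul ht (h.map_mem _ hm), h.opU_mul ht,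
        mul_neg, h.mul_mul' ht, h.q_map ht, ← h.reflection_mul ht hs, h.map_map _ hr,
        mul_neg, mul_neg, mul_smul_comm, mul_smul_comm]
    rw [key]
    by_cases h0 : q t = 0
    · rw [h0, zero_smul, neg_zero, opV_zero_middle]
      simp
    · obtain ⟨w, rfl⟩ : ∃ w, z = t * w :=
        ⟨(q t)⁻¹ • (J t * z), by rw [mul_smul_comm, h.mul_mul t ht, inv_smul_smul₀ h0]⟩
      rw [h.opV_mul t ht, mul_neg, mul_smul_comm, h.mul_mul t ht, opV_neg_middle, opV_smul_middle,
        opV_smul_middle, hx.inverse _ (h.map_mem _ hr), mul_neg, neg_neg, mul_smul_comm,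
        mul_smul_comm, mul_smul_comm, h.q_map hr]
      have := h.q_reflection_mul ht hs (t * w)
      rw [mul_smul _ (_ * _), mul_smul ν, this]
      simp only [smul_smul]
      ring_nf

end SkewClifford

/-! ### The structurable identity -/

/-- The pair `(T, T')` acts on the triple product as an inner structural transformation does: one
has `[T, V_{x,y}] = V_{T x, y} - V_{x, T' y}`. -/
def IsTriplePair {F : Type u} [Field F] {B : Type u} [NonAssocRing B] [Module F B]
    (τ T T' : B →ₗ[F] B) : Prop :=
  ∀ x y z, T (opV τ x y z) - opV τ x y (T z) = opV τ (T x) y z - opV τ x (T' y) z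

section TriplePair

variable {F : Type u} [Field F] {B : Type u} [NonAssocRing B] [Module F B]
  {τ T T' U U' : B →ₗ[F] B}

theorem IsTriplePair.add (hT : IsTriplePair τ T T') (hU : IsTriplePair τ U U') :
    IsTriplePair τ (T + U) (T' + U') := by
  intro x y z
  simp only [LinearMap.add_apply, opV_add_left, opV_add_middle, opV_add_right]
  linear_combination (norm := abel) hT x y z + hU x y z

theorem IsTriplePair.smul [SMulCommClass F B B] [IsScalarTower F B B] (c : F)
    (hT : IsTriplePair τ T T') : IsTriplePair τ (c • T) (c • T') := by
  intro x y z
  simp only [LinearMap.smul_apply, opV_smul_left, opV_smul_middle, opV_smul_right, ← smul_sub,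
    hT x y z]

theorem IsTriplePair.zero : IsTriplePair τ 0 0 := by
  intro x y z
  simp [opV]

theorem IsTriplePair.bracket (hT : IsTriplePair τ T T') (hU : IsTriplePair τ U U') :
    IsTriplePair τ (T ∘ₗ U - U ∘ₗ T) (U' ∘ₗ T' - T' ∘ₗ U') := by
  intro x y z
  have a1 := congrArg T (hU x y z)
  have a2 := congrArg U (hT x y z)
  simp only [map_sub] at a1 a2
  simp only [LinearMap.sub_apply, LinearMap.comp_apply, opV_sub_left, opV_sub_middle,
    opV_sub_right]
  linear_combination (norm := abel) a1 - a2 + hT x y (U z) - hU x y (T z) + hT (U x) y z -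
    hU (T x) y z - hT x (U' y) z + hU x (T' y) z

end TriplePair

namespace SkewClifford

variable {F : Type u} [Field F] {B : Type u} [NonAssocRing B] [Module F B]
  {τ J : B →ₗ[F] B} {q : B → F} (h : SkewClifford τ J q)
include h

/-- The linearization of the identity `opV_mul` in the skew element. -/
theorem opV_mul_add {s t : B} (hs : s ∈ skew τ) (ht : t ∈ skew τ) (x y z : B) :
    opV τ (s * x) y (t * z) + opV τ (t * x) y (s * z) =
      -(s * opV τ x (t * y) z) - t * opV τ x (s * y) z := by
  have h1 := h.opV_mul _ (add_mem hs ht) x y z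
  simp only [add_mul, opV_add_left, opV_add_middle, opV_add_right, mul_add] at h1
  linear_combination (norm := abel) h1 - h.opV_mul s hs x y z - h.opV_mul t ht x y z

/-- Every skew element is a difference of two anisotropic ones. -/
theorem exists_sub_of_mem_skew (h2 : (2 : F) ≠ 0) (h1 : (1 : B) ≠ 0) {s : B} (hs : s ∈ skew τ) :
    ∃ a ∈ skew τ, ∃ b ∈ skew τ, q a ≠ 0 ∧ q b ≠ 0 ∧ s = a - b := by
  obtain ⟨p, hp, hq⟩ := h.exists_ne_zero
  have smul_inj : ∀ c d : F, c • (1 : B) = d • 1 → c = d := fun c d e ↦ by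
    rw [← sub_eq_zero, ← sub_smul] at e
    exact sub_eq_zero.1 ((smul_eq_zero.1 e).resolve_right h1)
  have hneg : ∀ a ∈ skew τ, q (-a) = q a := by
    intro a ha
    apply smul_inj
    rw [← h.mul_mul a ha, ← h.mul_mul _ (neg_mem ha), map_neg, neg_mul, neg_mul, mul_neg,
      neg_neg]
  have hpar : q (s + p) + q (s - p) = 2 * q s + 2 * q p := by
    apply smul_inj
    rw [add_smul, add_smul, mul_smul, mul_smul, ← h.mul_mul _ (add_mem hs hp),
      ← h.mul_mul _ (sub_mem hs hp), ← h.mul_mul s hs, ← h.mul_mul p hp]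
    simp only [map_add, map_sub, mul_one, add_mul, sub_mul, mul_add, mul_sub, two_smul]
    abel
  by_cases h3 : q (s + p) = 0
  · by_cases h4 : q (s - p) = 0
    · have h5 : q s ≠ 0 := by
        intro h5
        rw [h3, h4, h5, add_zero, mul_zero, zero_add] at hpar
        exact mul_ne_zero h2 hq hpar.symm
      refine ⟨(2 : F) • s, (skew τ).smul_mem _ hs, s, hs, ?_, h5, by module⟩
      have h6 : q ((2 : F) • s) = 2 * 2 * q s := by
        apply smul_inj
        rw [mul_smul, ← h.mul_mul s hs, ← h.mul_mul _ ((skew τ).smul_mem _ hs), map_smul]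
        simp only [mul_one, two_smul, add_mul, mul_add, mul_smul]
      rw [h6]
      exact mul_ne_zero (mul_ne_zero h2 h2) h5
    · exact ⟨s - p, sub_mem hs hp, -p, neg_mem hp, h4, by rwa [hneg p hp], by abel⟩
  · exact ⟨s + p, add_mem hs hp, p, hp, h3, hq, by abel⟩

/-- The triple product is nondegenerate in its middle variable. -/
theorem eq_zero_of_opV_eq_zero (h3 : (3 : F) ≠ 0) {w : B}
    (hw : ∀ z v, opV τ z w v = 0) : w = 0 := by
  have e1 := hw 1 1
  simp only [opV, one_mul, mul_one, h.inv.map_one] at e1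
  have e2 := congrArg τ e1
  simp only [map_add, map_sub, h.inv.involutive, map_zero] at e2
  have e3 : (3 : F) • w = 0 := by
    linear_combination (norm := module) (2 : F) • e2 + e1
  exact (smul_eq_zero.1 e3).resolve_left h3

variable [SMulCommClass F B B] [IsScalarTower F B B]

/-- The assertion of `isTriplePair_mul_mul` for anisotropic `s`, where `V_{s x, y} (s z)` can be
compared with both sides after multiplication by `q(s)`. -/
theorem isTriplePair_mul_mul_aux {s t : B} (hs : s ∈ skew τ) (ht : t ∈ skew τ) (hq : q s ≠ 0)
    (x y z : B) : s * (t * opV τ x y z) - opV τ x y (s * (t * z)) =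
      opV τ (s * (t * x)) y z - opV τ x (t * (s * y)) z := by
  have e1 : q s • opV τ (s * (t * x)) y z = -(s * opV τ (t * x) (s * y) (J s * z)) := by
    rw [← h.opV_mul s hs, h.mul_mul s hs, opV_smul_right]
  have e2 := h.opV_mul_add ht (h.map_mem s hs) x (s * y) z
  rw [h.mul_mul' hs, h.q_map hs, opV_smul_middle, mul_smul_comm] at e2
  have e3 := h.opV_mul s hs (J s * x) y (t * z)
  rw [h.mul_mul s hs, opV_smul_left] at e3
  have e4 := congrArg (s * ·) e2
  simp only [mul_add, mul_sub, mul_neg, mul_smul_comm, h.mul_mul s hs] at e4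
  have e5 : q s • (s * (t * opV τ x y z) - opV τ x y (s * (t * z))) =
      q s • (opV τ (s * (t * x)) y z - opV τ x (t * (s * y)) z) := by
    linear_combination (norm := module) -e1 - e3 + e4
  exact smul_right_injective B hq e5

/-- The products `L_s L_t` of left multiplications by skew elements are inner structural
transformations. -/
theorem isTriplePair_mul_mul (h2 : (2 : F) ≠ 0) (h1 : (1 : B) ≠ 0) {s t : B} (hs : s ∈ skew τ)
    (ht : t ∈ skew τ) : IsTriplePair τ (LinearMap.mulLeft F s ∘ₗ LinearMap.mulLeft F t)
      (LinearMap.mulLeft F t ∘ₗ LinearMap.mulLeft F s) := by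
  intro x y z
  obtain ⟨a, ha, b, hb, hqa, hqb, rfl⟩ := h.exists_sub_of_mem_skew h2 h1 hs
  have e1 := h.isTriplePair_mul_mul_aux ha ht hqa x y z
  have e2 := h.isTriplePair_mul_mul_aux hb ht hqb x y z
  simp only [LinearMap.comp_apply, LinearMap.mulLeft_apply, sub_mul, mul_sub, opV_sub_left,
    opV_sub_middle, opV_sub_right]
  linear_combination (norm := abel) e1 - e2

/-- For `s` skew, the map `z ↦ s z + 2 z s` is a derivation of the triple product. -/
theorem isTriplePair_mul_add {s : B} (hs : s ∈ skew τ) :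
    IsTriplePair τ (opVLin τ s 1) (opVLin τ 1 s) := by
  have hs' : τ s = -s := hs
  have hT : ∀ z, opV τ s 1 z = s * z + (2 : F) • (z * s) := fun z ↦ by
    simp only [opV, h.inv.map_one, hs', mul_one, mul_neg]; module
  have hT' : ∀ z, opV τ 1 s z = -(s * z + (2 : F) • (z * s)) := fun z ↦ by
    simp only [opV, h.inv.map_one, hs', mul_one, mul_neg, one_mul, neg_mul]; module
  have key : ∀ a b c, s * ((a * τ b) * c) + (2 : F) • (((a * τ b) * c) * s) =
      ((s * a + (2 : F) • (a * s)) * τ b) * c + (a * τ (s * b + (2 : F) • (b * s))) * c +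
        (a * τ b) * (s * c + (2 : F) • (c * s)) := by
    intro a b c
    have a1 := h.assoc_swap s hs (a * τ b) c
    have a2 := h.assoc_cycle s hs (a * τ b) c
    have b1 := congrArg (· * c) (h.assoc_swap s hs a (τ b))
    have b2 := congrArg (· * c) (h.assoc_cycle s hs a (τ b))
    simp only [sub_mul] at b1 b2
    simp only [map_add, map_smul, h.inv.map_mul, hs', mul_add, add_mul, mul_smul_comm,
      smul_mul_assoc, mul_neg, neg_mul]
    linear_combination (norm := module) (-2 : F) • a2 + a1 + b2 - (2 : F) • b1
  intro x y z
  simp only [opVLin_apply, hT, hT', opV_neg_middle]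
  simp only [opV, mul_add, mul_sub, add_mul, sub_mul, smul_add, smul_sub]
  have k1 := key x y z
  have k2 := key z y x
  have k3 := key z x y
  simp only [mul_add, add_mul] at k1 k2 k3
  linear_combination (norm := module) k1 + k2 - k3

/-- The case `x = 1` of the structurable identity. -/
theorem isTriplePair_one (h2 : (2 : F) ≠ 0) (h1 : (1 : B) ≠ 0) (y : B) :
    IsTriplePair τ (opVLin τ 1 y) (opVLin τ y 1) := by
  have hy : y ∈ Submodule.span F {x | ∃ s ∈ skew τ, ∃ t ∈ skew τ, x = s * t} := by
    rw [h.span]; trivial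
  induction hy using Submodule.span_induction with
  | zero =>
    have e1 : opVLin τ 1 0 = 0 := by ext z; simp [opV]
    have e2 : opVLin τ 0 1 = 0 := by ext z; simp [opV]
    rw [e1, e2]; exact .zero
  | add a b _ _ ha hb =>
    have e1 : opVLin τ 1 (a + b) = opVLin τ 1 a + opVLin τ 1 b := by
      ext z; exact opV_add_middle ..
    have e2 : opVLin τ (a + b) 1 = opVLin τ a 1 + opVLin τ b 1 := by
      ext z; exact opV_add_left ..
    rw [e1, e2]; exact ha.add hb
  | smul c a _ ha =>
    have e1 : opVLin τ 1 (c • a) = c • opVLin τ 1 a := by ext z; exact opV_smul_middle ..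
    have e2 : opVLin τ (c • a) 1 = c • opVLin τ a 1 := by ext z; exact opV_smul_left ..
    rw [e1, e2]; exact ha.smul c
  | mem a ha =>
    obtain ⟨s, hs, t, ht, rfl⟩ := ha
    have hs' : τ s = -s := hs
    have ht' : τ t = -t := ht
    have hu : s * t - t * s ∈ skew τ := by
      change τ (s * t - t * s) = -(s * t - t * s)
      rw [map_sub, h.inv.map_mul, h.inv.map_mul, hs', ht']
      simp only [neg_mul_neg, neg_sub]
    have hassoc : ∀ z, (s * t) * z + (t * s) * z = s * (t * z) + t * (s * z) := by
      intro z
      linear_combination (norm := abel) h.assoc_swap s hs t z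
    have hk : τ (s * t + t * s) = s * t + t * s := by
      rw [map_add, h.inv.map_mul, h.inv.map_mul, hs', ht']
      simp only [neg_mul_neg]; abel
    have p1 := h.isTriplePair_mul_add hu
    have p2 := (h.isTriplePair_mul_mul h2 h1 hs ht).add (h.isTriplePair_mul_mul h2 h1 ht hs)
    -- the hermitian part `s t + t s` acts by left multiplications, the skew part `s t - t s` by
    -- the derivation `isTriplePair_mul_add`
    have e1 : opVLin τ 1 (s * t) = (2 : F)⁻¹ • ((LinearMap.mulLeft F s ∘ₗ LinearMap.mulLeft F t +
        LinearMap.mulLeft F t ∘ₗ LinearMap.mulLeft F s) + opVLin τ 1 (s * t - t * s)) := by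
      ext z
      have e3 : opV τ 1 (s * t + t * s) z = s * (t * z) + t * (s * z) := by
        simp only [opV, one_mul, h.inv.map_one, mul_one, hk]
        rw [add_mul, hassoc]; abel
      simp only [LinearMap.smul_apply, LinearMap.add_apply, LinearMap.comp_apply, opVLin_apply,
        LinearMap.mulLeft_apply]
      rw [← e3, eq_inv_smul_iff₀ h2, ← opV_add_middle, ← opV_smul_middle, two_smul]
      congr 1; abel
    have e2 : opVLin τ (s * t) 1 = (2 : F)⁻¹ • ((LinearMap.mulLeft F t ∘ₗ LinearMap.mulLeft F s +
        LinearMap.mulLeft F s ∘ₗ LinearMap.mulLeft F t) + opVLin τ (s * t - t * s) 1) := by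
      ext z
      have e3 : opV τ (s * t + t * s) 1 z = s * (t * z) + t * (s * z) := by
        simp only [opV, h.inv.map_one, mul_one, hk]
        rw [add_mul, hassoc]; abel
      simp only [LinearMap.smul_apply, LinearMap.add_apply, LinearMap.comp_apply, opVLin_apply,
        LinearMap.mulLeft_apply]
      rw [add_comm (t * (s * z)), ← e3, eq_inv_smul_iff₀ h2, ← opV_add_left, ← opV_smul_left,
        two_smul]
      congr 1; abel
    have p3 : IsTriplePair τ (opVLin τ 1 (s * t - t * s)) (opVLin τ (s * t - t * s) 1) := by
      have e3 : ∀ z, opV τ 1 (s * t - t * s) z = -opV τ (s * t - t * s) 1 z := fun z ↦ by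
        have hu' : τ (s * t - t * s) = -(s * t - t * s) := hu
        simp only [opV, h.inv.map_one, hu', mul_one, mul_neg, one_mul, neg_mul]; abel
      intro x y z
      have := p1 x y z
      simp only [opVLin_apply, e3, opV_neg_left, opV_neg_middle, opV_neg_right] at this ⊢
      linear_combination (norm := abel) -this
    rw [e1, e2]
    exact (p2.add p3).smul _

/-- The defining identity of structurable algebras:
`[V_{x,y}, V_{z,w}] = V_{V_{x,y} z, w} - V_{z, V_{y,x} w}`. -/
theorem isTriplePair_opV (h2 : (2 : F) ≠ 0) (h1 : (1 : B) ≠ 0) (x y : B) :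
    IsTriplePair τ (opVLin τ x y) (opVLin τ y x) := by
  have hx : x ∈ Submodule.span F {x | ∃ s ∈ skew τ, ∃ t ∈ skew τ, x = s * t} := by
    rw [h.span]; trivial
  induction hx using Submodule.span_induction with
  | zero =>
    have e1 : opVLin τ y 0 = 0 := by ext z; simp [opV]
    have e2 : opVLin τ 0 y = 0 := by ext z; simp [opV]
    rw [e1, e2]; exact .zero
  | add a b _ _ ha hb =>
    have e1 : opVLin τ y (a + b) = opVLin τ y a + opVLin τ y b := by
      ext z; exact opV_add_middle ..
    have e2 : opVLin τ (a + b) y = opVLin τ a y + opVLin τ b y := by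
      ext z; exact opV_add_left ..
    rw [e1, e2]; exact ha.add hb
  | smul c a _ ha =>
    have e1 : opVLin τ y (c • a) = c • opVLin τ y a := by ext z; exact opV_smul_middle ..
    have e2 : opVLin τ (c • a) y = c • opVLin τ a y := by ext z; exact opV_smul_left ..
    rw [e1, e2]; exact ha.smul c
  | mem a ha =>
    obtain ⟨s, hs, t, ht, rfl⟩ := ha
    have p1 := h.isTriplePair_mul_mul h2 h1 hs ht
    have p2 := h.isTriplePair_mul_mul h2 h1 ht hs
    -- `V_{s t, y}` is the bracket of `L_s L_t` with `V_{1, y}`, up to `V_{1, t (s y)}`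
    have e1 : opVLin τ (s * t) y =
        ((LinearMap.mulLeft F s ∘ₗ LinearMap.mulLeft F t) ∘ₗ opVLin τ 1 y -
          opVLin τ 1 y ∘ₗ (LinearMap.mulLeft F s ∘ₗ LinearMap.mulLeft F t)) +
        opVLin τ 1 (t * (s * y)) := by
      ext z
      have := p1 1 y z
      simp only [LinearMap.comp_apply, LinearMap.mulLeft_apply, mul_one] at this
      simp only [LinearMap.sub_apply, LinearMap.add_apply, LinearMap.comp_apply, opVLin_apply,
        LinearMap.mulLeft_apply]
      rw [this]; abel
    have e2 : opVLin τ y (s * t) =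
        (opVLin τ y 1 ∘ₗ (LinearMap.mulLeft F t ∘ₗ LinearMap.mulLeft F s) -
          (LinearMap.mulLeft F t ∘ₗ LinearMap.mulLeft F s) ∘ₗ opVLin τ y 1) +
        opVLin τ (t * (s * y)) 1 := by
      ext z
      have := p2 y 1 z
      simp only [LinearMap.comp_apply, LinearMap.mulLeft_apply, mul_one] at this
      simp only [LinearMap.sub_apply, LinearMap.add_apply, LinearMap.comp_apply, opVLin_apply,
        LinearMap.mulLeft_apply]
      linear_combination (norm := abel) this
    rw [e1, e2]
    exact (p1.bracket (h.isTriplePair_one h2 h1 y)).add (h.isTriplePair_one h2 h1 _)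

/-- The quartic map of a conjugate-invertible element is injective. -/
theorem eq_zero_of_quarticMap_eq_zero (h2 : (2 : F) ≠ 0) (h3 : (3 : F) ≠ 0) (h1 : (1 : B) ≠ 0)
    {x y : B} (hxy : ∀ z, opV τ x y z = z) {s : B} (hs : s ∈ skew τ)
    (h0 : quarticMap τ J x s = 0) : s = 0 := by
  have hp := h.isTriplePair_opV h2 h1
  -- as `V_{x,y} = id` commutes with all `V_{z,w}`, the structurable identity gives `V_{y,x} = id`
  have hyx : ∀ z, opV τ y x z = z := by
    intro w
    rw [← sub_eq_zero]
    apply h.eq_zero_of_opV_eq_zero h3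
    intro z v
    have := hp x y z w v
    simp only [opVLin_apply, hxy] at this
    rw [opV_sub_middle]
    linear_combination (norm := abel) this
  have hJ := h.map_mem s hs
  set z := J s * x with hz
  have hψ : opPsi τ z y = (2 : F) • J s := by
    have e1 := h.opV_add (J s) hJ y x 1
    rw [hyx, hxy, mul_one, mul_one] at e1
    have e2 : opPsi τ z y = -opPsi τ y z := by simp only [opPsi]; abel
    rw [e2, ← hz] at *
    linear_combination (norm := module) -e1
  have hzx : opV τ z x y = (3 : F) • z := by
    have e1 := opPsi_mul_eq τ z x y
    rw [hyx, hψ, smul_mul_assoc, ← hz] at e1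
    linear_combination (norm := module) -e1
  -- `V_{x,z}` commutes with `V_{x,y} = id`
  have hw : ∀ v, opV τ (opU τ x z) y v = (3 : F) • opV τ x z v := by
    intro v
    have e1 := hp x z x y v
    simp only [opVLin_apply, hxy, hzx, opV_smul_middle] at e1
    rw [opU]
    linear_combination (norm := module) -e1
  -- with `w = U_x z`, the hypothesis `ψ(x, w) = 0` says that `V_{x,y} w = V_{w,y} x`, that is,
  -- `w = 3 w`
  have hw0 : opU τ x z = 0 := by
    have e1 := opPsi_mul_eq τ x y (opU τ x z)
    have e2 : opPsi τ x (opU τ x z) = 0 := h0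
    rw [e2, zero_mul, hxy, hw] at e1
    have e3 : (2 : F) • opU τ x z = 0 := by
      rw [opU] at *
      linear_combination (norm := module) e1
    exact (smul_eq_zero.1 e3).resolve_left h2
  have hxz : ∀ v, opV τ x z v = 0 := by
    intro v
    have := hw v
    rw [hw0, opV_zero_left] at this
    exact (smul_eq_zero.1 this.symm).resolve_left h3
  have hzx' : opV τ z x y = 0 := by
    apply h.eq_zero_of_opV_eq_zero h3
    intro a v
    have := hp x z a y v
    simp only [opVLin_apply, hxz, opV_zero_left, opV_zero_right, sub_zero, zero_sub] at this
    exact neg_eq_zero.1 this.symm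
  rw [hzx] at hzx'
  have hz0 := (smul_eq_zero.1 hzx').resolve_left h3
  have : opPsi τ z y = 0 := by rw [hz0]; simp [opPsi]
  rw [hψ] at this
  have hJ0 := (smul_eq_zero.1 this).resolve_left h2
  rw [← h.map_map s hs, hJ0, map_zero]

end SkewClifford

/-! ### Density and the norm over an infinite field -/

section HomogeneousEval

theorem MvPolynomial.aeval_eq_eval' {ι F : Type*} [CommSemiring F] (x : ι → F)
    (f : MvPolynomial ι F) : MvPolynomial.aeval x f = MvPolynomial.eval x f := by
  rw [← MvPolynomial.coe_aeval_eq_eval]; rfl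

theorem MvPolynomial.IsHomogeneous.aeval_mul {ι R S : Type*} [CommSemiring R] [CommSemiring S]
    [Algebra R S] {f : MvPolynomial ι R} {n : ℕ} (hf : f.IsHomogeneous n) (t : S) (y : ι → S) :
    MvPolynomial.aeval (fun i ↦ t * y i) f = t ^ n * MvPolynomial.aeval y f := by
  rw [MvPolynomial.aeval_def, MvPolynomial.aeval_def, MvPolynomial.eval₂_eq, MvPolynomial.eval₂_eq,
    Finset.mul_sum]
  refine Finset.sum_congr rfl fun d hd ↦ ?_
  have hdeg : ∑ i ∈ d.support, d i = n := by
    have := hf (MvPolynomial.mem_support_iff.1 hd)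
    rwa [Finsupp.weight_apply, Finsupp.sum, Finset.sum_congr rfl fun i _ ↦ by
      rw [Pi.one_apply, smul_eq_mul, mul_one]] at this
  simp only [mul_pow, Finset.prod_mul_distrib, Finset.prod_pow_eq_pow_sum, hdeg]
  ring

/-- A polynomial which vanishes along curves `t w + t² r(t)` with arbitrary initial direction `w` is
zero: its lowest homogeneous component would vanish at every `w`. -/
theorem MvPolynomial.eq_zero_of_curves {ι F : Type*} [Field F] [Infinite F]
    (g : MvPolynomial ι F)
    (h : ∀ w : ι → F, ∃ r : ι → Polynomial F, ∀ t : F,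
      MvPolynomial.eval (fun i ↦ t * w i + t ^ 2 * (r i).eval t) g = 0) : g = 0 := by
  have key : ∀ m, g.homogeneousComponent m = 0 := by
    intro m
    induction m using Nat.strong_induction_on with
    | _ m ih =>
      apply MvPolynomial.funext
      intro w
      obtain ⟨r, hr⟩ := h w
      let Y : ι → Polynomial F := fun i ↦ Polynomial.C (w i) + Polynomial.X * r i
      have h0 : MvPolynomial.aeval (fun i ↦ Polynomial.X * Y i) g = 0 := by
        apply Polynomial.funext
        intro t
        rw [Polynomial.eval_zero, ← hr t, ← Polynomial.coe_aeval_eq_eval,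
          MvPolynomial.comp_aeval_apply, ← aeval_eq_eval']
        congr 2
        ext i
        simp [Y]; ring
      rw [← MvPolynomial.sum_homogeneousComponent g, map_sum] at h0
      simp only [(MvPolynomial.homogeneousComponent_isHomogeneous _ g).aeval_mul] at h0
      have h1 := congrArg (fun p ↦ Polynomial.coeff p m) h0
      simp only [Polynomial.finsetSum_coeff, Polynomial.coeff_X_pow_mul', Polynomial.coeff_zero]
        at h1
      rw [Finset.sum_eq_single m] at h1
      · rw [if_pos le_rfl, Nat.sub_self, Polynomial.coeff_zero_eq_aeval_zero,
          MvPolynomial.comp_aeval_apply] at h1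
        rw [map_zero, ← h1, ← aeval_eq_eval']
        congr 2
        ext i
        simp [Y]
      · intro i _ hi
        split_ifs with h2
        · rw [ih i (lt_of_le_of_ne h2 hi), map_zero, Polynomial.coeff_zero]
        · rfl
      · intro hm
        rw [Finset.mem_range, not_lt, Nat.succ_le_iff] at hm
        rw [MvPolynomial.homogeneousComponent_eq_zero _ _ hm, map_zero]
        simp
  rw [← MvPolynomial.sum_homogeneousComponent g]
  exact Finset.sum_eq_zero fun i _ ↦ key i

end HomogeneousEval

section PolynomialMap

variable {F : Type*} [Field F] {B : Type*} [NonAssocRing B] [Module F B] {ι : Type*}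

/-- A map whose composites with all linear forms are polynomials in the coordinates with respect to
the basis `b`. -/
def IsPolynomialMap {W : Type*} [AddCommGroup W] [Module F W] (b : Module.Basis ι F B)
    (g : B → W) : Prop :=
  ∀ l : W →ₗ[F] F, ∃ p : MvPolynomial ι F, ∀ x, l (g x) = MvPolynomial.eval (b.repr x) p

variable {b : Module.Basis ι F B}

theorem isPolynomialMap_id [Fintype ι] : IsPolynomialMap b (fun x : B ↦ x) := by
  intro l
  refine ⟨∑ i, MvPolynomial.X i * MvPolynomial.C (l (b i)), fun x ↦ ?_⟩
  conv_lhs => rw [← b.sum_repr x]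
  simp only [map_sum, map_smul, smul_eq_mul, map_mul, MvPolynomial.eval_X, MvPolynomial.eval_C]

section
variable {W W' : Type*} [AddCommGroup W] [Module F W] [AddCommGroup W'] [Module F W']

theorem isPolynomialMap_const (c : W) : IsPolynomialMap b (fun _ : B ↦ c) :=
  fun l ↦ ⟨MvPolynomial.C (l c), fun x ↦ by simp⟩

theorem IsPolynomialMap.add {g g' : B → W} (hg : IsPolynomialMap b g)
    (hg' : IsPolynomialMap b g') : IsPolynomialMap b (fun x ↦ g x + g' x) := by
  intro l
  obtain ⟨p, hp⟩ := hg l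
  obtain ⟨p', hp'⟩ := hg' l
  exact ⟨p + p', fun x ↦ by rw [map_add, map_add, hp, hp']⟩

theorem IsPolynomialMap.comp {g : B → W} (hg : IsPolynomialMap b g) (L : W →ₗ[F] W') :
    IsPolynomialMap b (fun x ↦ L (g x)) :=
  fun l ↦ hg (l ∘ₗ L)

theorem IsPolynomialMap.sub {g g' : B → W} (hg : IsPolynomialMap b g)
    (hg' : IsPolynomialMap b g') : IsPolynomialMap b (fun x ↦ g x - g' x) := by
  intro l
  obtain ⟨p, hp⟩ := hg l
  obtain ⟨p', hp'⟩ := hg' l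
  exact ⟨p - p', fun x ↦ by rw [map_sub, map_sub, hp, hp']⟩

theorem IsPolynomialMap.smul {g : B → F} {g' : B → W} (hg : IsPolynomialMap b g)
    (hg' : IsPolynomialMap b g') : IsPolynomialMap b (fun x ↦ g x • g' x) := by
  intro l
  obtain ⟨p, hp⟩ := hg LinearMap.id
  obtain ⟨p', hp'⟩ := hg' l
  exact ⟨p * p', fun x ↦ by rw [map_smul, map_mul, ← hp, ← hp']; rfl⟩

end

theorem IsPolynomialMap.mul [Fintype ι] [SMulCommClass F B B] [IsScalarTower F B B] {g g' : B → B}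
    (hg : IsPolynomialMap b g) (hg' : IsPolynomialMap b g') :
    IsPolynomialMap b (fun x ↦ g x * g' x) := by
  intro l
  choose p hp using fun i ↦ hg (b.coord i)
  choose p' hp' using fun i ↦ hg' (b.coord i)
  refine ⟨∑ i, ∑ j, p i * p' j * MvPolynomial.C (l (b i * b j)), fun x ↦ ?_⟩
  beta_reduce
  conv_lhs => rw [← b.sum_repr (g x), ← b.sum_repr (g' x)]
  simp only [Finset.sum_mul, Finset.mul_sum, smul_mul_assoc, mul_smul_comm, map_sum, map_smul,
    map_mul, MvPolynomial.eval_C, ← hp, ← hp', smul_eq_mul, Module.Basis.coord_apply]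
  rw [Finset.sum_comm]
  refine Finset.sum_congr rfl fun i _ ↦ Finset.sum_congr rfl fun j _ ↦ by ring

end PolynomialMap

section Polynomial

variable {F : Type u} [Field F] {B : Type u} [NonAssocRing B] [Module F B] {ι : Type*} [Fintype ι]
  [SMulCommClass F B B] [IsScalarTower F B B] {b : Module.Basis ι F B} {τ J : B →ₗ[F] B}

theorem IsPolynomialMap.opV {f g k : B → B} (hf : IsPolynomialMap b f) (hg : IsPolynomialMap b g)
    (hk : IsPolynomialMap b k) : IsPolynomialMap b (fun x ↦ opV τ (f x) (g x) (k x)) :=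
  ((((hf.mul (hg.comp τ)).mul hk).add ((hk.mul (hg.comp τ)).mul hf)).sub
    ((hk.mul (hf.comp τ)).mul hg))

theorem IsPolynomialMap.quarticMap {g : B → B} (hg : IsPolynomialMap b g) :
    IsPolynomialMap b (fun x ↦ quarticMap τ J x (g x)) := by
  have h1 := IsPolynomialMap.opV (τ := τ) isPolynomialMap_id ((hg.comp J).mul isPolynomialMap_id)
    isPolynomialMap_id
  exact (isPolynomialMap_id.mul (h1.comp τ)).sub (h1.mul (isPolynomialMap_id.comp τ))

end Polynomial

namespace SkewClifford

variable {F : Type u} [Field F] {B : Type u} [NonAssocRing B] [Module F B]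
  {τ J : B →ₗ[F] B} {q : B → F} (h : SkewClifford τ J q)
  [SMulCommClass F B B] [IsScalarTower F B B] {ι : Type*} [Fintype ι] (b : Module.Basis ι F B)
include h

/-- If a set contains `1` and is stable under left multiplication by skew elements, then it contains
curves `1 + t w + O(t²)` in every direction `w`. -/
theorem exists_curve (h2 : (2 : F) ≠ 0) (h1 : (1 : B) ≠ 0) {O : Set B} (hO1 : (1 : B) ∈ O)
    (hO : ∀ s ∈ skew τ, ∀ x ∈ O, s * x ∈ O) (w : B) :
    ∃ r : ι → Polynomial F, ∀ t : F, 1 + t • w + t ^ 2 • ∑ i, (r i).eval t • b i ∈ O := by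
  have hw : w ∈ Submodule.span F {x | ∃ s ∈ skew τ, ∃ t ∈ skew τ, x = s * t} := by
    rw [h.span]; trivial
  -- a curve with initial direction `w₀` can be modified to one with initial direction `w₀ + w`
  suffices ∀ (w₀ : B) (r : ι → Polynomial F),
      (∀ t : F, 1 + t • w₀ + t ^ 2 • ∑ i, (r i).eval t • b i ∈ O) →
      ∃ r' : ι → Polynomial F,
        ∀ t : F, 1 + t • (w₀ + w) + t ^ 2 • ∑ i, (r' i).eval t • b i ∈ O by
    simpa using this 0 0 (fun t ↦ by simpa using hO1)
  induction hw using Submodule.closure_induction with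
  | zero => intro w₀ r hr; exact ⟨r, by simpa using hr⟩
  | add a c _ _ ha hc =>
    intro w₀ r hr
    obtain ⟨r', hr'⟩ := ha w₀ r hr
    simpa only [add_assoc] using hc _ r' hr'
  | smul_mem c x hx =>
    obtain ⟨s, hs, v, hv, rfl⟩ := hx
    have key : ∀ p ∈ skew τ, q p ≠ 0 → ∀ v ∈ skew τ, ∀ (w₀ : B) (r : ι → Polynomial F),
        (∀ t : F, 1 + t • w₀ + t ^ 2 • ∑ i, (r i).eval t • b i ∈ O) →
        ∃ r' : ι → Polynomial F,
          ∀ t : F, 1 + t • (w₀ + p * v) + t ^ 2 • ∑ i, (r' i).eval t • b i ∈ O := by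
      intro p hp hqp v hv w₀ r hr
      -- apply `L_p L_{J p / q(p) + t v} = id + t L_p L_v` to the curve
      refine ⟨fun i ↦ r i + Polynomial.C (b.repr (p * (v * w₀)) i) + Polynomial.X *
        ∑ j, Polynomial.C (b.repr (p * (v * b j)) i) * r j, fun t ↦ ?_⟩
      have hmem := hO p hp _ (hO _ (add_mem ((skew τ).smul_mem (q p)⁻¹ (h.map_mem p hp))
        ((skew τ).smul_mem t hv)) _ (hr t))
      convert hmem using 1
      have e1 : ∀ y, p * (((q p)⁻¹ • J p + t • v) * y) = y + t • (p * (v * y)) := by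
        intro y
        rw [add_mul, mul_add, smul_mul_assoc, mul_smul_comm, h.mul_mul p hp, inv_smul_smul₀ hqp,
          smul_mul_assoc, mul_smul_comm]
      have e2 : ∑ i, (b.repr (p * (v * w₀)) i) • b i = p * (v * w₀) := b.sum_repr _
      have e3 : ∑ i, (∑ j, (b.repr (p * (v * b j)) i) * (r j).eval t) • b i =
          p * (v * ∑ j, (r j).eval t • b j) := by
        simp only [Finset.sum_smul, Finset.mul_sum, mul_smul_comm]
        rw [Finset.sum_comm]
        refine Finset.sum_congr rfl fun j _ ↦ ?_
        conv_rhs => rw [← b.sum_repr (p * (v * b j)), Finset.smul_sum]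
        simp only [smul_smul, mul_comm]
      rw [e1]
      simp only [Polynomial.eval_add, Polynomial.eval_C, Polynomial.eval_mul, Polynomial.eval_X,
        Polynomial.eval_finsetSum, add_smul, mul_smul, Finset.sum_add_distrib, ← Finset.smul_sum,
        e2, e3, mul_add, mul_one, mul_smul_comm]
      module
    obtain ⟨p, hp, p', hp', hq, hq', rfl⟩ := h.exists_sub_of_mem_skew h2 h1 hs
    intro w₀ r hr
    obtain ⟨r₁, hr₁⟩ := key p hp hq _ ((skew τ).smul_mem c hv) w₀ r hr
    obtain ⟨r₂, hr₂⟩ := key p' hp' hq' _ ((skew τ).smul_mem (-c) hv) _ r₁ hr₁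
    refine ⟨r₂, fun t ↦ ?_⟩
    have e : w₀ + c • ((p - p') * v) = w₀ + p * (c • v) + p' * (-c • v) := by
      rw [sub_mul, mul_smul_comm, mul_smul_comm]; module
    rw [e]
    exact hr₂ t

/-- Density: a polynomial map which vanishes on a set that contains `1` and is stable under left
multiplication by skew elements vanishes identically. -/
theorem eq_zero_of_forall_mem [Infinite F] (h2 : (2 : F) ≠ 0) (h1 : (1 : B) ≠ 0) {O : Set B}
    (hO1 : (1 : B) ∈ O) (hO : ∀ s ∈ skew τ, ∀ x ∈ O, s * x ∈ O) {W : Type*} [AddCommGroup W]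
    [Module F W] {g : B → W} (hg : IsPolynomialMap b g) (h0 : ∀ x ∈ O, g x = 0) (x : B) :
    g x = 0 := by
  rw [← Module.forall_dual_apply_eq_zero_iff F]
  intro l
  obtain ⟨p, hp⟩ := hg l
  suffices hz : MvPolynomial.aeval
      (fun i ↦ MvPolynomial.X i + MvPolynomial.C (b.repr 1 i)) p = 0 by
    have e := congrArg (MvPolynomial.aeval (fun i ↦ b.repr (x - 1) i)) hz
    rw [MvPolynomial.comp_aeval_apply, map_zero, MvPolynomial.aeval_eq_eval'] at e
    rw [hp, ← e]
    congr 2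
    ext i
    simp
  apply MvPolynomial.eq_zero_of_curves
  intro w
  obtain ⟨r, hr⟩ := h.exists_curve b h2 h1 hO1 hO (∑ i, w i • b i)
  refine ⟨r, fun t ↦ ?_⟩
  rw [← MvPolynomial.aeval_eq_eval', MvPolynomial.comp_aeval_apply, MvPolynomial.aeval_eq_eval']
  have e := hp (1 + t • ∑ i, w i • b i + t ^ 2 • ∑ i, (r i).eval t • b i)
  rw [h0 _ (hr t), map_zero] at e
  rw [e]
  congr 2
  ext i
  have e3 : ∀ c : ι → F, b.repr (∑ i, c i • b i) i = c i := fun c ↦ by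
    rw [b.repr_sum_self]
  simp only [map_add, map_smul, Finsupp.add_apply, Finsupp.smul_apply, e3, smul_eq_mul,
    MvPolynomial.aeval_X, MvPolynomial.aeval_C, Algebra.algebraMap_self, RingHom.id_apply]
  ring

/-- Over an infinite field the square of the quartic map is a scalar at every element. -/
theorem exists_normValue [Infinite F] [Module.Finite F B] (h2 : (2 : F) ≠ 0) (h3 : (3 : F) ≠ 0)
    (h1 : (1 : B) ≠ 0) : ∃ ν : B → F, ∀ x, NormValue τ J q x (ν x) := by
  let b := Module.finBasis F B
  obtain ⟨p, hp, hqp⟩ := h.exists_ne_zero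
  have hp0 := h.ne_zero_of_q_ne_zero h1 hp hqp
  have h36 : (36 : F) ≠ 0 := by
    have : (36 : F) = 2 * 2 * 3 * 3 := by norm_num
    rw [this]; exact mul_ne_zero (mul_ne_zero (mul_ne_zero h2 h2) h3) h3
  obtain ⟨l, hl⟩ : ∃ l : B →ₗ[F] F, l p = 1 := by
    obtain ⟨l, hl⟩ := (not_forall.1 ((Module.forall_dual_apply_eq_zero_iff F p).not.2 hp0))
    exact ⟨(l p)⁻¹ • l, inv_mul_cancel₀ hl⟩
  -- the only candidate for `ν(x)`, as a polynomial function
  let ν : B → F := fun x ↦ (36 : F)⁻¹ • l (quarticMap τ J x (quarticMap τ J x p))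
  have hν : IsPolynomialMap b ν :=
    ((isPolynomialMap_const p).quarticMap.quarticMap.comp l).comp ((36⁻¹ : F) • LinearMap.id)
  let O : Set B := {x | ∃ c, NormValue τ J q x c}
  have hOν : ∀ x ∈ O, NormValue τ J q x (ν x) := by
    rintro x ⟨c, hc⟩
    have : ν x = c := by
      simp only [ν, hc.sq p hp, map_smul, hl, smul_eq_mul, mul_one]
      rw [inv_mul_cancel_left₀ h36]
    rwa [this]
  have hO1 : (1 : B) ∈ O := ⟨1, h.normValue_one⟩
  have hO : ∀ s ∈ skew τ, ∀ x ∈ O, s * x ∈ O := fun s hs x ⟨c, hc⟩ ↦ ⟨_, NormValue.mul h hc hs⟩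
  refine ⟨ν, fun x ↦ ⟨fun u hu ↦ ?_, fun s hs z ↦ ?_⟩⟩
  · rw [← sub_eq_zero]
    refine h.eq_zero_of_forall_mem b h2 h1 hO1 hO (W := B)
      (g := fun x ↦ quarticMap τ J x (quarticMap τ J x u) - (36 * ν x) • u)
      ((isPolynomialMap_const u).quarticMap.quarticMap.sub
        ((hν.comp ((36 : F) • LinearMap.id)).smul (isPolynomialMap_const u)))
      (fun x hx ↦ sub_eq_zero.2 ((hOν x hx).sq u hu)) x
  · rw [← sub_eq_zero]
    refine h.eq_zero_of_forall_mem b h2 h1 hO1 hO (W := B)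
      (g := fun x ↦ opV τ x (J (quarticMap τ J x s) * opU τ x (J s * x)) z -
        (-18 * (ν x * q s)) • z)
      (IsPolynomialMap.sub (IsPolynomialMap.opV isPolynomialMap_id
        (((isPolynomialMap_const s).quarticMap.comp J).mul
          (IsPolynomialMap.opV isPolynomialMap_id
            ((isPolynomialMap_const (J s)).mul isPolynomialMap_id) isPolynomialMap_id))
        (isPolynomialMap_const z)) ?_)
      (fun x hx ↦ sub_eq_zero.2 ((hOν x hx).inverse s hs z)) x
    have := (hν.comp ((-18 * q s : F) • LinearMap.id)).smul (isPolynomialMap_const (b := b) z)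
    convert this using 3
    simp only [LinearMap.smul_apply, LinearMap.id_apply, smul_eq_mul]
    ring

/-- An element is conjugate-invertible if and only if its norm does not vanish. -/
theorem conjInvertible_iff (h2 : (2 : F) ≠ 0) (h3 : (3 : F) ≠ 0) (h1 : (1 : B) ≠ 0) {x : B}
    {ν : F} (hx : NormValue τ J q x ν) : ConjInvertible τ x ↔ ν ≠ 0 := by
  obtain ⟨p, hp, hqp⟩ := h.exists_ne_zero
  have hp0 := h.ne_zero_of_q_ne_zero h1 hp hqp
  have h18 : (-18 : F) ≠ 0 := by
    have : (-18 : F) = -(2 * 3 * 3) := by norm_num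
    rw [this]; exact neg_ne_zero.2 (mul_ne_zero (mul_ne_zero h2 h3) h3)
  constructor
  · rintro ⟨y, hy⟩ rfl
    apply hp0
    apply h.eq_zero_of_quarticMap_eq_zero h2 h3 h1 hy hp
    apply h.eq_zero_of_quarticMap_eq_zero h2 h3 h1 hy (h.quarticMap_mem _ _)
    rw [hx.sq p hp, mul_zero, zero_smul]
  · intro hν
    refine ⟨(-18 * (ν * q p))⁻¹ • (J (quarticMap τ J x p) * opU τ x (J p * x)), fun z ↦ ?_⟩
    rw [opV_smul_middle, hx.inverse p hp, inv_smul_smul₀]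
    exact mul_ne_zero h18 (mul_ne_zero hν hqp)

end SkewClifford

/-! ### Scalar extension of octonion algebras and decompositions -/

theorem ofNat_ne_zero_of_algebra {F K : Type*} [Field F] [Field K] [Algebra F K] {n : ℕ}
    [n.AtLeastTwo] (h : (ofNat(n) : F) ≠ 0) : (ofNat(n) : K) ≠ 0 := by
  rw [← map_ofNat (algebraMap F K) n]
  exact (map_ne_zero _).2 h

namespace OctonionAlgebra

/-- The octonion algebra with norm `x ↦ β(x, x) / 2`, for a symmetric nondegenerate bilinear form
`β` that satisfies the linearization of the composition law. -/
noncomputable def ofBilin {F : Type u} [Field F] (h2 : (2 : F) ≠ 0) (X : Type u) [NonAssocRing X]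
    [Module F X] [SMulCommClass F X X] [IsScalarTower F X X] (β : LinearMap.BilinForm F X)
    (hs : ∀ x y, β x y = β y x)
    (hm : ∀ x y z w, β (x * y) (z * w) + β (z * y) (x * w) = β x z * β y w)
    (hn : ∀ x, (∀ y, β x y = 0) → x = 0) (h8 : Module.finrank F X = 8) : OctonionAlgebra F where
  carrier := X
  norm := LinearMap.BilinMap.toQuadraticMap ((2 : F)⁻¹ • β)
  finrank_eq := h8
  nondegenerate := by
    have hp : ∀ x y, QuadraticMap.polarBilin
        (LinearMap.BilinMap.toQuadraticMap ((2 : F)⁻¹ • β)) x y = β x y := by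
      intro x y
      rw [QuadraticMap.polarBilin_apply_apply, LinearMap.BilinMap.polar_toQuadraticMap]
      simp only [LinearMap.smul_apply, smul_eq_mul, hs y x]
      rw [← two_mul, mul_inv_cancel_left₀ h2]
    refine ⟨fun x hx ↦ hn x fun y ↦ by rw [← hp, hx], fun y hy ↦ hn y fun x ↦ ?_⟩
    rw [hs, ← hp, hy]
  norm_mul x y := by
    have h := hm x y x y
    simp only [LinearMap.BilinMap.toQuadraticMap_apply, LinearMap.smul_apply, smul_eq_mul]
    field_simp
    linear_combination h

section
variable {F : Type u} [Field F] (h2 : (2 : F) ≠ 0) (X : Type u) [NonAssocRing X]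
    [Module F X] [SMulCommClass F X X] [IsScalarTower F X X] (β : LinearMap.BilinForm F X)
    (hs : ∀ x y, β x y = β y x)
    (hm : ∀ x y z w, β (x * y) (z * w) + β (z * y) (x * w) = β x z * β y w)
    (hn : ∀ x, (∀ y, β x y = 0) → x = 0) (h8 : Module.finrank F X = 8)

theorem ofBilin_bil (x y : X) : (ofBilin h2 X β hs hm hn h8).bil x y = β x y := by
  change QuadraticMap.polarBilin (LinearMap.BilinMap.toQuadraticMap ((2 : F)⁻¹ • β)) x y = β x y
  rw [QuadraticMap.polarBilin_apply_apply, LinearMap.BilinMap.polar_toQuadraticMap]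
  simp only [LinearMap.smul_apply, smul_eq_mul, hs y x]
  rw [← two_mul, mul_inv_cancel_left₀ h2]

theorem ofBilin_conj (x : X) : (ofBilin h2 X β hs hm hn h8).conj x = β x 1 • (1 : X) - x := by
  rw [← ofBilin_bil h2 X β hs hm hn h8 x 1]; rfl

end

variable {F : Type u} [Field F] (C : OctonionAlgebra F) (K : Type u) [Field K] [Algebra F K]

instance : Module.Finite F C := Module.finite_of_finrank_pos (by rw [C.finrank_eq]; omega)

/-- The linearized composition law is quadrilinear, so it holds after scalar extension. -/
theorem baseChange_bil_mul (x y z w : K ⊗[F] C) :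
    C.bil.baseChange K (x * y) (z * w) + C.bil.baseChange K (z * y) (x * w) =
      C.bil.baseChange K x z * C.bil.baseChange K y w := by
  induction x using TensorProduct.induction_on with
  | zero => simp
  | add x x' h h' =>
    simp only [add_mul, map_add, LinearMap.add_apply]
    linear_combination h + h'
  | tmul a x =>
  induction y using TensorProduct.induction_on with
  | zero => simp
  | add x x' h h' =>
    simp only [mul_add, map_add, LinearMap.add_apply]
    linear_combination h + h'
  | tmul b y =>
  induction z using TensorProduct.induction_on with
  | zero => simp
  | add x x' h h' =>
    simp only [add_mul, map_add, LinearMap.add_apply] at h h' ⊢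
    linear_combination h + h'
  | tmul c z =>
  induction w using TensorProduct.induction_on with
  | zero => simp
  | add x x' h h' =>
    simp only [mul_add, map_add] at h h' ⊢
    linear_combination h + h'
  | tmul d w =>
    simp only [Algebra.TensorProduct.tmul_mul_tmul, LinearMap.BilinForm.baseChange_tmul,
      Algebra.smul_def]
    have := congrArg (algebraMap F K) (C.bil_mul_add x y z w)
    simp only [map_add, map_mul] at this
    linear_combination (a * b * c * d) * this

theorem baseChange_bil_separating (x : K ⊗[F] C) (hx : ∀ y, C.bil.baseChange K x y = 0) :
    x = 0 := by
  classical
  let b := Module.finBasis F C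
  let b' := C.bil.dualBasis C.nondegenerate b
  have hb : ∀ i j, C.bil (b i) (b' j) = if i = j then 1 else 0 := fun i j ↦ by
    rw [bil_comm]; exact LinearMap.BilinForm.apply_dualBasis_left C.nondegenerate b j i
  have h := (Algebra.TensorProduct.basis K b).sum_repr x
  rw [← h]
  apply Finset.sum_eq_zero
  intro j _
  have h1 := hx (1 ⊗ₜ b' j)
  rw [← h] at h1
  simp only [map_sum, map_smul, LinearMap.sum_apply, LinearMap.smul_apply,
    Algebra.TensorProduct.basis_apply, LinearMap.BilinForm.baseChange_tmul, hb] at h1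
  simp only [mul_one, ite_smul, one_smul, zero_smul, smul_eq_mul, mul_ite, mul_zero,
    Finset.sum_ite_eq', Finset.mem_univ, if_true] at h1
  rw [h1, zero_smul]

/-- The scalar extension of an octonion algebra, in characteristic different from two. -/
noncomputable def baseChange (h2 : (2 : K) ≠ 0) : OctonionAlgebra K :=
  ofBilin h2 (K ⊗[F] C) (C.bil.baseChange K)
    (fun x y ↦ by
      induction x using TensorProduct.induction_on with
      | zero => simp
      | add x x' h h' => rw [map_add, map_add, LinearMap.add_apply, h, h']
      | tmul a x =>
      induction y using TensorProduct.induction_on with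
      | zero => simp
      | add x x' h h' => rw [map_add, map_add, LinearMap.add_apply, h, h']
      | tmul b y =>
        rw [LinearMap.BilinForm.baseChange_tmul, LinearMap.BilinForm.baseChange_tmul, C.bil_comm,
          mul_comm])
    (C.baseChange_bil_mul K) (C.baseChange_bil_separating K)
    (by rw [Module.finrank_baseChange, C.finrank_eq])

/-- The identification of the underlying space of the scalar extension with `K ⊗ C`. -/
noncomputable def toBaseChange (h2 : (2 : K) ≠ 0) : (K ⊗[F] C) ≃ₗ[K] C.baseChange K h2 :=
  LinearEquiv.refl K (K ⊗[F] C)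

theorem toBaseChange_mul (h2 : (2 : K) ≠ 0) (x y : K ⊗[F] C) :
    C.toBaseChange K h2 (x * y) = C.toBaseChange K h2 x * C.toBaseChange K h2 y := rfl

theorem baseChange_conj (h2 : (2 : K) ≠ 0) (x : K ⊗[F] C) :
    (C.baseChange K h2).conj (C.toBaseChange K h2 x) =
      C.toBaseChange K h2 (C.conj.baseChange K x) := by
  refine (ofBilin_conj h2 (K ⊗[F] C) (C.bil.baseChange K) _ _ _ _ x).trans ?_
  change _ = C.conj.baseChange K x
  induction x using TensorProduct.induction_on with
  | zero => simp
  | add x y hx hy =>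
    rw [map_add (C.conj.baseChange K), ← hx, ← hy, map_add, LinearMap.add_apply]
    module
  | tmul a x =>
    rw [LinearMap.baseChange_tmul, conj_apply, TensorProduct.tmul_sub, TensorProduct.tmul_smul,
      Algebra.TensorProduct.one_def, LinearMap.BilinForm.baseChange_tmul, mul_one,
      TensorProduct.smul_tmul', TensorProduct.smul_tmul', smul_eq_mul, mul_one]

end OctonionAlgebra

namespace BioctonionDecomposition

variable {F : Type u} [Field F] {B : Type u} [NonAssocRing B] [Module F B] {τ : B →ₗ[F] B}

/-- Transport of a decomposition along an isomorphism of algebras with involution. -/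
def congr (D : BioctonionDecomposition τ) {B' : Type u} [NonAssocRing B'] [Module F B']
    {τ' : B' →ₗ[F] B'} (e : B' ≃ₗ[F] B) (hm : ∀ x y, e (x * y) = e x * e y)
    (hc : ∀ x, e (τ' x) = τ (e x)) : BioctonionDecomposition τ' where
  C₁ := D.C₁
  C₂ := D.C₂
  iso := e.trans D.iso
  map_mul x y := by simp only [LinearEquiv.trans_apply, hm, D.map_mul]
  map_conj x := by simp only [LinearEquiv.trans_apply, hc, D.map_conj]

variable [SMulCommClass F B B] [IsScalarTower F B B] (K : Type u) [Field K] [Algebra F K]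

/-- The canonical isomorphism from the scalar extension of a tensor product of two octonion
algebras to the tensor product of the scalar extensions. -/
noncomputable def distribEquiv (C₁ C₂ : OctonionAlgebra F) (h2 : (2 : K) ≠ 0) :
    (K ⊗[F] (C₁ ⊗[F] C₂)) ≃ₗ[K] (C₁.baseChange K h2 ⊗[K] C₂.baseChange K h2) :=
  (TensorProduct.AlgebraTensorModule.distribBaseChange F K C₁ C₂).trans
    (TensorProduct.congr (C₁.toBaseChange K h2) (C₂.toBaseChange K h2))

theorem distribEquiv_tmul (C₁ C₂ : OctonionAlgebra F) (h2 : (2 : K) ≠ 0) (a : K) (x : C₁)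
    (y : C₂) : distribEquiv K C₁ C₂ h2 (a ⊗ₜ (x ⊗ₜ y)) =
      C₁.toBaseChange K h2 (a ⊗ₜ x) ⊗ₜ C₂.toBaseChange K h2 (1 ⊗ₜ y) := rfl

theorem distribEquiv_mul (C₁ C₂ : OctonionAlgebra F) (h2 : (2 : K) ≠ 0)
    (s t : K ⊗[F] (C₁ ⊗[F] C₂)) :
    distribEquiv K C₁ C₂ h2 (s * t) = distribEquiv K C₁ C₂ h2 s * distribEquiv K C₁ C₂ h2 t := by
  induction s using TensorProduct.induction_on with
  | zero => rw [zero_mul, map_zero, zero_mul]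
  | add s s' h h' => rw [add_mul, map_add, h, h', map_add, add_mul]
  | tmul a s =>
  induction s using TensorProduct.induction_on with
  | zero => rw [TensorProduct.tmul_zero, zero_mul, map_zero, zero_mul]
  | add s s' h h' => rw [TensorProduct.tmul_add, add_mul, map_add, h, h', map_add, add_mul]
  | tmul x y =>
  induction t using TensorProduct.induction_on with
  | zero => rw [mul_zero, map_zero, mul_zero]
  | add s s' h h' => rw [mul_add, map_add, h, h', map_add, mul_add]
  | tmul b t =>
  induction t using TensorProduct.induction_on with
  | zero => rw [TensorProduct.tmul_zero, mul_zero, map_zero, mul_zero]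
  | add s s' h h' => rw [TensorProduct.tmul_add, mul_add, map_add, h, h', map_add, mul_add]
  | tmul z w =>
    rw [Algebra.TensorProduct.tmul_mul_tmul, Algebra.TensorProduct.tmul_mul_tmul,
      distribEquiv_tmul, distribEquiv_tmul, distribEquiv_tmul,
      Algebra.TensorProduct.tmul_mul_tmul, ← OctonionAlgebra.toBaseChange_mul,
      ← OctonionAlgebra.toBaseChange_mul, Algebra.TensorProduct.tmul_mul_tmul,
      Algebra.TensorProduct.tmul_mul_tmul, one_mul]

theorem distribEquiv_conj (C₁ C₂ : OctonionAlgebra F) (h2 : (2 : K) ≠ 0)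
    (s : K ⊗[F] (C₁ ⊗[F] C₂)) :
    distribEquiv K C₁ C₂ h2 ((TensorProduct.map C₁.conj C₂.conj).baseChange K s) =
      TensorProduct.map (C₁.baseChange K h2).conj (C₂.baseChange K h2).conj
        (distribEquiv K C₁ C₂ h2 s) := by
  induction s using TensorProduct.induction_on with
  | zero => simp only [map_zero]
  | add s s' h h' => simp only [map_add, h, h']
  | tmul a s =>
  induction s using TensorProduct.induction_on with
  | zero => simp only [TensorProduct.tmul_zero, map_zero]
  | add s s' h h' => simp only [TensorProduct.tmul_add, map_add, h, h']
  | tmul x y =>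
    rw [LinearMap.baseChange_tmul, TensorProduct.map_tmul, distribEquiv_tmul, distribEquiv_tmul,
      TensorProduct.map_tmul, OctonionAlgebra.baseChange_conj, OctonionAlgebra.baseChange_conj,
      LinearMap.baseChange_tmul, LinearMap.baseChange_tmul]

/-- Scalar extension of a decomposition. -/
noncomputable def baseChange (D : BioctonionDecomposition τ) (h2 : (2 : K) ≠ 0) :
    BioctonionDecomposition (τ.baseChange K) where
  C₁ := D.C₁.baseChange K h2
  C₂ := D.C₂.baseChange K h2
  iso := (D.iso.baseChange F K B (D.C₁ ⊗[F] D.C₂)).trans (distribEquiv K D.C₁ D.C₂ h2)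
  map_mul x y := by
    rw [LinearEquiv.trans_apply, LinearEquiv.trans_apply, LinearEquiv.trans_apply,
      ← distribEquiv_mul]
    congr 1
    induction x using TensorProduct.induction_on with
    | zero => rw [zero_mul, map_zero, zero_mul]
    | add x x' h h' => rw [add_mul, map_add, h, h', map_add, add_mul]
    | tmul a x =>
    induction y using TensorProduct.induction_on with
    | zero => rw [mul_zero, map_zero, mul_zero]
    | add x x' h h' => rw [mul_add, map_add, h, h', map_add, mul_add]
    | tmul b y =>
      simp only [Algebra.TensorProduct.tmul_mul_tmul, LinearEquiv.baseChange_tmul, D.map_mul]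
  map_conj x := by
    rw [LinearEquiv.trans_apply, LinearEquiv.trans_apply, ← distribEquiv_conj]
    congr 1
    induction x using TensorProduct.induction_on with
    | zero => simp only [map_zero]
    | add x x' h h' => simp only [map_add, h, h']
    | tmul a x =>
      simp only [LinearMap.baseChange_tmul, LinearEquiv.baseChange_tmul, D.map_conj]

theorem Signs.baseChange {D : BioctonionDecomposition τ} {δ : F} {x y : B} (h : D.Signs δ x y)
    (h2 : (2 : K) ≠ 0) :
    (D.baseChange K h2).Signs (algebraMap F K δ) (1 ⊗ₜ x) (1 ⊗ₜ y) := by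
  obtain ⟨s₁, s₂, h₁, h₂, hx, hy⟩ := h
  refine ⟨D.C₁.toBaseChange K h2 (1 ⊗ₜ s₁), D.C₂.toBaseChange K h2 (1 ⊗ₜ s₂), ?_, ?_, ?_, ?_⟩
  · refine (D.C₁.baseChange_conj K h2 _).trans ?_
    rw [LinearMap.baseChange_tmul, h₁, TensorProduct.tmul_neg, map_neg]
    rfl
  · refine (D.C₂.baseChange_conj K h2 _).trans ?_
    rw [LinearMap.baseChange_tmul, h₂, TensorProduct.tmul_neg, map_neg]
    rfl
  · change distribEquiv K D.C₁ D.C₂ h2 (D.iso.baseChange F K B (D.C₁ ⊗[F] D.C₂) (1 ⊗ₜ x)) = _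
    rw [LinearEquiv.baseChange_tmul, hx, TensorProduct.tmul_add, map_add, distribEquiv_tmul,
      distribEquiv_tmul]
    rfl
  · change distribEquiv K D.C₁ D.C₂ h2 (D.iso.baseChange F K B (D.C₁ ⊗[F] D.C₂) (1 ⊗ₜ y)) = _
    rw [LinearEquiv.baseChange_tmul, hy, TensorProduct.tmul_smul, TensorProduct.tmul_sub,
      ← algebraMap_smul K, map_smul, map_sub, distribEquiv_tmul, distribEquiv_tmul]
    rfl

end BioctonionDecomposition

section Tower

variable {k : Type u} [Field k] {A : Type u} [NonAssocRing A] [Module k A] [SMulCommClass k A A]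
  [IsScalarTower k A A] {σ : A →ₗ[k] A} (E K : Type u) [Field E] [Field K] [Algebra k E]
  [Algebra k K] [Algebra E K] [IsScalarTower k E K]

/-- Scalar extension, from `E` to `K`, of a decomposition of `E ⊗ A`. -/
noncomputable def BioctonionDecomposition.extend (D : BioctonionDecomposition (σ.baseChange E))
    (h2 : (2 : K) ≠ 0) : BioctonionDecomposition (σ.baseChange K) :=
  (D.baseChange K h2).congr
    (TensorProduct.AlgebraTensorModule.cancelBaseChange k E K K A).symm
    (fun x y ↦ by
      induction x using TensorProduct.induction_on with
      | zero => rw [zero_mul, map_zero]; exact (zero_mul (M₀ := K ⊗[E] (E ⊗[k] A)) _).symm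
      | add x x' h h' => rw [add_mul, map_add, h, h', map_add, add_mul]
      | tmul a x =>
      induction y using TensorProduct.induction_on with
      | zero => rw [mul_zero, map_zero]; exact (mul_zero (M₀ := K ⊗[E] (E ⊗[k] A)) _).symm
      | add x x' h h' => rw [mul_add, map_add, h, h', map_add, mul_add]
      | tmul b y =>
        simp only [Algebra.TensorProduct.tmul_mul_tmul,
          TensorProduct.AlgebraTensorModule.cancelBaseChange_symm_tmul, one_mul])
    (fun x ↦ by
      induction x using TensorProduct.induction_on with
      | zero => simp only [map_zero]
      | add x x' h h' => simp only [map_add, h, h']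
      | tmul a x =>
        simp only [LinearMap.baseChange_tmul,
          TensorProduct.AlgebraTensorModule.cancelBaseChange_symm_tmul])

theorem BioctonionDecomposition.Signs.extend {D : BioctonionDecomposition (σ.baseChange E)}
    {δ : E} {x y : A} (h : D.Signs δ (1 ⊗ₜ x) (1 ⊗ₜ y)) (h2 : (2 : K) ≠ 0) :
    (D.extend E K h2).Signs (algebraMap E K δ) (1 ⊗ₜ x) (1 ⊗ₜ y) :=
  h.baseChange K h2

end Tower

/-! ### The matrix of quartic forms -/

section Sums

variable {F : Type u} [Field F] {B : Type u} [NonAssocRing B] [Module F B] (τ : B →ₗ[F] B)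
  {ι : Type*} [Fintype ι] (g : ι → B) (x y z : B)

theorem opV_sum_left : opV τ (∑ i, g i) y z = ∑ i, opV τ (g i) y z :=
  map_sum (AddMonoidHom.mk' (fun x ↦ opV τ x y z) fun a b ↦ opV_add_left τ a b y z) _ _

theorem opV_sum_middle : opV τ x (∑ i, g i) z = ∑ i, opV τ x (g i) z :=
  map_sum (AddMonoidHom.mk' (fun y ↦ opV τ x y z) fun a b ↦ opV_add_middle τ x a b z) _ _

theorem opV_sum_right : opV τ x y (∑ i, g i) = ∑ i, opV τ x y (g i) :=
  map_sum (AddMonoidHom.mk' (fun z ↦ opV τ x y z) fun a b ↦ opV_add_right τ x y a b) _ _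

theorem opPsi_sum_left : opPsi τ (∑ i, g i) y = ∑ i, opPsi τ (g i) y := by
  simp only [opPsi, map_sum, Finset.sum_mul, Finset.mul_sum, Finset.sum_sub_distrib]

theorem opPsi_sum_right : opPsi τ x (∑ i, g i) = ∑ i, opPsi τ x (g i) := by
  simp only [opPsi, map_sum, Finset.sum_mul, Finset.mul_sum, Finset.sum_sub_distrib]

end Sums

section BaseChange

variable {k : Type u} [Field k] {A : Type u} [NonAssocRing A] [Module k A] [SMulCommClass k A A]
  [IsScalarTower k A A] (σ : A →ₗ[k] A) (K : Type u) [Field K] [Algebra k K]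

theorem opV_baseChange_tmul (a b c : K) (x y z : A) :
    opV (σ.baseChange K) (a ⊗ₜ x) (b ⊗ₜ y) (c ⊗ₜ z) = (a * b * c) ⊗ₜ[k] opV σ x y z := by
  simp only [opV, LinearMap.baseChange_tmul, Algebra.TensorProduct.tmul_mul_tmul,
    TensorProduct.tmul_add, TensorProduct.tmul_sub]
  rw [show c * b * a = a * b * c by ring, show c * a * b = a * b * c by ring]

theorem opPsi_baseChange_tmul (a b : K) (x y : A) :
    opPsi (σ.baseChange K) (a ⊗ₜ x) (b ⊗ₜ y) = (a * b) ⊗ₜ[k] opPsi σ x y := by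
  simp only [opPsi, LinearMap.baseChange_tmul, Algebra.TensorProduct.tmul_mul_tmul,
    TensorProduct.tmul_sub]
  rw [mul_comm b a]

variable {σ}

theorem IsInvolution.baseChange (hσ : IsInvolution σ) : IsInvolution (σ.baseChange K) where
  involutive x := by
    induction x using TensorProduct.induction_on with
    | zero => simp
    | add x y hx hy => rw [map_add, map_add, hx, hy]
    | tmul a x => rw [LinearMap.baseChange_tmul, LinearMap.baseChange_tmul, hσ.involutive]
  map_mul x y := by
    induction x using TensorProduct.induction_on with
    | zero => simp
    | add x y hx hy => rw [add_mul, map_add, map_add, mul_add, hx, hy]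
    | tmul a x =>
    induction y using TensorProduct.induction_on with
    | zero => simp
    | add x y hx hy => rw [mul_add, map_add, map_add, add_mul, hx, hy]
    | tmul b y =>
      simp only [LinearMap.baseChange_tmul, Algebra.TensorProduct.tmul_mul_tmul, hσ.map_mul,
        mul_comm a b]

variable {K}

theorem one_tmul_mem_skew {s : A} (hs : s ∈ skew σ) : (1 : K) ⊗ₜ[k] s ∈ skew (σ.baseChange K) := by
  change σ.baseChange K _ = _
  rw [LinearMap.baseChange_tmul, show σ s = -s from hs, TensorProduct.tmul_neg]

end BaseChange

section QuarticMatrix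

variable {k : Type u} [Field k] {A : Type u} [NonAssocRing A] [Module k A] [SMulCommClass k A A]
  [IsScalarTower k A A] {σ : A →ₗ[k] A} (hσ : IsInvolution σ) (f : skew σ →ₗ[k] skew σ)
  {ι κ : Type*} [Fintype ι] [Fintype κ] (b : Module.Basis ι k A)
  (c : Module.Basis κ k (skew σ))

variable (σ) in
/-- A quadrilinear map, with skew values, whose restriction to the diagonal is `ψ(x, U_x(u x))`. -/
def quarticPolar (hσ : IsInvolution σ) (u x y z w : A) : skew σ :=
  ⟨opPsi σ x (opV σ w (u * z) y), opPsi_mem_skew hσ _ _⟩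

open MvPolynomial in
/-- The matrix of the maps `M_x` with respect to the basis `c`, whose entries are polynomials in the
coordinates of `x` with respect to `b`. -/
noncomputable def quarticMatrix : Matrix κ κ (MvPolynomial ι k) := fun i j ↦
  ∑ p, ∑ q, ∑ r, ∑ t,
    C ((6 : k)⁻¹ * c.repr (quarticPolar σ hσ (f (c j)) (b p) (b q) (b r) (b t)) i) *
      (X p * X q * X r * X t)

omit [SMulCommClass k A A] [IsScalarTower k A A] [Fintype κ] in
open MvPolynomial in
theorem quarticMatrix_isHomogeneous (i j : κ) : (quarticMatrix hσ f b c i j).IsHomogeneous 4 := by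
  have key : ∀ (a : k) (p q r t : ι),
      (C a * (X p * X q * X r * X t) : MvPolynomial ι k).IsHomogeneous 4 := by
    intro a p q r t
    have h := ((((isHomogeneous_X k p).mul (isHomogeneous_X k q)).mul (isHomogeneous_X k r)).mul
      (isHomogeneous_X k t))
    have h' := (isHomogeneous_C ι a).mul h
    rwa [show 0 + (1 + 1 + 1 + 1) = 4 by norm_num] at h'
  rw [quarticMatrix]
  exact MvPolynomial.IsHomogeneous.sum _ _ _ fun p _ ↦ MvPolynomial.IsHomogeneous.sum _ _ _
    fun q _ ↦ MvPolynomial.IsHomogeneous.sum _ _ _ fun r _ ↦ MvPolynomial.IsHomogeneous.sum _ _ _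
    fun t _ ↦ key _ _ _ _ _

/-- The columns of the quartic matrix are the coordinates of the images of the basis vectors, over
every extension field. -/
theorem sum_aeval_quarticMatrix (h6 : (6 : k) ≠ 0) (K : Type u) [Field K] [Algebra k K]
    (x : ι → K) (j : κ) :
    opPsi (σ.baseChange K) (∑ i, x i ⊗ₜ b i) (opU (σ.baseChange K) (∑ i, x i ⊗ₜ b i)
      (((1 : K) ⊗ₜ[k] (f (c j) : A)) * ∑ i, x i ⊗ₜ b i)) =
    ∑ i, ((6 : K) * MvPolynomial.aeval x (quarticMatrix hσ f b c i j)) ⊗ₜ[k] (c i : A) := by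
  have h6' : (6 : K) * algebraMap k K (6⁻¹) = 1 := by
    have : (6 : K) = algebraMap k K 6 := by rw [map_ofNat]
    rw [this, ← map_mul, mul_inv_cancel₀ h6, map_one]
  have hc : ∀ (a : K) (v : skew σ), a ⊗ₜ[k] (v : A) =
      ∑ i, (a * algebraMap k K (c.repr v i)) ⊗ₜ[k] (c i : A) := by
    intro a v
    conv_lhs => rw [← c.sum_repr v]
    rw [Submodule.coe_sum, TensorProduct.tmul_sum]
    refine Finset.sum_congr rfl fun i _ ↦ ?_
    rw [Submodule.coe_smul, TensorProduct.tmul_smul, TensorProduct.smul_tmul', Algebra.smul_def,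
      mul_comm]
  have hl : opPsi (σ.baseChange K) (∑ i, x i ⊗ₜ b i) (opU (σ.baseChange K) (∑ i, x i ⊗ₜ b i)
      (((1 : K) ⊗ₜ[k] (f (c j) : A)) * ∑ i, x i ⊗ₜ b i)) = ∑ p, ∑ q, ∑ r, ∑ t,
      (x p * x q * x r * x t) ⊗ₜ[k]
        (quarticPolar σ hσ (f (c j)) (b p) (b q) (b r) (b t) : A) := by
    rw [opU, opPsi_sum_left]
    simp only [opV_sum_left, opPsi_sum_right, Finset.mul_sum, opV_sum_middle, opV_sum_right,
      opV_baseChange_tmul, opPsi_baseChange_tmul, Algebra.TensorProduct.tmul_mul_tmul]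
    refine Finset.sum_congr rfl fun p _ ↦ Finset.sum_congr rfl fun q _ ↦ Finset.sum_congr rfl
      fun r _ ↦ Finset.sum_congr rfl fun t _ ↦ ?_
    rw [show x p * (x t * (1 * x r) * x q) = x p * x q * x r * x t by ring]
    rfl
  have hs : ∀ T : ι → ι → ι → ι → κ → K ⊗[k] A, ∑ p, ∑ q, ∑ r, ∑ t, ∑ i, T p q r t i =
      ∑ i, ∑ p, ∑ q, ∑ r, ∑ t, T p q r t i := by
    intro T
    simp_rw [Finset.sum_comm (γ := κ)]
  rw [hl]
  have hc' := fun a p q r t ↦ hc a (quarticPolar σ hσ (f (c j)) (b p) (b q) (b r) (b t))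
  simp only [hc']
  rw [hs]
  refine Finset.sum_congr rfl fun i _ ↦ ?_
  simp only [quarticMatrix, map_sum, map_mul, MvPolynomial.aeval_C, MvPolynomial.aeval_X,
    Finset.mul_sum, TensorProduct.sum_tmul]
  refine Finset.sum_congr rfl fun p _ ↦ Finset.sum_congr rfl fun q _ ↦ Finset.sum_congr rfl
      fun r _ ↦ Finset.sum_congr rfl fun t _ ↦ ?_
  congr 1
  linear_combination (-(x p * x q * x r * x t) *
    algebraMap k K (c.repr (quarticPolar σ hσ (f (c j)) (b p) (b q) (b r) (b t)) i)) * h6'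

/-- The evaluation of the quartic matrix at a point of `A` is the matrix of `M_x`. -/
theorem quarticMatrix_map_eval [DecidableEq κ] (h6 : (6 : k) ≠ 0) (x : A) :
    (quarticMatrix hσ f b c).map (MvPolynomial.eval (b.repr x)) =
      LinearMap.toMatrix c c (opM hσ f x) := by
  ext i j
  rw [LinearMap.toMatrix_apply, Matrix.map_apply]
  have h := sum_aeval_quarticMatrix hσ f b c h6 k (b.repr x) j
  have hx : ∑ i, b.repr x i ⊗ₜ[k] b i = 1 ⊗ₜ x := by
    conv_rhs => rw [← b.sum_repr x]
    rw [TensorProduct.tmul_sum]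
    refine Finset.sum_congr rfl fun i _ ↦ ?_
    rw [TensorProduct.tmul_smul, TensorProduct.smul_tmul', smul_eq_mul, mul_one]
  rw [hx, Algebra.TensorProduct.tmul_mul_tmul, opU, opV_baseChange_tmul, opPsi_baseChange_tmul] at h
  have h' := congrArg (TensorProduct.lid k A) h
  rw [map_sum] at h'
  simp only [TensorProduct.lid_tmul, mul_one, one_smul] at h'
  have h'' : opM hσ f x (c j) =
      ∑ i, MvPolynomial.aeval (b.repr x) (quarticMatrix hσ f b c i j) • c i := by
    apply Subtype.ext
    change (6 : k)⁻¹ • opPsi σ x (opV σ x ((f (c j) : A) * x) x) = _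
    rw [h', Submodule.coe_sum, Finset.smul_sum]
    refine Finset.sum_congr rfl fun i _ ↦ ?_
    rw [smul_smul, inv_mul_cancel_left₀ h6]; rfl
  rw [h'', c.repr_sum_self, MvPolynomial.aeval_eq_eval']

end QuarticMatrix

section Square

variable {k : Type u} [Field k] {A : Type u} [NonAssocRing A] [Module k A] [SMulCommClass k A A]
  [IsScalarTower k A A] {σ : A →ₗ[k] A} (hσ : IsInvolution σ) {f : skew σ →ₗ[k] skew σ}
  {ι κ : Type*} [Fintype ι] [Fintype κ] [DecidableEq κ] (b : Module.Basis ι k A)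
  (c : Module.Basis κ k (skew σ))
  {K : Type u} [Field K] [Algebra k K] (D : BioctonionDecomposition (σ.baseChange K)) {d : k}
  {δ : K}

theorem BioctonionDecomposition.Signs.eq_smul {F : Type u} [Field F] {B : Type u} [NonAssocRing B]
    [Module F B] {τ : B →ₗ[F] B} {D : BioctonionDecomposition τ} {δ : F} {x y : B}
    (h : D.Signs δ x y) : y = δ • D.natural x := by
  obtain ⟨s₁, s₂, h₁, h₂, hx, hy⟩ := h
  apply D.iso.injective
  rw [hy, map_smul, D.iso_natural_eq h₂ hx]

omit [SMulCommClass k A A] [IsScalarTower k A A] [DecidableEq κ] in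
/-- Coefficients with respect to the image of a basis of the skew elements are unique. -/
theorem coeff_eq_of_sum_tmul_eq {a a' : κ → K}
    (h : ∑ i, a i ⊗ₜ[k] (c i : A) = ∑ i, a' i ⊗ₜ[k] (c i : A)) : a = a' := by
  classical
  obtain ⟨π, hπ⟩ := (skew σ).subtype.exists_leftInverse_of_injective (Submodule.ker_subtype _)
  have hπ' : ∀ s : skew σ, π (s : A) = s := fun s ↦ LinearMap.congr_fun hπ s
  funext l
  have := congrArg (TensorProduct.rid k K ∘ ((c.coord l).comp π).lTensor K) h
  simpa [hπ', Finsupp.single_apply, Finset.sum_ite_eq] using this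

/-- Where `M_x² = ν id` for the sign change of a decomposition over `K`, the quartic matrix of a map
`f` that is `δ` times the sign change squares to `δ² ν = d ν`. -/
theorem aeval_sq_quarticMatrix (h2 : (2 : k) ≠ 0) (h3 : (3 : k) ≠ 0)
    (hδ : δ ^ 2 = algebraMap k K d)
    (hf : ∀ s : skew σ, D.Signs δ (1 ⊗ₜ (s : A)) (1 ⊗ₜ (f s : A))) {q : K ⊗[k] A → K}
    {x : ι → K} {ν : K}
    (h : NormValue (σ.baseChange K) D.natural q (∑ i, x i ⊗ₜ b i) ν) (i j : κ) :
    MvPolynomial.aeval x ((quarticMatrix hσ f b c * quarticMatrix hσ f b c) i j) =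
      if i = j then algebraMap k K d * ν else 0 := by
  have h6 : (6 : k) ≠ 0 := by
    rw [show (6 : k) = 2 * 3 by norm_num]; exact mul_ne_zero h2 h3
  have h6' : (6 : K) ≠ 0 := ofNat_ne_zero_of_algebra h6
  have hcol := sum_aeval_quarticMatrix hσ f b c h6 K x
  generalize hX : ∑ i, x i ⊗ₜ[k] b i = X at h hcol
  set P := quarticMatrix hσ f b c with hP
  let L : K ⊗[k] A →ₗ[K] K ⊗[k] A :=
    { toFun := fun u ↦ opPsi (σ.baseChange K) X (opU (σ.baseChange K) X (u * X))
      map_add' := fun u v ↦ by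
        simp only [add_mul, opU, opV_add_middle, opPsi, mul_add, map_add]; abel
      map_smul' := fun a u ↦ by
        simp only [smul_mul_assoc, opU, opV_smul_middle, opPsi_smul_right, RingHom.id_apply] }
  have hL : ∀ u, quarticMap (σ.baseChange K) D.natural X u = L (D.natural u) := fun _ ↦ rfl
  have hcol' : ∀ j, δ • L (D.natural ((1 : K) ⊗ₜ[k] (c j : A))) =
      ∑ i, ((6 : K) * MvPolynomial.aeval x (P i j)) • ((1 : K) ⊗ₜ[k] (c i : A)) := by
    intro j
    rw [← map_smul, ← (hf (c j)).eq_smul]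
    refine (hcol j).trans (Finset.sum_congr rfl fun i _ ↦ ?_)
    rw [TensorProduct.smul_tmul', smul_eq_mul, mul_one]
  have hsq := h.sq _ (one_tmul_mem_skew (c j).2)
  rw [hL, hL] at hsq
  have hsq' : ∑ l, ((36 : K) * ∑ i, MvPolynomial.aeval x (P i j) *
      MvPolynomial.aeval x (P l i)) ⊗ₜ[k] (c l : A) =
      ∑ l, ((36 : K) * if l = j then algebraMap k K d * ν else 0) ⊗ₜ[k] (c l : A) := by
    have h1 : δ • L (D.natural (δ • L (D.natural ((1 : K) ⊗ₜ[k] (c j : A))))) =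
        ((36 : K) * (algebraMap k K d * ν)) ⊗ₜ[k] (c j : A) := by
      rw [map_smul, map_smul, hsq, smul_smul, smul_smul, TensorProduct.smul_tmul', smul_eq_mul,
        ← hδ]
      congr 1; ring
    rw [hcol', map_sum, map_sum, Finset.smul_sum] at h1
    simp only [map_smul, smul_comm δ, hcol'] at h1
    have h2 : ∑ l, ((36 : K) * if l = j then algebraMap k K d * ν else 0) ⊗ₜ[k] (c l : A) =
        ((36 : K) * (algebraMap k K d * ν)) ⊗ₜ[k] (c j : A) := by
      rw [Finset.sum_eq_single j]
      · rw [if_pos rfl]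
      · intro l _ hl
        rw [if_neg hl, mul_zero, TensorProduct.zero_tmul]
      · simp
    rw [h2, ← h1]
    simp only [Finset.smul_sum]
    rw [Finset.sum_comm]
    refine Finset.sum_congr rfl fun l _ ↦ ?_
    rw [Finset.mul_sum, TensorProduct.sum_tmul]
    refine Finset.sum_congr rfl fun i _ ↦ ?_
    rw [smul_smul, TensorProduct.smul_tmul', smul_eq_mul]
    congr 1; ring
  have hfin := congrFun (coeff_eq_of_sum_tmul_eq c hsq') i
  have h36 : (36 : K) ≠ 0 := by rw [show (36 : K) = 6 * 6 by norm_num]; exact mul_ne_zero h6' h6'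
  rw [Matrix.mul_apply, map_sum, ← mul_left_cancel₀ h36 hfin]
  refine Finset.sum_congr rfl fun l _ ↦ ?_
  rw [map_mul, mul_comm]

end Square

/-! ### The octic form -/

/-- Any two extensions of a field are contained in an algebraically closed one. -/
theorem exists_isAlgClosed_extension (k K E : Type u) [Field k] [Field K] [Field E] [Algebra k K]
    [Algebra k E] : ∃ (Ω : Type u) (_ : Field Ω) (_ : IsAlgClosed Ω) (_ : Algebra k Ω)
      (_ : Algebra K Ω) (_ : Algebra E Ω), IsScalarTower k K Ω ∧ IsScalarTower k E Ω := by
  obtain ⟨m, hm⟩ := Ideal.exists_maximal (K ⊗[k] E)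
  let _ : Field ((K ⊗[k] E) ⧸ m) := Ideal.Quotient.field m
  let Ω := AlgebraicClosure ((K ⊗[k] E) ⧸ m)
  let g : (K ⊗[k] E) →+* Ω := (algebraMap _ Ω).comp (Ideal.Quotient.mk m)
  let _ : Algebra k Ω := (g.comp (algebraMap k (K ⊗[k] E))).toAlgebra
  let _ : Algebra K Ω := (g.comp Algebra.TensorProduct.includeLeftRingHom).toAlgebra
  let _ : Algebra E Ω := (g.comp
    (Algebra.TensorProduct.includeRight : E →ₐ[k] K ⊗[k] E).toRingHom).toAlgebra
  refine ⟨Ω, inferInstance, inferInstance, inferInstance, inferInstance, inferInstance,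
    IsScalarTower.of_algebraMap_eq fun x ↦ rfl, IsScalarTower.of_algebraMap_eq fun x ↦ ?_⟩
  change g (algebraMap k (K ⊗[k] E) x) = g (Algebra.TensorProduct.includeRight (algebraMap k E x))
  rw [AlgHom.commutes]

section Descent

variable {k : Type u} [Field k] {A : Type u} [NonAssocRing A] [Module k A] [SMulCommClass k A A]
  [IsScalarTower k A A] (σ : A →ₗ[k] A) {K Ω : Type u} [Field K] [Field Ω] [Algebra k K]
  [Algebra k Ω] [Algebra K Ω] [IsScalarTower k K Ω]

/-- Conjugate-invertibility is insensitive to field extensions. -/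
theorem conjInvertible_baseChange_iff (X : K ⊗[k] A) :
    ConjInvertible (σ.baseChange Ω) ((IsScalarTower.toAlgHom k K Ω).toLinearMap.rTensor A X) ↔
      ConjInvertible (σ.baseChange K) X := by
  set j := (IsScalarTower.toAlgHom k K Ω).toLinearMap.rTensor A with hj
  have hjt : ∀ (a : K) (x : A), j (a ⊗ₜ x) = algebraMap K Ω a ⊗ₜ x := fun a x ↦ rfl
  have hjm : ∀ x y, j (x * y) = j x * j y := by
    intro x y
    induction x using TensorProduct.induction_on with
    | zero => rw [zero_mul, map_zero, zero_mul]
    | add x x' h h' => rw [add_mul, map_add, h, h', map_add, add_mul]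
    | tmul a x =>
    induction y using TensorProduct.induction_on with
    | zero => rw [mul_zero, map_zero, mul_zero]
    | add x x' h h' => rw [mul_add, map_add, h, h', map_add, mul_add]
    | tmul b y => simp only [hjt, Algebra.TensorProduct.tmul_mul_tmul, map_mul]
  have hjσ : ∀ x, j (σ.baseChange K x) = σ.baseChange Ω (j x) := by
    intro x
    induction x using TensorProduct.induction_on with
    | zero => simp only [map_zero]
    | add x x' h h' => simp only [map_add, h, h']
    | tmul a x => simp only [hjt, LinearMap.baseChange_tmul]
  have hjV : ∀ x y z, j (opV (σ.baseChange K) x y z) = opV (σ.baseChange Ω) (j x) (j y) (j z) := by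
    intro x y z
    simp only [opV, map_sub, map_add, hjm, hjσ]
  constructor
  · -- a `K`-linear retraction of `Ω` onto `K` carries a conjugate inverse down
    rintro ⟨y, hy⟩
    obtain ⟨ρ, hρ⟩ := (Algebra.linearMap K Ω).exists_leftInverse_of_injective
      (LinearMap.ker_eq_bot.2 (algebraMap K Ω).injective)
    have hρ' : ∀ a, ρ (algebraMap K Ω a) = a := fun a ↦ LinearMap.congr_fun hρ a
    have hρm : ∀ (a : K) (w : Ω), ρ (algebraMap K Ω a * w) = a * ρ w := by
      intro a w
      rw [← Algebra.smul_def, map_smul, smul_eq_mul]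
    set r := (ρ.restrictScalars k).rTensor A with hr
    have hrt : ∀ (a : Ω) (x : A), r (a ⊗ₜ x) = ρ a ⊗ₜ x := fun a x ↦ rfl
    have hrj : ∀ x, r (j x) = x := by
      intro x
      induction x using TensorProduct.induction_on with
      | zero => simp only [map_zero]
      | add x x' h h' => simp only [map_add, h, h']
      | tmul a x => rw [hjt, hrt, hρ']
    have hrl : ∀ x w, r (j x * w) = x * r w := by
      intro x y
      induction x using TensorProduct.induction_on with
      | zero => rw [map_zero, zero_mul, map_zero, zero_mul]
      | add x x' h h' => rw [map_add, add_mul, map_add, h, h', add_mul]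
      | tmul a x =>
      induction y using TensorProduct.induction_on with
      | zero => rw [mul_zero, map_zero, mul_zero]
      | add x x' h h' => rw [mul_add, map_add, h, h', map_add, mul_add]
      | tmul b y => simp only [hjt, Algebra.TensorProduct.tmul_mul_tmul, hrt, hρm]
    have hrr : ∀ x w, r (w * j x) = r w * x := by
      intro x y
      induction x using TensorProduct.induction_on with
      | zero => rw [map_zero, mul_zero, map_zero, mul_zero]
      | add x x' h h' => rw [map_add, mul_add, map_add, h, h', mul_add]
      | tmul a x =>
      induction y using TensorProduct.induction_on with
      | zero => rw [zero_mul, map_zero, zero_mul]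
      | add x x' h h' => rw [add_mul, map_add, h, h', map_add, add_mul]
      | tmul b y =>
        simp only [hjt, Algebra.TensorProduct.tmul_mul_tmul, hrt, mul_comm b, hρm, mul_comm a]
    have hrσ : ∀ x, r (σ.baseChange Ω x) = σ.baseChange K (r x) := by
      intro x
      induction x using TensorProduct.induction_on with
      | zero => simp only [map_zero]
      | add x x' h h' => simp only [map_add, h, h']
      | tmul a x => simp only [hrt, LinearMap.baseChange_tmul]
    refine ⟨r y, fun z ↦ ?_⟩
    have h := congrArg r (hy (j z))
    rw [hrj] at h
    refine Eq.trans ?_ h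
    simp only [opV, map_sub, map_add, hrl, hrr, ← hjσ, hrσ, ← hjm]
  · rintro ⟨y, hy⟩
    refine ⟨j y, fun z ↦ ?_⟩
    induction z using TensorProduct.induction_on with
    | zero => rw [opV_zero_right]
    | add z z' h h' => rw [opV_add_right, h, h']
    | tmul a z =>
      have h := hy (1 ⊗ₜ z)
      have h' := congrArg j h
      rw [hjV, hjt, map_one] at h'
      have e : a ⊗ₜ[k] z = a • ((1 : Ω) ⊗ₜ[k] z) := by
        rw [TensorProduct.smul_tmul', smul_eq_mul, mul_one]
      rw [e, opV_smul_right, h']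

end Descent

theorem BioctonionDecomposition.one_ne_zero {F : Type u} [Field F] {B : Type u} [NonAssocRing B]
    [Module F B] {τ : B →ₗ[F] B} (D : BioctonionDecomposition τ) : (1 : B) ≠ 0 := by
  intro h
  have h1 : Module.finrank F (D.C₁ ⊗[F] D.C₂) = 64 := by
    rw [Module.finrank_tensorProduct, D.C₁.finrank_eq, D.C₂.finrank_eq]
  have h2 : Subsingleton B := subsingleton_of_forall_eq 0 fun x ↦ by rw [← mul_one x, h, mul_zero]
  have h3 : Subsingleton (D.C₁ ⊗[F] D.C₂) := D.iso.symm.toEquiv.subsingleton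
  rw [Module.finrank_zero_of_subsingleton] at h1
  omega

theorem sum_tmul_basis_repr_one {k A Ω ι : Type*} [Field k] [NonAssocRing A] [Module k A] [Field Ω]
    [Algebra k Ω] [Fintype ι] (b : Module.Basis ι k A) :
    ∑ i, algebraMap k Ω (b.repr 1 i) ⊗ₜ[k] b i = 1 ⊗ₜ 1 := by
  conv_rhs => rw [← b.sum_repr 1, TensorProduct.tmul_sum]
  refine Finset.sum_congr rfl fun i _ ↦ ?_
  rw [TensorProduct.tmul_smul, TensorProduct.smul_tmul', Algebra.smul_def, mul_one]

section Norm

variable {k : Type u} [Field k] {A : Type u} [NonAssocRing A] [Module k A] [SMulCommClass k A A]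
  [IsScalarTower k A A] {σ : A →ₗ[k] A} (hσ : IsInvolution σ) {f : skew σ →ₗ[k] skew σ}
  {ι κ : Type*} [Fintype ι] [Fintype κ] [DecidableEq κ] [Nonempty κ] (b : Module.Basis ι k A)
  (c : Module.Basis κ k (skew σ))

/-- If `f` becomes a `♮`-map over some extension, its quartic matrix is a matrix factorization of
an octic form that detects conjugate-invertibility. -/
theorem exists_detecting_form (h2 : (2 : k) ≠ 0) (h3 : (3 : k) ≠ 0) {E : Type u} [Field E]
    [Algebra k E] (D : BioctonionDecomposition (σ.baseChange E)) {d : k} (hd : d ≠ 0) {δ : E}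
    (hδ : δ ^ 2 = algebraMap k E d)
    (hf : ∀ s : skew σ, D.Signs δ (1 ⊗ₜ (s : A)) (1 ⊗ₜ (f s : A))) :
    ∃ N : MvPolynomial ι k, N.IsHomogeneous 8 ∧ DetectsInvertibility σ b N ∧
      MvPolynomial.eval (b.repr 1) N = 1 ∧
      quarticMatrix hσ f b c * quarticMatrix hσ f b c =
        (MvPolynomial.C d * N) • (1 : Matrix κ κ (MvPolynomial ι k)) := by
  have : Module.Finite k A := Module.Finite.of_basis b
  obtain ⟨i₀⟩ := ‹Nonempty κ›
  set P := quarticMatrix hσ f b c with hP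
  -- any diagonal entry of the square of the matrix gives the form
  set N : MvPolynomial ι k := MvPolynomial.C d⁻¹ * (P * P) i₀ i₀ with hN
  have hhom : ∀ i j, ((P * P) i j).IsHomogeneous 8 := fun i j ↦ by
    rw [Matrix.mul_apply]
    exact MvPolynomial.IsHomogeneous.sum _ _ _ fun l _ ↦
      (quarticMatrix_isHomogeneous hσ f b c i l).mul (quarticMatrix_isHomogeneous hσ f b c l j)
  -- over an algebraically closed extension the square of the matrix is the norm value
  have key : ∀ (Ω : Type u) [Field Ω] [IsAlgClosed Ω] [Algebra k Ω] [Algebra E Ω]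
      [IsScalarTower k E Ω], (∀ (x : ι → Ω) i j, MvPolynomial.aeval x ((P * P) i j) =
        if i = j then algebraMap k Ω d * MvPolynomial.aeval x N else 0) ∧
      (∀ x : ι → Ω, ConjInvertible (σ.baseChange Ω) (∑ i, x i ⊗ₜ[k] b i) ↔
        MvPolynomial.aeval x N ≠ 0) ∧
      (∀ x : ι → Ω, ∑ i, x i ⊗ₜ[k] b i = 1 → MvPolynomial.aeval x N = 1) := by
    intro Ω _ _ _ _ _
    have h2' : (2 : Ω) ≠ 0 := ofNat_ne_zero_of_algebra h2
    have h3' : (3 : Ω) ≠ 0 := ofNat_ne_zero_of_algebra h3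
    have hd' : algebraMap k Ω d ≠ 0 := (map_ne_zero _).2 hd
    have : Infinite Ω := IsAlgClosed.instInfinite
    let D' := D.extend E Ω h2'
    obtain ⟨q, hq⟩ := D'.exists_skewClifford h2'
    obtain ⟨ν, hν⟩ := hq.exists_normValue h2' h3' D'.one_ne_zero
    have hδ' : (algebraMap E Ω δ) ^ 2 = algebraMap k Ω d := by
      rw [← map_pow, hδ, ← IsScalarTower.algebraMap_apply]
    have hsq : ∀ {x : ι → Ω} {μ : Ω}, NormValue (σ.baseChange Ω) D'.natural q
        (∑ i, x i ⊗ₜ b i) μ → ∀ i j, _ := fun {x μ} hx ↦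
      aeval_sq_quarticMatrix hσ b c D' h2 h3 hδ' (fun s ↦ (hf s).extend E Ω h2') hx
    have hNν : ∀ {x : ι → Ω} {μ : Ω}, NormValue (σ.baseChange Ω) D'.natural q
        (∑ i, x i ⊗ₜ b i) μ → MvPolynomial.aeval x N = μ := fun {x μ} hx ↦ by
      rw [hN, map_mul, hsq hx, if_pos rfl, MvPolynomial.aeval_C, map_inv₀,
        inv_mul_cancel_left₀ hd']
    refine ⟨fun x i j ↦ ?_, fun x ↦ ?_, fun x hx ↦ ?_⟩
    · rw [hsq (hν _), hNν (hν _)]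
    · rw [hNν (hν _)]
      exact hq.conjInvertible_iff h2' h3' D'.one_ne_zero (hν _)
    · exact hNν (by rw [hx]; exact hq.normValue_one)
  have heval : ∀ (K Ω : Type u) [Field K] [Field Ω] [Algebra k K] [Algebra k Ω] [Algebra K Ω]
      [IsScalarTower k K Ω] (x : ι → K) (p : MvPolynomial ι k),
      MvPolynomial.aeval (fun i ↦ algebraMap K Ω (x i)) p =
        algebraMap K Ω (MvPolynomial.aeval x p) := by
    intro K Ω _ _ _ _ _ _ x p
    exact MvPolynomial.aeval_algebraMap_apply Ω x p
  refine ⟨N, ?_, ?_, ?_, ?_⟩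
  · simpa using (MvPolynomial.isHomogeneous_C ι d⁻¹).mul (hhom i₀ i₀)
  · intro K _ _ x
    obtain ⟨Ω, _, _, _, _, _, _, _⟩ := exists_isAlgClosed_extension k K E
    rw [← conjInvertible_baseChange_iff σ (Ω := Ω), map_sum]
    change _ ↔ ConjInvertible _ (∑ i, algebraMap K Ω (x i) ⊗ₜ[k] b i)
    rw [(key Ω).2.1, heval K Ω]
    exact (map_ne_zero (algebraMap K Ω)).symm
  · have h := (key (AlgebraicClosure E)).2.2
      (fun i ↦ algebraMap k (AlgebraicClosure E) (b.repr 1 i))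
      (sum_tmul_basis_repr_one b)
    rw [heval k (AlgebraicClosure E), MvPolynomial.aeval_eq_eval'] at h
    exact (algebraMap k (AlgebraicClosure E)).injective (h.trans (map_one _).symm)
  · have : Infinite (AlgebraicClosure E) := IsAlgClosed.instInfinite
    ext1 i j
    apply MvPolynomial.map_injective _ (algebraMap k (AlgebraicClosure E)).injective
    refine MvPolynomial.funext fun x ↦ ?_
    rw [MvPolynomial.eval_map, MvPolynomial.eval_map, ← MvPolynomial.aeval_def,
      ← MvPolynomial.aeval_def, (key (AlgebraicClosure E)).1, Matrix.smul_apply, Matrix.one_apply,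
      smul_eq_mul]
    split_ifs
    · rw [mul_one]
      refine Eq.trans ?_ (map_mul _ _ _).symm
      rw [MvPolynomial.aeval_C]
    · rw [mul_zero, map_zero]

end Norm

/-! ### Signed families of octonions -/

namespace OctonionAlgebra

/-- A family of orthonormal octonions, indexed by an abelian group, which is closed under
multiplication and conjugation up to prescribed scalars. -/
structure SignedFamily {F : Type u} [Field F] (C : OctonionAlgebra F) {G : Type} [AddCommGroup G]
    (ε : G → G → F) (κ : G → F) (e : G → C) : Prop where
  zero : e 0 = 1
  mul : ∀ g h, e g * e h = ε g h • e (g + h)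
  conj : ∀ g, C.conj (e g) = κ g • e g
  norm : ∀ g, C.norm (e g) = 1
  orthogonal : ∀ g h, g ≠ h → C.bil (e g) (e h) = 0

/-- The scalars of the multiplication of a doubled family. -/
def doubleMul {F : Type u} [Field F] {G : Type} (ε : G → G → F) (κ : G → F) (p q : G × ZMod 2) :
    F :=
  if p.2 = 0 then (if q.2 = 0 then ε p.1 q.1 else ε q.1 p.1)
  else (if q.2 = 0 then κ q.1 * ε p.1 q.1 else -(κ q.1 * ε q.1 p.1))

/-- The scalars of the conjugation of a doubled family. -/
def doubleConj {F : Type u} [Field F] {G : Type} (κ : G → F) (p : G × ZMod 2) : F :=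
  if p.2 = 0 then κ p.1 else -1

/-- The Cayley–Dickson double of a family by an element `l`. -/
def double {F : Type u} [Field F] {C : OctonionAlgebra F} {G : Type} (e : G → C) (l : C)
    (p : G × ZMod 2) : C :=
  if p.2 = 0 then e p.1 else e p.1 * l

section

variable {F : Type u} [Field F] {C : OctonionAlgebra F} {G : Type} [AddCommGroup G]
  {ε : G → G → F} {κ : G → F} {e : G → C}

/-- The Cayley–Dickson process: the structure scalars of the doubled family depend only on those of
the given one. -/
theorem SignedFamily.double (h : C.SignedFamily ε κ e) {l : C} (hl : C.norm l = 1)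
    (ho : ∀ g, C.bil l (e g) = 0) :
    C.SignedFamily (doubleMul ε κ) (doubleConj κ) (OctonionAlgebra.double e l) := by
  have h01 : ∀ z : ZMod 2, z = 0 ∨ z = 1 := by decide
  have hl1 : C.conj l = -l := by rw [conj_eq_neg_iff, ← h.zero]; exact ho 0
  have hll : ∀ a : C, (a * l) * l = -a := fun a ↦ by
    have := C.mul_mul_conj l a
    rw [hl1, mul_neg, hl, one_smul] at this
    rw [← neg_eq_iff_eq_neg, this]
  have hlconj : ∀ g, C.conj (e g * l) = -(e g * l) := fun g ↦ by
    rw [conj_eq_neg_iff, bil_mul_adj_left, mul_one, h.conj, map_smul, ho, smul_zero]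
  have hcomm : ∀ g, l * C.conj (e g) = e g * l := fun g ↦ by
    have := hlconj g
    rw [conj_mul, hl1, neg_mul, neg_inj] at this
    exact this
  -- `(a l) b = (a b̄) l`
  have hR : ∀ (a : C) g, (a * l) * e g = (a * C.conj (e g)) * l := fun a g ↦ by
    have := C.mul_conj_mul_add' l (e g) a
    rw [hl1, ho, zero_smul, mul_neg, neg_mul, neg_add_eq_zero] at this
    exact this
  -- `a (b l) = (b a) l`
  have hL : ∀ g g', e g * (e g' * l) = (e g' * e g) * l := fun g g' ↦ by
    have h1 := C.mul_conj_mul_add (e g) l (C.conj (e g'))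
    rw [bil_comm, ho, zero_smul, hl1, neg_mul, mul_neg, neg_add_eq_zero, hcomm, ← conj_mul, h.mul,
      map_smul, mul_smul_comm, hcomm, ← smul_mul_assoc, ← h.mul] at h1
    exact h1
  -- `(a l) (b l) = -b̄ a`
  have hLL : ∀ g g', (e g * l) * (e g' * l) = -(C.conj (e g') * e g) := fun g g' ↦ by
    have h1 := C.mul_conj_mul_add' l (e g' * l) (e g)
    rw [hl1, hlconj, mul_neg, mul_neg, neg_mul, neg_mul, hL, hll, neg_neg] at h1
    have h2 : C.bil l (e g' * l) = C.bil (e g') 1 := by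
      have := C.mul_conj_self l
      rw [hl, one_smul] at this
      rw [bil_comm, bil_mul_adj_right, this]
    rw [h2] at h1
    rw [C.conj_apply (e g'), sub_mul, smul_mul_assoc, one_mul, ← h1]
    abel
  refine ⟨?_, ?_, ?_, ?_, ?_⟩
  · simp [OctonionAlgebra.double, h.zero]
  · rintro ⟨g, x⟩ ⟨g', y⟩
    rcases h01 x with rfl | rfl <;> rcases h01 y with rfl | rfl
    · simp [OctonionAlgebra.double, doubleMul, h.mul]
    · simp [OctonionAlgebra.double, doubleMul, hL, h.mul, add_comm g g', smul_mul_assoc]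
    · simp [OctonionAlgebra.double, doubleMul, hR, h.mul, h.conj, smul_smul, mul_smul_comm,
        smul_mul_assoc]
    · simp [OctonionAlgebra.double, doubleMul, hLL, h.mul, h.conj, smul_smul, smul_mul_assoc,
        add_comm g g', show (1 : ZMod 2) + 1 = 0 from rfl]
  · rintro ⟨g, x⟩
    rcases h01 x with rfl | rfl
    · simp [OctonionAlgebra.double, doubleConj, h.conj]
    · simp [OctonionAlgebra.double, doubleConj, hlconj]
  · rintro ⟨g, x⟩
    rcases h01 x with rfl | rfl
    · simp [OctonionAlgebra.double, h.norm]
    · simp [OctonionAlgebra.double, h.norm, C.norm_mul, hl]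
  · have hlb : ∀ g g', C.bil (e g * l) (e g') = 0 := fun g g' ↦ by
      rw [bil_mul_adj_left, h.conj, smul_mul_assoc, h.mul, map_smul, map_smul, ho, smul_zero,
        smul_zero]
    rintro ⟨g, x⟩ ⟨g', y⟩ hne
    rcases h01 x with rfl | rfl <;> rcases h01 y with rfl | rfl
    · have : g ≠ g' := fun h ↦ hne (by rw [h])
      simp [OctonionAlgebra.double, h.orthogonal _ _ this]
    · simpa [OctonionAlgebra.double, C.bil_comm (e g)] using hlb g' g
    · simpa [OctonionAlgebra.double] using hlb g g'
    · have : g ≠ g' := fun h ↦ hne (by rw [h])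
      simp [OctonionAlgebra.double, bil_mul_right, h.orthogonal _ _ this]

omit [AddCommGroup G] in
theorem doubleMul_sq (hε : ∀ g h, ε g h * ε g h = 1) (hκ : ∀ g, κ g * κ g = 1)
    (p q : G × ZMod 2) : doubleMul ε κ p q * doubleMul ε κ p q = 1 := by
  unfold doubleMul
  split_ifs
  · exact hε _ _
  · exact hε _ _
  · linear_combination κ q.1 * κ q.1 * hε p.1 q.1 + hκ q.1
  · linear_combination κ q.1 * κ q.1 * hε q.1 p.1 + hκ q.1

omit [AddCommGroup G] in
theorem doubleConj_sq (hκ : ∀ g, κ g * κ g = 1) (p : G × ZMod 2) :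
    doubleConj κ p * doubleConj κ p = 1 := by
  unfold doubleConj
  split_ifs <;> simp [hκ]

/-- The pairing of two octonion algebras with families of the same structure is invariant under
simultaneous multiplication by corresponding members: these permute the terms of the sum, and the
scalars of both families cancel. -/
theorem SignedFamily.sum_bil_mul [Fintype G] (hε : ∀ g h, ε g h * ε g h = 1)
    (hκ : ∀ g, κ g * κ g = 1) (h : C.SignedFamily ε κ e) {C' : OctonionAlgebra F} {e' : G → C'}
    (h' : C'.SignedFamily ε κ e') (g : G) (a : C) (b : C') :
    ∑ i, C.bil (e i) (e g * a) * C'.bil (e' i) (e' g * b) =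
      ∑ i, C.bil (e i) a * C'.bil (e' i) b := by
  rw [← Equiv.sum_comp (Equiv.addLeft g) fun i ↦ C.bil (e i) a * C'.bil (e' i) b]
  refine Finset.sum_congr rfl fun i _ ↦ ?_
  rw [C.bil_comm, C'.bil_comm, bil_mul_adj_left, bil_mul_adj_left, h.conj, h'.conj, smul_mul_assoc,
    smul_mul_assoc, h.mul, h'.mul, smul_smul, smul_smul, map_smul, map_smul, C.bil_comm,
    C'.bil_comm, Equiv.coe_addLeft]
  simp only [smul_eq_mul]
  linear_combination (C.bil (e (g + i)) a * C'.bil (e' (g + i)) b) * (κ g * κ g * hε g i + hκ g)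

theorem SignedFamily.sum_bil_mul' [Fintype G] (hε : ∀ g h, ε g h * ε g h = 1)
    (hκ : ∀ g, κ g * κ g = 1) (h : C.SignedFamily ε κ e) {C' : OctonionAlgebra F} {e' : G → C'}
    (h' : C'.SignedFamily ε κ e') (g : G) (a : C) (b : C') :
    ∑ i, C.bil (e i) (a * e g) * C'.bil (e' i) (b * e' g) =
      ∑ i, C.bil (e i) a * C'.bil (e' i) b := by
  rw [← Equiv.sum_comp (Equiv.addRight g) fun i ↦ C.bil (e i) a * C'.bil (e' i) b]
  refine Finset.sum_congr rfl fun i _ ↦ ?_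
  rw [C.bil_comm, C'.bil_comm, bil_mul_adj_right, bil_mul_adj_right, h.conj, h'.conj, mul_smul_comm,
    mul_smul_comm, h.mul, h'.mul, smul_smul, smul_smul, map_smul, map_smul, C.bil_comm,
    C'.bil_comm, Equiv.coe_addRight]
  simp only [smul_eq_mul]
  linear_combination (C.bil (e (i + g)) a * C'.bil (e' (i + g)) b) * (κ g * κ g * hε i g + hκ g)

end

section Triple

variable {F : Type u} [Field F] {C : OctonionAlgebra F}

/-- The eight products of a triple of octonions, obtained by doubling three times. -/
def tripleFamily (i j l : C) : ((Unit × ZMod 2) × ZMod 2) × ZMod 2 → C :=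
  double (double (double (fun _ ↦ 1) i) j) l

variable (F) in
/-- The scalars of the multiplication of the family generated by a triple. -/
def tripleMul : ((Unit × ZMod 2) × ZMod 2) × ZMod 2 → ((Unit × ZMod 2) × ZMod 2) × ZMod 2 → F :=
  doubleMul (doubleMul (doubleMul (fun _ _ ↦ 1) fun _ ↦ 1) (doubleConj fun _ ↦ 1))
    (doubleConj (doubleConj fun _ ↦ 1))

variable (F) in
/-- The scalars of the conjugation of the family generated by a triple. -/
def tripleConj : ((Unit × ZMod 2) × ZMod 2) × ZMod 2 → F :=
  doubleConj (doubleConj (doubleConj fun _ ↦ 1))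

/-- Three orthonormal skew octonions `i`, `j`, `l` such that `l` is orthogonal to `i j`. -/
structure IsBasicTriple (C : OctonionAlgebra F) (i j l : C) : Prop where
  norm_fst : C.norm i = 1
  norm_snd : C.norm j = 1
  norm_trd : C.norm l = 1
  fst_one : C.bil i 1 = 0
  snd_one : C.bil j 1 = 0
  snd_fst : C.bil j i = 0
  trd_one : C.bil l 1 = 0
  trd_fst : C.bil l i = 0
  trd_snd : C.bil l j = 0
  trd_mul : C.bil l (i * j) = 0

theorem signedFamily_one : C.SignedFamily (fun _ _ ↦ 1) (fun _ ↦ 1) (fun _ : Unit ↦ 1) where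
  zero := rfl
  mul _ _ := by rw [mul_one, one_smul]
  conj _ := by rw [conj_one, one_smul]
  norm _ := C.norm_one
  orthogonal _ _ h := (h rfl).elim

theorem IsBasicTriple.signedFamily {i j l : C} (h : C.IsBasicTriple i j l) :
    C.SignedFamily (tripleMul F) (tripleConj F) (tripleFamily i j l) := by
  refine ((signedFamily_one.double h.norm_fst ?_).double h.norm_snd ?_).double h.norm_trd ?_
  · exact fun _ ↦ h.fst_one
  · rintro ⟨_, x⟩
    unfold OctonionAlgebra.double
    split_ifs
    · exact h.snd_one
    · rw [one_mul]; exact h.snd_fst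
  · rintro ⟨⟨_, x⟩, y⟩
    unfold OctonionAlgebra.double
    dsimp only
    split_ifs
    · exact h.trd_one
    · rw [one_mul]; exact h.trd_fst
    · rw [one_mul]; exact h.trd_snd
    · rw [one_mul]; exact h.trd_mul

theorem IsBasicTriple.smul {i j l : C} (h : C.IsBasicTriple i j l) {r s t : F} (hr : r * r = 1)
    (hs : s * s = 1) (ht : t * t = 1) : C.IsBasicTriple (r • i) (s • j) (t • l) where
  norm_fst := by rw [QuadraticMap.map_smul, hr, h.norm_fst, smul_eq_mul, mul_one]
  norm_snd := by rw [QuadraticMap.map_smul, hs, h.norm_snd, smul_eq_mul, mul_one]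
  norm_trd := by rw [QuadraticMap.map_smul, ht, h.norm_trd, smul_eq_mul, mul_one]
  fst_one := by rw [map_smul, LinearMap.smul_apply, h.fst_one, smul_zero]
  snd_one := by rw [map_smul, LinearMap.smul_apply, h.snd_one, smul_zero]
  snd_fst := by rw [map_smul, map_smul, LinearMap.smul_apply, h.snd_fst, smul_zero, smul_zero]
  trd_one := by rw [map_smul, LinearMap.smul_apply, h.trd_one, smul_zero]
  trd_fst := by rw [map_smul, map_smul, LinearMap.smul_apply, h.trd_fst, smul_zero, smul_zero]
  trd_snd := by rw [map_smul, map_smul, LinearMap.smul_apply, h.trd_snd, smul_zero, smul_zero]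
  trd_mul := by
    rw [smul_mul_smul_comm, map_smul, map_smul, LinearMap.smul_apply, h.trd_mul, smul_zero,
      smul_zero]

/-- A family of fewer than eight members can be doubled. -/
theorem SignedFamily.exists_orthogonal [IsAlgClosed F] (h2 : (2 : F) ≠ 0) {G : Type}
    [AddCommGroup G] [Fintype G] {ε : G → G → F} {κ : G → F} {e : G → C}
    (h : C.SignedFamily ε κ e) (hc : Fintype.card G < 8) :
    ∃ l : C, C.norm l = 1 ∧ ∀ g, C.bil l (e g) = 0 := by
  obtain ⟨l, hl, hn⟩ := C.exists_orthogonal h2 e (fun g ↦ by rw [h.norm]; exact one_ne_zero)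
    h.orthogonal hc
  obtain ⟨r, hr⟩ := IsAlgClosed.exists_pow_nat_eq (C.norm l)⁻¹ (n := 2) (by norm_num)
  refine ⟨r • l, ?_, fun g ↦ by rw [map_smul, LinearMap.smul_apply, hl, smul_zero]⟩
  rw [QuadraticMap.map_smul, ← pow_two, hr, smul_eq_mul, inv_mul_cancel₀ hn]

variable (C) in
theorem exists_isBasicTriple [IsAlgClosed F] (h2 : (2 : F) ≠ 0) :
    ∃ i j l : C, C.IsBasicTriple i j l := by
  have h₀ := signedFamily_one (C := C)
  obtain ⟨i, hi, hi'⟩ := h₀.exists_orthogonal h2 (by decide)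
  have h₁ := h₀.double hi hi'
  obtain ⟨j, hj, hj'⟩ := h₁.exists_orthogonal h2 (by decide)
  have h₂ := h₁.double hj hj'
  obtain ⟨l, hl, hl'⟩ := h₂.exists_orthogonal h2 (by decide)
  refine ⟨i, j, l, ⟨hi, hj, hl, hi' (), hj' ((), 0), ?_, hl' (((), 0), 0), ?_, ?_, ?_⟩⟩
  · have := hj' ((), 1)
    simpa [OctonionAlgebra.double] using this
  · have := hl' (((), 1), 0)
    simpa [OctonionAlgebra.double] using this
  · have := hl' (((), 0), 1)
    simpa [OctonionAlgebra.double] using this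
  · have := hl' (((), 1), 1)
    simpa [OctonionAlgebra.double] using this

/-- For basic triples in two octonion algebras there is a linear form on the tensor product which
does not change under multiplication by the tensor product of corresponding members. -/
theorem IsBasicTriple.exists_linearMap (h2 : (2 : F) ≠ 0) {C' : OctonionAlgebra F} {v : Fin 3 → C}
    {v' : Fin 3 → C'} (h : C.IsBasicTriple (v 0) (v 1) (v 2))
    (h' : C'.IsBasicTriple (v' 0) (v' 1) (v' 2)) :
    ∃ L : C ⊗[F] C' →ₗ[F] F, L 1 ≠ 0 ∧
      ∀ i x, L ((v i ⊗ₜ v' i) * x) = L x ∧ L (x * (v i ⊗ₜ v' i)) = L x := by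
  have hf := h.signedFamily
  have hf' := h'.signedFamily
  have hκ : ∀ g, tripleConj F g * tripleConj F g = 1 :=
    doubleConj_sq (doubleConj_sq (doubleConj_sq fun _ ↦ one_mul 1))
  have hε : ∀ g h, tripleMul F g h * tripleMul F g h = 1 :=
    doubleMul_sq (doubleMul_sq (doubleMul_sq (fun _ _ ↦ one_mul 1) fun _ ↦ one_mul 1)
      (doubleConj_sq fun _ ↦ one_mul 1)) (doubleConj_sq (doubleConj_sq fun _ ↦ one_mul 1))
  set e := tripleFamily (v 0) (v 1) (v 2) with he
  set e' := tripleFamily (v' 0) (v' 1) (v' 2) with he'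
  let L : C ⊗[F] C' →ₗ[F] F := TensorProduct.lift (∑ g, (C.bil (e g)).smulRight (C'.bil (e' g)))
  have hL : ∀ a b, L (a ⊗ₜ b) = ∑ g, C.bil (e g) a * C'.bil (e' g) b := fun a b ↦ by
    simp [L, TensorProduct.lift.tmul, LinearMap.sum_apply]
  -- the members of the triple are the members of the family at the generators of the index group
  let γ : Fin 3 → ((Unit × ZMod 2) × ZMod 2) × ZMod 2 :=
    ![((((), 1), 0), 0), ((((), 0), 1), 0), ((((), 0), 0), 1)]
  have hv : ∀ i, v i = e (γ i) ∧ v' i = e' (γ i) := by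
    intro i
    fin_cases i <;>
      simp [e, e', γ, tripleFamily, OctonionAlgebra.double]
  refine ⟨L, ?_, fun i x ↦ ?_⟩
  · rw [Algebra.TensorProduct.one_def, hL, Finset.sum_eq_single 0]
    · rw [hf.zero, hf'.zero, bil_self, bil_self, norm_one, norm_one, mul_one]
      exact mul_ne_zero (by simpa using h2) (by simpa using h2)
    · intro g _ hg
      rw [← hf.zero, hf.orthogonal g 0 hg, zero_mul]
    · simp
  · induction x using TensorProduct.induction_on with
    | zero => simp
    | add x y hx hy =>
      exact ⟨by rw [mul_add, map_add, hx.1, hy.1, map_add],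
        by rw [add_mul, map_add, hx.2, hy.2, map_add]⟩
    | tmul a b =>
      rw [Algebra.TensorProduct.tmul_mul_tmul, Algebra.TensorProduct.tmul_mul_tmul, hL, hL, hL,
        (hv i).1, (hv i).2, hf.sum_bil_mul hε hκ hf', hf.sum_bil_mul' hε hκ hf']
      exact ⟨rfl, rfl⟩

end Triple

end OctonionAlgebra

/-- Over an algebraically closed field there are three hermitian elements with simultaneous linear
eigenforms for all eight systems of signs as eigenvalues. -/
theorem BioctonionDecomposition.exists_eigenforms {F : Type u} [Field F] [IsAlgClosed F]
    (h2 : (2 : F) ≠ 0) {B : Type u} [NonAssocRing B] [Module F B] {τ : B →ₗ[F] B}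
    (D : BioctonionDecomposition τ) :
    ∃ v : Fin 3 → B, (∀ i, τ (v i) = v i) ∧ ∀ s : Fin 3 → F, (∀ i, s i * s i = 1) →
      ∃ L : B →ₗ[F] F, L 1 ≠ 0 ∧ ∀ i b, L (v i * b) = s i * L b ∧ L (b * v i) = s i * L b := by
  obtain ⟨i, j, l, h⟩ := D.C₁.exists_isBasicTriple h2
  obtain ⟨i', j', l', h'⟩ := D.C₂.exists_isBasicTriple h2
  let v : Fin 3 → D.C₁ := ![i, j, l]
  let v' : Fin 3 → D.C₂ := ![i', j', l']
  have hv : ∀ a, D.C₁.conj (v a) = -v a := fun a ↦ by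
    rw [OctonionAlgebra.conj_eq_neg_iff]
    fin_cases a
    exacts [h.fst_one, h.snd_one, h.trd_one]
  have hv' : ∀ a, D.C₂.conj (v' a) = -v' a := fun a ↦ by
    rw [OctonionAlgebra.conj_eq_neg_iff]
    fin_cases a
    exacts [h'.fst_one, h'.snd_one, h'.trd_one]
  refine ⟨fun a ↦ D.iso.symm (v a ⊗ₜ v' a), fun a ↦ ?_, fun s hs ↦ ?_⟩
  · apply D.iso.injective
    rw [D.map_conj, LinearEquiv.apply_symm_apply, TensorProduct.map_tmul, hv, hv',
      TensorProduct.neg_tmul, TensorProduct.tmul_neg, neg_neg]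
  -- change the first triple by the signs, so that the invariant form becomes an eigenform
  · have hs' : D.C₁.IsBasicTriple (s 0 • v 0) (s 1 • v 1) (s 2 • v 2) :=
      OctonionAlgebra.IsBasicTriple.smul h (hs 0) (hs 1) (hs 2)
    obtain ⟨L, hL1, hL⟩ := OctonionAlgebra.IsBasicTriple.exists_linearMap h2
      (v := fun a ↦ s a • v a) (v' := v') hs' h'
    have hL' : ∀ a x, L ((v a ⊗ₜ v' a) * x) = s a * L x ∧ L (x * (v a ⊗ₜ v' a)) = s a * L x := by
      intro a x
      have h1 := hL a (s a • x)
      rw [← TensorProduct.smul_tmul', smul_mul_smul_comm, smul_mul_smul_comm, hs, one_smul,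
        one_smul, map_smul, smul_eq_mul] at h1
      exact h1
    refine ⟨L ∘ₗ D.iso.toLinearMap, ?_, fun a b ↦ ?_⟩
    · change L (D.iso 1) ≠ 0
      rwa [D.iso_one]
    · change L (D.iso _) = _ * L (D.iso b) ∧ L (D.iso _) = _ * L (D.iso b)
      rw [D.map_mul, D.map_mul, LinearEquiv.apply_symm_apply]
      exact hL' a _

/-! ### Forms determined by their zeros -/

namespace MvPolynomial

section Line

variable {ι R S : Type*} [CommSemiring R] [CommSemiring S]

/-- The restriction of a polynomial to the line through `x` in the direction `o`. -/
noncomputable def alongLine (f : R →+* S) (x o : ι → S) (N : MvPolynomial ι R) : Polynomial S :=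
  eval₂ (Polynomial.C.comp f) (fun i ↦ Polynomial.C (x i) + Polynomial.C (o i) * Polynomial.X) N

theorem eval_alongLine (f : R →+* S) (x o : ι → S) (N : MvPolynomial ι R) (t : S) :
    (N.alongLine f x o).eval t = eval₂ f (fun i ↦ x i + o i * t) N := by
  rw [alongLine, ← Polynomial.coe_evalRingHom, eval₂_comp_left]
  congr 1
  · ext; simp
  · funext i; simp

theorem map_alongLine {S' : Type*} [CommSemiring S'] (f : R →+* S) (g : S →+* S') (x o : ι → S)
    (N : MvPolynomial ι R) :
    (N.alongLine f x o).map g = N.alongLine (g.comp f) (g ∘ x) (g ∘ o) := by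
  rw [alongLine, alongLine, ← Polynomial.coe_mapRingHom, eval₂_comp_left]
  congr 1
  · ext; simp
  · funext i; simp

/-- A homogeneous polynomial of degree `n` restricts to a polynomial of degree at most `n`, whose
coefficient of degree `n` is the value in the direction of the line. -/
theorem natDegree_alongLine_le {N : MvPolynomial ι R} {n : ℕ} (hN : N.IsHomogeneous n)
    (f : R →+* S) (x o : ι → S) : (N.alongLine f x o).natDegree ≤ n ∧
      (N.alongLine f x o).coeff n = eval₂ f o N := by
  have hpow : ∀ (i : ι) (m : ℕ),
      ((Polynomial.C (x i) + Polynomial.C (o i) * Polynomial.X) ^ m).natDegree ≤ m ∧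
      ((Polynomial.C (x i) + Polynomial.C (o i) * Polynomial.X) ^ m).coeff m = o i ^ m := by
    intro i m
    have h1 : (Polynomial.C (x i) + Polynomial.C (o i) * Polynomial.X).natDegree ≤ 1 := by
      compute_degree
    refine ⟨(Polynomial.natDegree_pow_le_of_le m h1).trans (by rw [mul_one]), ?_⟩
    have := Polynomial.coeff_pow_of_natDegree_le h1 (m := m)
    rw [mul_one] at this
    rw [this]
    simp
  have hprod : ∀ (d : ι →₀ ℕ) (s : Finset ι),
      (∏ i ∈ s, (Polynomial.C (x i) + Polynomial.C (o i) * Polynomial.X) ^ d i).natDegree ≤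
        ∑ i ∈ s, d i ∧
      (∏ i ∈ s, (Polynomial.C (x i) + Polynomial.C (o i) * Polynomial.X) ^ d i).coeff
        (∑ i ∈ s, d i) = ∏ i ∈ s, o i ^ d i := by
    intro d s
    classical
    induction s using Finset.induction_on with
    | empty => simp
    | insert a s ha ih =>
      rw [Finset.prod_insert ha, Finset.sum_insert ha, Finset.prod_insert ha]
      refine ⟨Polynomial.natDegree_mul_le_of_le (hpow a _).1 ih.1, ?_⟩
      rw [Polynomial.coeff_mul_add_eq_of_natDegree_le (hpow a _).1 ih.1, (hpow a _).2, ih.2]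
  have hdeg : ∀ d ∈ N.support, ∑ i ∈ d.support, d i = n := by
    intro d hd
    have := hN (mem_support_iff.1 hd)
    rwa [Finsupp.weight_apply, Finsupp.sum, Finset.sum_congr rfl fun i _ ↦ by
      rw [Pi.one_apply, smul_eq_mul, mul_one]] at this
  rw [alongLine, eval₂_eq]
  constructor
  · refine Polynomial.natDegree_sum_le_of_forall_le _ _ fun d hd ↦ ?_
    refine (Polynomial.natDegree_C_mul_le _ _).trans ?_
    rw [← hdeg d hd]
    exact (hprod d _).1
  · rw [Polynomial.finsetSum_coeff, eval₂_eq]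
    refine Finset.sum_congr rfl fun d hd ↦ ?_
    have := (hprod d d.support).2
    rw [hdeg d hd] at this
    rw [RingHom.comp_apply, Polynomial.coeff_C_mul, this]

end Line

variable {ι F : Type*} [Field F]

/-- A form which vanishes at `m` points of a line, and not in the direction of that line, has
degree at least `m`. -/
theorem IsHomogeneous.card_le {N : MvPolynomial ι F} {n : ℕ} (hN : N.IsHomogeneous n)
    {x o : ι → F} (ho : eval o N ≠ 0) (T : Finset F)
    (hT : ∀ t ∈ T, eval (fun i ↦ x i + o i * t) N = 0) : T.card ≤ n := by
  obtain ⟨h1, h2⟩ := natDegree_alongLine_le hN (RingHom.id F) x o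
  have hne : N.alongLine (RingHom.id F) x o ≠ 0 := by
    intro h
    rw [h, Polynomial.coeff_zero] at h2
    exact ho h2.symm
  refine le_trans (Polynomial.card_le_degree_of_subset_roots (Z := T) fun t ht ↦ ?_) h1
  rw [Polynomial.mem_roots hne, Polynomial.IsRoot, eval_alongLine]
  exact hT t ht

/-- Let a form of degree `n` take the value `1` at `o`, and have `n` different zeros on some
line with direction `o`. Then it is determined by its zeros among the forms of degree `n` with value
`1` at `o`: two such forms agree where the restriction to the parallel line is separable, which is a
nonempty open set, as seen from the resultant with the derivative. -/
theorem IsHomogeneous.eq_of_zeros [IsAlgClosed F] {N N' : MvPolynomial ι F} {n : ℕ} (hn : n ≠ 0)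
    (hN : N.IsHomogeneous n) (hN' : N'.IsHomogeneous n) {x₀ o : ι → F} (ho : eval o N = 1)
    (ho' : eval o N' = 1) (hz : ∀ x, eval x N = 0 → eval x N' = 0) (T : Finset F)
    (hT : ∀ t ∈ T, eval (fun i ↦ x₀ i + o i * t) N = 0) (hTn : T.card = n) : N = N' := by
  have : Infinite F := IsAlgClosed.instInfinite
  have hmonic : ∀ {M : MvPolynomial ι F}, M.IsHomogeneous n → eval o M = 1 → ∀ x : ι → F,
      (M.alongLine (RingHom.id F) x o).Monic ∧ (M.alongLine (RingHom.id F) x o).natDegree = n := by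
    intro M hM hMo x
    obtain ⟨h1, h2⟩ := natDegree_alongLine_le hM (RingHom.id F) x o
    have h2 : (M.alongLine (RingHom.id F) x o).coeff n = 1 := h2.trans hMo
    have h3 : (M.alongLine (RingHom.id F) x o).natDegree = n :=
      le_antisymm h1 (Polynomial.le_natDegree_of_ne_zero (by rw [h2]; exact one_ne_zero))
    exact ⟨by rw [Polynomial.Monic, Polynomial.leadingCoeff, h3, h2], h3⟩
  -- the resultant of the restriction to a generic line with its derivative
  let G : Polynomial (MvPolynomial ι F) := N.alongLine C X fun i ↦ C (o i)
  have hG : ∀ x : ι → F, G.map (eval x) = N.alongLine (RingHom.id F) x o := by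
    intro x
    rw [map_alongLine]
    congr 1
    · ext; simp
    · funext i; simp
    · funext i; simp
  let r := Polynomial.resultant G G.derivative n (n - 1)
  have hr : ∀ x : ι → F, eval x r = Polynomial.resultant (N.alongLine (RingHom.id F) x o)
      (N.alongLine (RingHom.id F) x o).derivative n (n - 1) := by
    intro x
    rw [← hG, Polynomial.derivative_map, Polynomial.resultant_map_map]
  have hder : ∀ x : ι → F, (N.alongLine (RingHom.id F) x o).derivative.natDegree ≤ n - 1 :=
    fun x ↦ (Polynomial.natDegree_derivative_le _).trans (by rw [(hmonic hN ho x).2])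
  have key : ∀ x, eval x r ≠ 0 → eval x N = eval x N' := by
    intro x hx
    obtain ⟨p, q, -, -, hpq⟩ := Polynomial.exists_mul_add_mul_eq_C_resultant
      (N.alongLine (RingHom.id F) x o) (N.alongLine (RingHom.id F) x o).derivative
      (hmonic hN ho x).2.le (hder x) (Or.inl hn)
    rw [← hr] at hpq
    have hsep : (N.alongLine (RingHom.id F) x o).Separable := by
      refine ⟨p * Polynomial.C (eval x r)⁻¹, q * Polynomial.C (eval x r)⁻¹, ?_⟩
      have : (Polynomial.C (eval x r) : Polynomial F) * Polynomial.C (eval x r)⁻¹ = 1 := by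
        rw [← Polynomial.C_mul, mul_inv_cancel₀ hx, Polynomial.C_1]
      linear_combination Polynomial.C (eval x r)⁻¹ * hpq + this
    have hne := (hmonic hN ho x).1.ne_zero
    have hne' := (hmonic hN' ho' x).1.ne_zero
    have hdvd : N.alongLine (RingHom.id F) x o ∣ N'.alongLine (RingHom.id F) x o := by
      rw [IsAlgClosed.dvd_iff_roots_le_roots hne hne',
        Multiset.le_iff_subset (Polynomial.nodup_roots hsep)]
      intro t ht
      rw [Polynomial.mem_roots hne, Polynomial.IsRoot, eval_alongLine] at ht
      rw [Polynomial.mem_roots hne', Polynomial.IsRoot, eval_alongLine]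
      exact hz _ ht
    have heq := Polynomial.eq_of_monic_of_dvd_of_natDegree_le (hmonic hN ho x).1
      (hmonic hN' ho' x).1 hdvd (by rw [(hmonic hN' ho' x).2, (hmonic hN ho x).2])
    have h0 := congrArg (Polynomial.eval 0) heq
    rw [eval_alongLine, eval_alongLine] at h0
    simp only [mul_zero, add_zero] at h0
    exact h0.symm
  have hr0 : eval x₀ r ≠ 0 := by
    have hne := (hmonic hN ho x₀).1.ne_zero
    have hsub : T.val ≤ (N.alongLine (RingHom.id F) x₀ o).roots := by
      rw [Multiset.le_iff_subset T.nodup]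
      intro t ht
      rw [Polynomial.mem_roots hne, Polynomial.IsRoot, eval_alongLine]
      exact hT t ht
    have hroots := Multiset.eq_of_le_of_card_le hsub
      ((Polynomial.card_roots' _).trans (by rw [(hmonic hN ho x₀).2]; exact hTn.ge))
    have hsep : (N.alongLine (RingHom.id F) x₀ o).Separable := by
      rw [← Polynomial.nodup_roots_iff_of_splits hne (IsAlgClosed.splits _), ← hroots]
      exact T.nodup
    obtain ⟨m, hm⟩ := Nat.exists_eq_add_of_le (hder x₀)
    rw [hr, hm, Polynomial.resultant_add_right_deg _ _ _ _ _ le_rfl]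
    have hc : (N.alongLine (RingHom.id F) x₀ o).coeff n = 1 :=
      (natDegree_alongLine_le hN (RingHom.id F) x₀ o).2.trans ho
    rw [hc, one_pow, one_mul]
    have := Polynomial.resultant_ne_zero _ _ hsep
    rwa [(hmonic hN ho x₀).2] at this
  have hmul : r * (N - N') = 0 := by
    refine MvPolynomial.funext fun x ↦ ?_
    rw [map_mul, map_sub, map_zero]
    by_cases hx : eval x r = 0
    · rw [hx, zero_mul]
    · rw [key x hx, sub_self, mul_zero]
  rcases mul_eq_zero.1 hmul with h | h
  · rw [h, map_zero] at hr0
    exact (hr0 rfl).elim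
  · exact sub_eq_zero.1 h

end MvPolynomial

/-! ### Minimality and uniqueness of the norm -/

section SignSums

variable {F : Type*} [Field F] [Infinite F]

open Classical in
/-- Some translate of a finite set is disjoint from its opposite translate. -/
theorem exists_card_union_image (h2 : (2 : F) ≠ 0) (T : Finset F) :
    ∃ c : F, (T.image (· + c) ∪ T.image (· - c)).card = 2 * T.card := by
  obtain ⟨c, hc⟩ := Infinite.exists_notMem_finset
    ((T ×ˢ T).image fun p : F × F ↦ (p.1 - p.2) / 2)
  refine ⟨c, ?_⟩
  rw [Finset.card_union_of_disjoint, Finset.card_image_of_injective _ (add_left_injective c),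
    Finset.card_image_of_injective _ (sub_left_injective), two_mul]
  rw [Finset.disjoint_left]
  intro x hx hx'
  obtain ⟨t, ht, rfl⟩ := Finset.mem_image.1 hx
  obtain ⟨t', ht', h⟩ := Finset.mem_image.1 hx'
  refine hc (Finset.mem_image.2 ⟨(t', t), Finset.mem_product.2 ⟨ht', ht⟩, ?_⟩)
  rw [div_eq_iff h2]
  linear_combination h

/-- For suitable `c₀`, `c₁`, `c₂` the eight sums `± c₀ ± c₁ ± c₂` are different. -/
theorem exists_sign_sums (h2 : (2 : F) ≠ 0) : ∃ (c : Fin 3 → F) (T : Finset F), T.card = 8 ∧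
    ∀ t ∈ T, ∃ s : Fin 3 → F, (∀ i, s i * s i = 1) ∧ t + ∑ i, c i * s i = 0 := by
  classical
  obtain ⟨c₀, h₀⟩ := exists_card_union_image h2 ({0} : Finset F)
  obtain ⟨c₁, h₁⟩ := exists_card_union_image h2
    (({0} : Finset F).image (· + c₀) ∪ ({0} : Finset F).image (· - c₀))
  set T₀ := ({0} : Finset F).image (· + c₀) ∪ ({0} : Finset F).image (· - c₀) with hT₀
  obtain ⟨c₂, h₂⟩ := exists_card_union_image h2 (T₀.image (· + c₁) ∪ T₀.image (· - c₁))
  set T₁ := T₀.image (· + c₁) ∪ T₀.image (· - c₁) with hT₁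
  have hm : ∀ (T : Finset F) c, ∀ t ∈ T.image (· + c) ∪ T.image (· - c),
      ∃ t' ∈ T, ∃ s : F, s * s = 1 ∧ t + s * c = t' := by
    intro T c t ht
    rcases Finset.mem_union.1 ht with ht | ht
    · obtain ⟨t', ht', rfl⟩ := Finset.mem_image.1 ht
      exact ⟨t', ht', -1, by norm_num, by ring⟩
    · obtain ⟨t', ht', rfl⟩ := Finset.mem_image.1 ht
      exact ⟨t', ht', 1, by norm_num, by ring⟩
  refine ⟨![c₀, c₁, c₂], T₁.image (· + c₂) ∪ T₁.image (· - c₂), ?_, fun t ht ↦ ?_⟩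
  · rw [h₂, h₁, h₀]; simp
  · obtain ⟨t₁, ht₁, s₂, hs₂, e₂⟩ := hm _ _ t ht
    obtain ⟨t₂, ht₂, s₁, hs₁, e₁⟩ := hm _ _ t₁ ht₁
    obtain ⟨t₃, ht₃, s₀, hs₀, e₀⟩ := hm _ _ t₂ ht₂
    rw [Finset.mem_singleton] at ht₃
    refine ⟨![s₀, s₁, s₂], fun i ↦ by fin_cases i <;> assumption, ?_⟩
    rw [Fin.sum_univ_three]
    change t + (c₀ * s₀ + c₁ * s₁ + c₂ * s₂) = 0
    linear_combination e₂ + e₁ + e₀ + ht₃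

end SignSums

/-- A hermitian element which is annihilated by a linear form, in the sense that the form vanishes
on its left and right multiples, but does not vanish at `1`, is not conjugate-invertible. -/
theorem not_conjInvertible_of_linearMap {F : Type u} [Field F] {B : Type u} [NonAssocRing B]
    [Module F B] {τ : B →ₗ[F] B} {x : B} (hx : τ x = x) (L : B →ₗ[F] F) (h1 : L 1 ≠ 0)
    (hl : ∀ b, L (x * b) = 0) (hr : ∀ b, L (b * x) = 0) : ¬ ConjInvertible τ x := by
  rintro ⟨y, hy⟩
  have h := congrArg L (hy 1)
  rw [opV, hx, mul_one, one_mul, one_mul, map_sub, map_add, hl, hr, hl, add_zero, sub_zero] at h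
  exact h1 h.symm

theorem IsInvolution.conjInvertible_one {F : Type u} [Field F] {B : Type u} [NonAssocRing B]
    [Module F B] {τ : B →ₗ[F] B} (h : IsInvolution τ) : ConjInvertible τ 1 :=
  ⟨1, fun z ↦ by simp [opV, h.map_one]⟩

section Uniqueness

variable {k : Type u} [Field k] {A : Type u} [NonAssocRing A] [Module k A] [SMulCommClass k A A]
  [IsScalarTower k A A] {σ : A →ₗ[k] A} (hσ : IsInvolution σ)
  {ι : Type*} [Fintype ι] (b : Module.Basis ι k A) {Ω : Type u} [Field Ω] [Algebra k Ω]

include hσ in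
/-- Over an algebraically closed field, some line in the direction of `1` contains eight elements
that are not conjugate-invertible. -/
theorem exists_line [IsAlgClosed Ω] (h2 : (2 : Ω) ≠ 0)
    (D : BioctonionDecomposition (σ.baseChange Ω)) : ∃ (x : ι → Ω) (T : Finset Ω), T.card = 8 ∧
      ∀ t ∈ T, ¬ ConjInvertible (σ.baseChange Ω)
        (∑ i, (x i + algebraMap k Ω (b.repr 1 i) * t) ⊗ₜ[k] b i) := by
  have : Infinite Ω := IsAlgClosed.instInfinite
  obtain ⟨c, T, hT8, hT⟩ := exists_sign_sums h2
  obtain ⟨v, hv, hL⟩ := D.exists_eigenforms h2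
  let b' := Algebra.TensorProduct.basis Ω b
  refine ⟨fun i ↦ b'.repr (∑ j, c j • v j) i, T, hT8, fun t ht ↦ ?_⟩
  obtain ⟨s, hs, hts⟩ := hT t ht
  obtain ⟨L, hL1, hLv⟩ := hL s hs
  have hsum : ∑ i, (b'.repr (∑ j, c j • v j) i + algebraMap k Ω (b.repr 1 i) * t) ⊗ₜ[k] b i =
      ∑ j, c j • v j + t • 1 := by
    simp only [TensorProduct.add_tmul, Finset.sum_add_distrib]
    congr 1
    · conv_rhs => rw [← b'.sum_repr (∑ j, c j • v j)]
      refine Finset.sum_congr rfl fun i _ ↦ ?_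
      rw [Algebra.TensorProduct.basis_apply, TensorProduct.smul_tmul', smul_eq_mul, mul_one]
    · rw [Algebra.TensorProduct.one_def, ← sum_tmul_basis_repr_one (Ω := Ω) b, Finset.smul_sum]
      refine Finset.sum_congr rfl fun i _ ↦ ?_
      rw [TensorProduct.smul_tmul', smul_eq_mul, mul_comm]
  rw [hsum]
  have hlin : ∀ y, L y * (t + ∑ i, c i * s i) = 0 := fun y ↦ by rw [hts, mul_zero]
  refine not_conjInvertible_of_linearMap ?_ L hL1 (fun y ↦ ?_) fun y ↦ ?_
  · simp only [map_add, map_sum, map_smul, hv, (hσ.baseChange Ω).map_one]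
  · rw [← hlin y, add_mul, Finset.sum_mul, map_add, map_sum, mul_add, Finset.mul_sum, add_comm]
    congr 1
    · rw [smul_mul_assoc, one_mul, map_smul, smul_eq_mul, mul_comm]
    · refine Finset.sum_congr rfl fun i _ ↦ ?_
      rw [smul_mul_assoc, map_smul, (hLv i y).1, smul_eq_mul]; ring
  · rw [← hlin y, mul_add, Finset.mul_sum, map_add, map_sum, mul_add, Finset.mul_sum, add_comm]
    congr 1
    · rw [mul_smul_comm, mul_one, map_smul, smul_eq_mul, mul_comm]
    · refine Finset.sum_congr rfl fun i _ ↦ ?_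
      rw [mul_smul_comm, map_smul, (hLv i y).2, smul_eq_mul]; ring

variable [IsAlgClosed Ω] (h2 : (2 : Ω) ≠ 0) (D : BioctonionDecomposition (σ.baseChange Ω))

theorem eval_map_algebraMap {k Ω ι : Type*} [Field k] [Field Ω] [Algebra k Ω] (x : ι → Ω)
    (N : MvPolynomial ι k) :
    MvPolynomial.eval x (MvPolynomial.map (algebraMap k Ω) N) = MvPolynomial.aeval x N := by
  rw [MvPolynomial.eval_map, MvPolynomial.aeval_def]

theorem eval_map_algebraMap_one {k Ω ι : Type*} [Field k] [Field Ω] [Algebra k Ω] (x : ι → k)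
    (N : MvPolynomial ι k) : MvPolynomial.eval (fun i ↦ algebraMap k Ω (x i))
      (MvPolynomial.map (algebraMap k Ω) N) = algebraMap k Ω (MvPolynomial.eval x N) := by
  rw [eval_map_algebraMap, ← MvPolynomial.aeval_eq_eval']
  exact MvPolynomial.aeval_algebraMap_apply Ω x N

include hσ h2 D in
/-- A form that detects conjugate-invertibility has degree at least eight: it has eight zeros on the
line of `exists_line` and does not vanish at `1`. -/
theorem eight_le_of_detectsInvertibility {N : MvPolynomial ι k} {n : ℕ} (hN : N.IsHomogeneous n)
    (h : DetectsInvertibility σ b N) : 8 ≤ n := by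
  obtain ⟨x, T, hT8, hT⟩ := exists_line hσ b h2 D
  rw [← hT8]
  refine (hN.map (algebraMap k Ω)).card_le (x := x)
    (o := fun i ↦ algebraMap k Ω (b.repr 1 i)) ?_ T fun t ht ↦ ?_
  · rw [eval_map_algebraMap, h Ω, sum_tmul_basis_repr_one]
    exact (hσ.baseChange Ω).conjInvertible_one
  · rw [eval_map_algebraMap]
    by_contra hne
    exact hT t ht ((h Ω _).1 hne)

include hσ h2 D in
/-- A normalized octic form that detects conjugate-invertibility is unique, since its zeros are
prescribed and its restriction to the line of `exists_line` is separable. -/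
theorem eq_of_detectsInvertibility {N N' : MvPolynomial ι k} (hN : N.IsHomogeneous 8)
    (hN' : N'.IsHomogeneous 8) (h : DetectsInvertibility σ b N)
    (h' : DetectsInvertibility σ b N') (h1 : MvPolynomial.eval (b.repr 1) N = 1)
    (h1' : MvPolynomial.eval (b.repr 1) N' = 1) : N = N' := by
  obtain ⟨x, T, hT8, hT⟩ := exists_line hσ b h2 D
  apply MvPolynomial.map_injective _ (algebraMap k Ω).injective
  refine (hN.map (algebraMap k Ω)).eq_of_zeros (by norm_num) (hN'.map (algebraMap k Ω)) (x₀ := x)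
    (o := fun i ↦ algebraMap k Ω (b.repr 1 i)) ?_ ?_ (fun y hy ↦ ?_) T (fun t ht ↦ ?_) hT8
  · rw [eval_map_algebraMap_one, h1, map_one]
  · rw [eval_map_algebraMap_one, h1', map_one]
  · rw [eval_map_algebraMap] at hy ⊢
    by_contra hne
    exact (h Ω _).2 ((h' Ω _).1 hne) hy
  · rw [eval_map_algebraMap]
    by_contra hne
    exact hT t ht ((h Ω _).1 hne)

end Uniqueness

/-! ### Descent of octonion subalgebras -/

section Descent

variable {F : Type u} [Field F] {K : Type u} [Field K] [Algebra F K]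

theorem one_tmul_injective (K : Type u) [Field K] [Algebra F K] (M : Type u) [AddCommGroup M]
    [Module F M] : Function.Injective fun x : M ↦ (1 : K) ⊗ₜ[F] x :=
  Module.FaithfullyFlat.tensorProduct_mk_injective M

/-- A vector that is a scalar multiple of `1` over an extension field is so over the ground
field. -/
theorem eq_algebraMap_of_one_tmul_eq {M : Type u} [NonAssocRing M] [Module F M] (φ : M →ₗ[F] F)
    (hφ : φ 1 = 1) {x : M} {c : K} (h : (1 : K) ⊗ₜ[F] x = c ⊗ₜ 1) : c = algebraMap F K (φ x) := by
  have := congrArg (TensorProduct.rid F K ∘ φ.lTensor K) h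
  simp only [Function.comp_apply, LinearMap.lTensor_tmul, TensorProduct.rid_tmul, hφ, one_smul]
    at this
  rw [← this, Algebra.smul_def, mul_one]

/-- An algebra which becomes an octonion algebra over an extension field is an octonion algebra, if
the conjugation is defined over the ground field. -/
theorem OctonionAlgebra.exists_of_baseChange (h2 : (2 : F) ≠ 0) {M : Type u} [NonAssocRing M]
    [Module F M] [SMulCommClass F M M] [IsScalarTower F M M] (C : OctonionAlgebra K)
    (e : K ⊗[F] M ≃ₗ[K] C) (hm : ∀ x y, e (1 ⊗ₜ (x * y)) = e (1 ⊗ₜ x) * e (1 ⊗ₜ y))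
    (h1 : e (1 ⊗ₜ 1) = 1) (t : M →ₗ[F] M) (ht : ∀ x, e (1 ⊗ₜ t x) = C.conj (e (1 ⊗ₜ x))) :
    ∃ (C' : OctonionAlgebra F) (j : C' ≃ₗ[F] M), (∀ x y, j (x * y) = j x * j y) ∧ j 1 = 1 ∧
      ∀ x, j (C'.conj x) = t (j x) := by
  have hinj : ∀ {x y : M}, e (1 ⊗ₜ x) = e (1 ⊗ₜ y) → x = y := fun h ↦
    one_tmul_injective K M (e.injective h)
  have hsm : ∀ (c : F) (x : M), e (1 ⊗ₜ (c • x)) = algebraMap F K c • e (1 ⊗ₜ x) := fun c x ↦ by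
    rw [TensorProduct.tmul_smul, ← algebraMap_smul K, map_smul]
  have hne : (1 : M) ≠ 0 := by
    intro h
    rw [h, TensorProduct.tmul_zero, map_zero] at h1
    have := C.norm_one
    rw [← h1, QuadraticMap.map_zero] at this
    exact zero_ne_one this
  obtain ⟨φ, hφ⟩ := Module.Projective.exists_dual_eq_one F hne
  let β : LinearMap.BilinForm F M := LinearMap.mk₂ F (fun x y ↦ φ (x * t y + y * t x))
    (fun x x' y ↦ by simp only [add_mul, mul_add, map_add]; ring)
    (fun c x y ↦ by
      simp only [smul_mul_assoc, mul_smul_comm, map_add, map_smul, smul_eq_mul]; ring)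
    (fun x y y' ↦ by simp only [add_mul, mul_add, map_add]; ring)
    (fun c x y ↦ by
      simp only [smul_mul_assoc, mul_smul_comm, map_add, map_smul, smul_eq_mul]; ring)
  have hβ : ∀ x y, C.bil (e (1 ⊗ₜ x)) (e (1 ⊗ₜ y)) = algebraMap F K (β x y) := by
    intro x y
    refine eq_algebraMap_of_one_tmul_eq φ hφ (e.injective ?_)
    rw [TensorProduct.tmul_add, map_add, hm, hm, ht, ht, C.mul_conj_add, ← h1, ← map_smul,
      TensorProduct.smul_tmul', smul_eq_mul, mul_one]
  have hs : ∀ x y, β x y = β y x := fun x y ↦ by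
    apply (algebraMap F K).injective
    rw [← hβ, ← hβ, C.bil_comm]
  have hmm : ∀ x y z w, β (x * y) (z * w) + β (z * y) (x * w) = β x z * β y w := by
    intro x y z w
    apply (algebraMap F K).injective
    simp only [map_add, map_mul, ← hβ, hm]
    exact C.bil_mul_add _ _ _ _
  have hn : ∀ x, (∀ y, β x y = 0) → x = 0 := by
    intro x hx
    apply hinj
    rw [TensorProduct.tmul_zero, map_zero]
    apply C.eq_of_bil_eq
    intro z
    rw [map_zero, LinearMap.zero_apply]
    obtain ⟨w, rfl⟩ := e.surjective z
    induction w using TensorProduct.induction_on with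
    | zero => simp
    | add w w' h h' => rw [map_add, map_add, h, h', add_zero]
    | tmul a y =>
      have : a ⊗ₜ[F] y = a • ((1 : K) ⊗ₜ[F] y) := by
        rw [TensorProduct.smul_tmul', smul_eq_mul, mul_one]
      rw [this, map_smul, map_smul, hβ, hx, map_zero, smul_zero]
  have h8 : Module.finrank F M = 8 := by
    rw [← Module.finrank_baseChange (R := K), e.finrank_eq, C.finrank_eq]
  have hconj : ∀ x : M, β x 1 • (1 : M) - x = t x := fun x ↦ hinj (by
    rw [ht, C.conj_apply, TensorProduct.tmul_sub, map_sub, hsm, h1, ← hβ, h1])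
  exact ⟨ofBilin h2 M β hs hmm hn h8, LinearEquiv.refl F M, fun _ _ ↦ rfl, rfl,
    fun x ↦ (ofBilin_conj h2 M β hs hmm hn h8 x).trans (hconj x)⟩

/-- The ring structure on a subspace that contains `1` and is closed under multiplication. -/
abbrev Submodule.nonAssocRing {B : Type u} [NonAssocRing B] [Module F B] (M : Submodule F B)
    (h1 : (1 : B) ∈ M) (hm : ∀ x ∈ M, ∀ y ∈ M, x * y ∈ M) : NonAssocRing M :=
  { (inferInstance : AddCommGroup M) with
    mul := fun x y ↦ ⟨x * y, hm _ x.2 _ y.2⟩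
    one := ⟨1, h1⟩
    left_distrib := fun x y z ↦ Subtype.ext (mul_add (x : B) y z)
    right_distrib := fun x y z ↦ Subtype.ext (add_mul (x : B) y z)
    zero_mul := fun x ↦ Subtype.ext (zero_mul (x : B))
    mul_zero := fun x ↦ Subtype.ext (mul_zero (x : B))
    one_mul := fun x ↦ Subtype.ext (one_mul (x : B))
    mul_one := fun x ↦ Subtype.ext (mul_one (x : B)) }

/-- An octonion subalgebra of `K ⊗ B` that is spanned by elements of `B` is the scalar extension
of an octonion subalgebra of `B`. -/
theorem OctonionAlgebra.exists_descent (h2 : (2 : F) ≠ 0) {B : Type u} [NonAssocRing B]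
    [Module F B] [SMulCommClass F B B] [IsScalarTower F B B] {τ : B →ₗ[F] B}
    (C : OctonionAlgebra K) (i : C →ₗ[K] K ⊗[F] B) (hi : Function.Injective i)
    (hm : ∀ x y, i (x * y) = i x * i y) (h1 : i 1 = 1)
    (hc : ∀ x, i (C.conj x) = τ.baseChange K (i x))
    (hs : ∀ a, i a ∈ Submodule.span K {z | (∃ x : B, z = 1 ⊗ₜ x) ∧ z ∈ LinearMap.range i}) :
    ∃ (C' : OctonionAlgebra F) (j : C' →ₗ[F] B), Function.Injective j ∧
      (∀ x y, j (x * y) = j x * j y) ∧ j 1 = 1 ∧ (∀ x, j (C'.conj x) = τ (j x)) ∧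
      ∀ x : B, x ∈ LinearMap.range j ↔ (1 : K) ⊗ₜ[F] x ∈ LinearMap.range i := by
  let M : Submodule F B :=
    { carrier := {x | (1 : K) ⊗ₜ[F] x ∈ LinearMap.range i}
      add_mem' := fun {x y} hx hy ↦ by
        simp only [Set.mem_ofPred_eq] at *
        rw [TensorProduct.tmul_add]; exact add_mem hx hy
      zero_mem' := ⟨0, by rw [map_zero, TensorProduct.tmul_zero]⟩
      smul_mem' := fun c x hx ↦ by
        simp only [Set.mem_ofPred_eq] at *
        rw [TensorProduct.tmul_smul, ← algebraMap_smul K]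
        exact Submodule.smul_mem _ _ hx }
  have hM : ∀ x, x ∈ M ↔ (1 : K) ⊗ₜ[F] x ∈ LinearMap.range i := fun x ↦ Iff.rfl
  have hM1 : (1 : B) ∈ M := ⟨1, h1⟩
  have hMm : ∀ x ∈ M, ∀ y ∈ M, x * y ∈ M := by
    rintro x ⟨a, ha⟩ y ⟨b, hb⟩
    refine ⟨a * b, ?_⟩
    rw [hm, ha, hb, Algebra.TensorProduct.tmul_mul_tmul, mul_one]
  let _ := M.nonAssocRing hM1 hMm
  have : SMulCommClass F M M := ⟨fun c x y ↦ Subtype.ext (smul_comm c (x : B) (y : B))⟩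
  have : IsScalarTower F M M := ⟨fun c x y ↦ Subtype.ext (smul_mul_assoc c (x : B) (y : B))⟩
  have hMt : ∀ x ∈ M, τ x ∈ M := by
    rintro x ⟨a, ha⟩
    exact ⟨C.conj a, by rw [hc, ha, LinearMap.baseChange_tmul]⟩
  let t : M →ₗ[F] M := τ.restrict hMt
  -- the inclusion of the scalar extension of the subalgebra
  let I : K ⊗[F] M →ₗ[K] K ⊗[F] B := M.subtype.baseChange K
  have hI : Function.Injective I :=
    Module.Flat.lTensor_preserves_injective_linearMap M.subtype M.subtype_injective
  have hIt : ∀ (a : K) (x : M), I (a ⊗ₜ x) = a ⊗ₜ (x : B) := fun a x ↦ rfl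
  have hr : LinearMap.range I = LinearMap.range i := by
    apply le_antisymm
    · rintro _ ⟨w, rfl⟩
      induction w using TensorProduct.induction_on with
      | zero => simp
      | add w w' h h' => rw [map_add]; exact add_mem h h'
      | tmul a x =>
        have : I (a ⊗ₜ x) = a • ((1 : K) ⊗ₜ[F] (x : B)) := by
          rw [hIt, TensorProduct.smul_tmul', smul_eq_mul, mul_one]
        rw [this]
        exact Submodule.smul_mem _ _ x.2
    · rintro _ ⟨a, rfl⟩
      refine Submodule.span_le.2 ?_ (hs a)
      rintro _ ⟨⟨x, rfl⟩, hx⟩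
      exact ⟨1 ⊗ₜ (⟨x, hx⟩ : M), rfl⟩
  let e : K ⊗[F] M ≃ₗ[K] C := (LinearEquiv.ofInjective I hI).trans
    ((LinearEquiv.ofEq _ _ hr).trans (LinearEquiv.ofInjective i hi).symm)
  have he : ∀ w, i (e w) = I w := by
    intro w
    have : i (e w) = (LinearEquiv.ofInjective i hi (e w) : K ⊗[F] B) := rfl
    rw [this]
    simp only [e, LinearEquiv.trans_apply, LinearEquiv.apply_symm_apply]
    rfl
  obtain ⟨C', j, hjm, hj1, hjc⟩ := C.exists_of_baseChange h2 (M := M) e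
    (fun x y ↦ hi (by
      rw [hm, he, he, he, hIt, hIt, hIt, Algebra.TensorProduct.tmul_mul_tmul, mul_one]; rfl))
    (hi (by rw [he, h1, hIt]; rfl)) t (fun x ↦ hi (by
      rw [hc, he, he, hIt, hIt, LinearMap.baseChange_tmul]; rfl))
  refine ⟨C', M.subtype ∘ₗ j.toLinearMap, M.subtype_injective.comp j.injective, fun x y ↦ ?_, ?_,
    fun x ↦ ?_, fun x ↦ ?_⟩
  · exact congrArg Subtype.val (hjm x y)
  · exact congrArg Subtype.val hj1
  · exact congrArg Subtype.val (hjc x)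
  · rw [← hM]
    constructor
    · rintro ⟨y, rfl⟩; exact (j y).2
    · intro hx
      exact ⟨j.symm ⟨x, hx⟩, by simp⟩

end Descent

/-! ### Descent of decompositions -/

namespace OctonionAlgebra

variable {F : Type u} [Field F]

theorem tmul_one_injective (C C' : OctonionAlgebra F) :
    Function.Injective fun a : C ↦ a ⊗ₜ[F] (1 : C') := by
  have hne : (1 : C') ≠ 0 := fun h ↦ by
    have := C'.norm_one
    rw [h, QuadraticMap.map_zero] at this
    exact zero_ne_one this
  obtain ⟨φ, hφ⟩ := Module.Projective.exists_dual_eq_one F hne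
  intro a b h
  have := congrArg (TensorProduct.rid F C ∘ φ.lTensor C) h
  simpa [hφ] using this

theorem one_tmul_injective (C C' : OctonionAlgebra F) :
    Function.Injective fun a : C' ↦ (1 : C) ⊗ₜ[F] a := by
  intro a b h
  apply C'.tmul_one_injective C
  have := congrArg (TensorProduct.comm F C C') h
  simpa using this

end OctonionAlgebra

section

variable {F : Type u} [Field F] {K : Type u} [Field K] [Algebra F K] {B : Type u} [NonAssocRing B]
  [Module F B] [SMulCommClass F B B] [IsScalarTower F B B] {τ : B →ₗ[F] B}

/-- The skew elements of a scalar extension are spanned by skew elements. -/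
theorem mem_span_of_mem_skew (h2 : (2 : K) ≠ 0) (hτ : IsInvolution τ) {u : K ⊗[F] B}
    (hu : u ∈ skew (τ.baseChange K)) :
    u ∈ Submodule.span K {z | ∃ s ∈ skew τ, z = (1 : K) ⊗ₜ[F] s} := by
  have h : ∀ v : K ⊗[F] B, v - τ.baseChange K v ∈
      Submodule.span K {z | ∃ s ∈ skew τ, z = (1 : K) ⊗ₜ[F] s} := by
    intro v
    induction v using TensorProduct.induction_on with
    | zero => simp
    | add v w hv hw =>
      rw [map_add, add_sub_add_comm]; exact add_mem hv hw
    | tmul a x =>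
      have : a ⊗ₜ[F] x - τ.baseChange K (a ⊗ₜ x) = a • ((1 : K) ⊗ₜ[F] (x - τ x)) := by
        rw [LinearMap.baseChange_tmul, TensorProduct.smul_tmul', smul_eq_mul, mul_one,
          TensorProduct.tmul_sub]
      rw [this]
      refine Submodule.smul_mem _ _ (Submodule.subset_span ⟨_, ?_, rfl⟩)
      change τ (x - τ x) = -(x - τ x)
      rw [map_sub, hτ.involutive, neg_sub]
  have h' := h u
  rw [show τ.baseChange K u = -u from hu, sub_neg_eq_add, ← two_smul K] at h'
  have := Submodule.smul_mem _ (2 : K)⁻¹ h'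
  rwa [smul_smul, inv_mul_cancel₀ h2, one_smul] at this

namespace BioctonionDecomposition

omit [SMulCommClass F B B] [IsScalarTower F B B] in
/-- A decomposition from an isomorphism out of a tensor product. -/
def ofEquiv (C₁ C₂ : OctonionAlgebra F) (e : (C₁ ⊗[F] C₂) ≃ₗ[F] B)
    (hm : ∀ t u, e (t * u) = e t * e u)
    (hc : ∀ t, e (TensorProduct.map C₁.conj C₂.conj t) = τ (e t)) : BioctonionDecomposition τ where
  C₁ := C₁
  C₂ := C₂
  iso := e.symm
  map_mul x y := by
    rw [LinearEquiv.symm_apply_eq, hm, LinearEquiv.apply_symm_apply, LinearEquiv.apply_symm_apply]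
  map_conj x := by rw [LinearEquiv.symm_apply_eq, hc, LinearEquiv.apply_symm_apply]

omit [SMulCommClass F B B] [IsScalarTower F B B] in
theorem signs_ofEquiv {C₁ C₂ : OctonionAlgebra F} {e : (C₁ ⊗[F] C₂) ≃ₗ[F] B}
    (hm : ∀ t u, e (t * u) = e t * e u)
    (hc : ∀ t, e (TensorProduct.map C₁.conj C₂.conj t) = τ (e t)) {x : C₁} {y : C₂}
    (hx : C₁.conj x = -x) (hy : C₂.conj y = -y) :
    (ofEquiv C₁ C₂ e hm hc).Signs 1 (e (x ⊗ₜ 1 + 1 ⊗ₜ y)) (e (x ⊗ₜ 1 - 1 ⊗ₜ y)) :=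
  ⟨x, y, hx, hy, e.symm_apply_apply _, (e.symm_apply_apply _).trans (one_smul F _).symm⟩

end BioctonionDecomposition

/-- If the sign change of the skew elements is defined over the ground field, then so is the
decomposition: its factors are generated by the eigenspaces of the sign change. -/
theorem BioctonionDecomposition.exists_descent (h2 : (2 : F) ≠ 0) (hτ : IsInvolution τ)
    (D : BioctonionDecomposition (τ.baseChange K)) (g : B →ₗ[F] B)
    (hg : ∀ s ∈ skew τ, (1 : K) ⊗ₜ[F] g s = D.natural (1 ⊗ₜ s)) :
    ∃ D' : BioctonionDecomposition τ, ∀ s ∈ skew τ, D'.Signs 1 s (g s) := by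
  have h2' : (2 : K) ≠ 0 := ofNat_ne_zero_of_algebra h2
  let i₁ : D.C₁ →ₗ[K] K ⊗[F] B :=
    D.iso.symm.toLinearMap ∘ₗ (TensorProduct.mk K D.C₁ D.C₂).flip 1
  let i₂ : D.C₂ →ₗ[K] K ⊗[F] B :=
    D.iso.symm.toLinearMap ∘ₗ TensorProduct.mk K D.C₁ D.C₂ 1
  have hi₁ : ∀ a, D.iso (i₁ a) = a ⊗ₜ 1 := fun a ↦ D.iso.apply_symm_apply _
  have hi₂ : ∀ a, D.iso (i₂ a) = 1 ⊗ₜ a := fun a ↦ D.iso.apply_symm_apply _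
  have hinj : Function.Injective fun x : B ↦ (1 : K) ⊗ₜ[F] x := one_tmul_injective K B
  have hh : algebraMap F K 2⁻¹ = 2⁻¹ := by rw [map_inv₀, map_ofNat]
  have hhalf : (2 : K)⁻¹ * 2 = 1 := inv_mul_cancel₀ h2'
  -- the projections of the skew elements to the two factors
  have hproj : ∀ s ∈ skew τ, ∃ (s₁ : D.C₁) (s₂ : D.C₂), D.C₁.conj s₁ = -s₁ ∧ D.C₂.conj s₂ = -s₂ ∧
      (1 : K) ⊗ₜ[F] ((2 : F)⁻¹ • (s + g s)) = i₁ s₁ ∧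
      (1 : K) ⊗ₜ[F] ((2 : F)⁻¹ • (s - g s)) = i₂ s₂ := by
    intro s hs
    obtain ⟨s₁, s₂, h₁, h₂, h⟩ := D.exists_of_mem_skew h2' (one_tmul_mem_skew (K := K) hs)
    have hJ := D.iso_natural_eq h₂ h
    refine ⟨s₁, s₂, h₁, h₂, D.iso.injective ?_, D.iso.injective ?_⟩
    · rw [hi₁, TensorProduct.tmul_smul, ← algebraMap_smul K, map_smul, TensorProduct.tmul_add,
        hg s hs, map_add, h, hJ, hh]
      linear_combination (norm := module) hhalf • (s₁ ⊗ₜ[K] (1 : D.C₂))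
    · rw [hi₂, TensorProduct.tmul_smul, ← algebraMap_smul K, map_smul, TensorProduct.tmul_sub,
        hg s hs, map_sub, h, hJ, hh]
      linear_combination (norm := module) hhalf • ((1 : D.C₁) ⊗ₜ[K] s₂)
  have hhalf' : (2 : F)⁻¹ * 2 = 1 := inv_mul_cancel₀ h2
  -- each factor is spanned by its elements that are defined over the ground field
  have hspan₁ : ∀ a, i₁ a ∈
      Submodule.span K {z | (∃ x : B, z = 1 ⊗ₜ x) ∧ z ∈ LinearMap.range i₁} := by
    intro a
    obtain ⟨c, s, hs, rfl⟩ := D.C₁.exists_add_skew h2' a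
    rw [map_add, map_smul]
    refine add_mem (Submodule.smul_mem _ _ (Submodule.subset_span
      ⟨⟨1, D.iso.injective (by rw [hi₁]; exact D.iso_one.symm)⟩, 1, rfl⟩)) ?_
    have his : D.iso (i₁ s) = s ⊗ₜ 1 + 1 ⊗ₜ 0 := by rw [hi₁, TensorProduct.tmul_zero, add_zero]
    let P : K ⊗[F] B →ₗ[K] K ⊗[F] B := (2 : K)⁻¹ • (LinearMap.id + D.natural)
    have hP : P (i₁ s) = i₁ s := by
      apply D.iso.injective
      change D.iso ((2 : K)⁻¹ • (i₁ s + D.natural (i₁ s))) = _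
      rw [map_smul, map_add, D.iso_natural_eq (by simp) his, his]
      linear_combination (norm := (simp only [TensorProduct.tmul_zero]; module))
        hhalf • (s ⊗ₜ[K] (1 : D.C₂))
    rw [← hP]
    refine (Submodule.span_le (p := (Submodule.span K _).comap P)).2 ?_
      (mem_span_of_mem_skew h2' hτ (D.mem_skew_of_eq hs (by simp) his))
    rintro _ ⟨t, ht, rfl⟩
    obtain ⟨s₁, s₂, -, -, e₁, -⟩ := hproj t ht
    refine Submodule.subset_span ?_
    have : P (1 ⊗ₜ t) = 1 ⊗ₜ ((2 : F)⁻¹ • (t + g t)) := by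
      change (2 : K)⁻¹ • ((1 : K) ⊗ₜ[F] t + D.natural (1 ⊗ₜ t)) = _
      rw [← hg t ht, ← TensorProduct.tmul_add, TensorProduct.tmul_smul, ← hh, algebraMap_smul]
    rw [this]
    exact ⟨⟨_, rfl⟩, s₁, e₁.symm⟩
  have hspan₂ : ∀ a, i₂ a ∈
      Submodule.span K {z | (∃ x : B, z = 1 ⊗ₜ x) ∧ z ∈ LinearMap.range i₂} := by
    intro a
    obtain ⟨c, s, hs, rfl⟩ := D.C₂.exists_add_skew h2' a
    rw [map_add, map_smul]
    refine add_mem (Submodule.smul_mem _ _ (Submodule.subset_span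
      ⟨⟨1, D.iso.injective (by rw [hi₂]; exact D.iso_one.symm)⟩, 1, rfl⟩)) ?_
    have his : D.iso (i₂ s) = 0 ⊗ₜ 1 + 1 ⊗ₜ s := by rw [hi₂, TensorProduct.zero_tmul, zero_add]
    let P : K ⊗[F] B →ₗ[K] K ⊗[F] B := (2 : K)⁻¹ • (LinearMap.id - D.natural)
    have hP : P (i₂ s) = i₂ s := by
      apply D.iso.injective
      change D.iso ((2 : K)⁻¹ • (i₂ s - D.natural (i₂ s))) = _
      rw [map_smul, map_sub, D.iso_natural_eq hs his, his]
      linear_combination (norm := (simp only [TensorProduct.zero_tmul]; module))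
        hhalf • ((1 : D.C₁) ⊗ₜ[K] s)
    rw [← hP]
    refine (Submodule.span_le (p := (Submodule.span K _).comap P)).2 ?_
      (mem_span_of_mem_skew h2' hτ (D.mem_skew_of_eq (by simp) hs his))
    rintro _ ⟨t, ht, rfl⟩
    obtain ⟨s₁, s₂, -, -, -, e₂⟩ := hproj t ht
    refine Submodule.subset_span ?_
    have : P (1 ⊗ₜ t) = 1 ⊗ₜ ((2 : F)⁻¹ • (t - g t)) := by
      change (2 : K)⁻¹ • ((1 : K) ⊗ₜ[F] t - D.natural (1 ⊗ₜ t)) = _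
      rw [← hg t ht, ← TensorProduct.tmul_sub, TensorProduct.tmul_smul, ← hh, algebraMap_smul]
    rw [this]
    exact ⟨⟨_, rfl⟩, s₂, e₂.symm⟩
  obtain ⟨C₁, j₁, hj₁, hm₁, ho₁, hc₁, hr₁⟩ := D.C₁.exists_descent (τ := τ) h2 i₁
    (D.iso.symm.injective.comp (D.C₁.tmul_one_injective D.C₂))
    (fun x y ↦ D.iso.injective (by
      rw [D.map_mul, hi₁, hi₁, hi₁, Algebra.TensorProduct.tmul_mul_tmul, mul_one]))
    (D.iso.injective (by rw [hi₁, D.iso_one]; rfl))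
    (fun x ↦ D.iso.injective (by
      rw [D.map_conj, hi₁, hi₁, TensorProduct.map_tmul, OctonionAlgebra.conj_one])) hspan₁
  obtain ⟨C₂, j₂, hj₂, hm₂, ho₂, hc₂, hr₂⟩ := D.C₂.exists_descent (τ := τ) h2 i₂
    (D.iso.symm.injective.comp (D.C₁.one_tmul_injective D.C₂))
    (fun x y ↦ D.iso.injective (by
      rw [D.map_mul, hi₂, hi₂, hi₂, Algebra.TensorProduct.tmul_mul_tmul, mul_one]))
    (D.iso.injective (by rw [hi₂, D.iso_one]; rfl))
    (fun x ↦ D.iso.injective (by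
      rw [D.map_conj, hi₂, hi₂, TensorProduct.map_tmul, OctonionAlgebra.conj_one])) hspan₂
  -- products of elements of the two factors
  have hd₁ : ∀ x, ∃ a, D.iso (1 ⊗ₜ j₁ x) = a ⊗ₜ 1 := fun x ↦ by
    obtain ⟨a, ha⟩ := (hr₁ (j₁ x)).1 ⟨x, rfl⟩
    exact ⟨a, by rw [← ha, hi₁]⟩
  have hd₂ : ∀ x, ∃ a, D.iso (1 ⊗ₜ j₂ x) = 1 ⊗ₜ a := fun x ↦ by
    obtain ⟨a, ha⟩ := (hr₂ (j₂ x)).1 ⟨x, rfl⟩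
    exact ⟨a, by rw [← ha, hi₂]⟩
  have hDm : ∀ x y : B, D.iso (1 ⊗ₜ (x * y)) = D.iso (1 ⊗ₜ x) * D.iso (1 ⊗ₜ y) := fun x y ↦ by
    rw [← D.map_mul, Algebra.TensorProduct.tmul_mul_tmul, mul_one]
  have hcomm : ∀ x y, j₁ x * j₂ y = j₂ y * j₁ x := fun x y ↦ by
    obtain ⟨a, ha⟩ := hd₁ x
    obtain ⟨b, hb⟩ := hd₂ y
    apply hinj
    apply D.iso.injective
    simp only [hDm, ha, hb, Algebra.TensorProduct.tmul_mul_tmul, mul_one, one_mul]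
  have hmulmul : ∀ x y z w, (j₁ x * j₂ y) * (j₁ z * j₂ w) = (j₁ x * j₁ z) * (j₂ y * j₂ w) := by
    intro x y z w
    obtain ⟨a, ha⟩ := hd₁ x
    obtain ⟨b, hb⟩ := hd₂ y
    obtain ⟨c, hc⟩ := hd₁ z
    obtain ⟨d, hd⟩ := hd₂ w
    apply hinj
    apply D.iso.injective
    simp only [hDm, ha, hb, hc, hd, Algebra.TensorProduct.tmul_mul_tmul, mul_one, one_mul]
  let m : C₁ ⊗[F] C₂ →ₗ[F] B := TensorProduct.lift ((LinearMap.mul F B).compl₁₂ j₁ j₂)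
  have hmt : ∀ x y, m (x ⊗ₜ y) = j₁ x * j₂ y := fun x y ↦ by simp [m]
  have hmm : ∀ t u, m (t * u) = m t * m u := by
    intro t u
    induction t using TensorProduct.induction_on with
    | zero => rw [zero_mul, map_zero, zero_mul]
    | add t t' h h' => rw [add_mul, map_add, h, h', map_add, add_mul]
    | tmul x y =>
    induction u using TensorProduct.induction_on with
    | zero => rw [mul_zero, map_zero, mul_zero]
    | add t t' h h' => rw [mul_add, map_add, h, h', map_add, mul_add]
    | tmul z w =>
      rw [Algebra.TensorProduct.tmul_mul_tmul, hmt, hmt, hmt, hm₁, hm₂, hmulmul]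
  have hmc : ∀ t, m (TensorProduct.map C₁.conj C₂.conj t) = τ (m t) := by
    intro t
    induction t using TensorProduct.induction_on with
    | zero => simp only [map_zero]
    | add t t' h h' => simp only [map_add, h, h']
    | tmul x y => rw [TensorProduct.map_tmul, hmt, hmt, hτ.map_mul, hc₁, hc₂, ← hc₁, ← hc₂, hcomm]
  -- a linear form that vanishes on the image of the multiplication map vanishes after extension
  have hsurj : Function.Surjective m := by
    rw [← LinearMap.range_eq_top]
    by_contra hne
    obtain ⟨φ, hφ0, hφ⟩ := Submodule.exists_le_ker_of_lt_top _ (lt_top_iff_ne_top.2 hne)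
    have hφK : ∀ w, φ.baseChange K w = 0 := by
      have h₁ : ∀ (x : C₁) (b : D.C₂), φ.baseChange K ((1 ⊗ₜ j₁ x) * i₂ b) = 0 := by
        intro x b
        refine (Submodule.span_le (p := LinearMap.ker
          (φ.baseChange K ∘ₗ LinearMap.mulLeft K ((1 : K) ⊗ₜ[F] j₁ x)))).2 ?_ (hspan₂ b)
        rintro _ ⟨⟨y, rfl⟩, hy⟩
        obtain ⟨z, rfl⟩ := (hr₂ y).2 hy
        change φ.baseChange K ((1 ⊗ₜ j₁ x) * (1 ⊗ₜ j₂ z)) = 0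
        rw [Algebra.TensorProduct.tmul_mul_tmul, LinearMap.baseChange_tmul, ← hmt,
          show φ (m (x ⊗ₜ z)) = 0 from hφ ⟨_, rfl⟩, TensorProduct.tmul_zero]
      have h₂ : ∀ (a : D.C₁) (b : D.C₂), φ.baseChange K (i₁ a * i₂ b) = 0 := by
        intro a b
        refine (Submodule.span_le (p := LinearMap.ker
          (φ.baseChange K ∘ₗ LinearMap.mulRight K (i₂ b)))).2 ?_ (hspan₁ a)
        rintro _ ⟨⟨y, rfl⟩, hy⟩
        obtain ⟨z, rfl⟩ := (hr₁ y).2 hy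
        exact h₁ z b
      intro w
      obtain ⟨w, rfl⟩ := D.iso.symm.surjective w
      induction w using TensorProduct.induction_on with
      | zero => simp only [map_zero]
      | add t t' h h' => simp only [map_add, h, h', add_zero]
      | tmul a b =>
        rw [← h₂ a b]
        congr 1
        apply D.iso.injective
        rw [D.map_mul, hi₁, hi₂, Algebra.TensorProduct.tmul_mul_tmul, mul_one, one_mul,
          LinearEquiv.apply_symm_apply]
    apply hφ0
    ext x
    have := hφK (1 ⊗ₜ x)
    rw [LinearMap.baseChange_tmul] at this
    have := congrArg (TensorProduct.rid F K) this
    rw [TensorProduct.rid_tmul, map_zero, ← Algebra.algebraMap_eq_smul_one, map_eq_zero] at this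
    exact this
  have hfin : Module.finrank F (C₁ ⊗[F] C₂) = Module.finrank F B := by
    rw [Module.finrank_tensorProduct, C₁.finrank_eq, C₂.finrank_eq,
      ← Module.finrank_baseChange (R := K), D.iso.finrank_eq, Module.finrank_tensorProduct,
      D.C₁.finrank_eq, D.C₂.finrank_eq]
  have : Module.Finite F B := Module.finite_of_finrank_pos (by
    rw [← hfin, Module.finrank_tensorProduct, C₁.finrank_eq, C₂.finrank_eq]; norm_num)
  let e : (C₁ ⊗[F] C₂) ≃ₗ[F] B := LinearEquiv.ofBijective m
    ⟨(LinearMap.injective_iff_surjective_of_finrank_eq_finrank hfin).2 hsurj, hsurj⟩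
  have he : ∀ t, e t = m t := fun _ ↦ rfl
  refine ⟨BioctonionDecomposition.ofEquiv C₁ C₂ e hmm hmc, fun s hs ↦ ?_⟩
  obtain ⟨s₁, s₂, h₁, h₂, e₁, e₂⟩ := hproj s hs
  obtain ⟨x, hx⟩ := (hr₁ _).2 ⟨s₁, e₁.symm⟩
  obtain ⟨y, hy⟩ := (hr₂ _).2 ⟨s₂, e₂.symm⟩
  have hgs : τ (g s) = -g s := by
    apply hinj
    have := D.natural_mem_skew h2' (one_tmul_mem_skew (K := K) hs)
    rw [← hg s hs] at this
    have : τ.baseChange K (1 ⊗ₜ g s) = -(1 ⊗ₜ g s) := this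
    rwa [LinearMap.baseChange_tmul, ← TensorProduct.tmul_neg] at this
  have hs' : τ s = -s := hs
  have hxs : C₁.conj x = -x := hj₁ (by
    rw [hc₁, map_neg, hx, map_smul, map_add, hgs, hs']; module)
  have hys : C₂.conj y = -y := hj₂ (by
    rw [hc₂, map_neg, hy, map_smul, map_sub, hgs, hs']; module)
  have es : e (x ⊗ₜ 1 + 1 ⊗ₜ y) = s := by
    rw [he, map_add, hmt, hmt, ho₁, ho₂, mul_one, one_mul, hx, hy]
    linear_combination (norm := module) hhalf' • s
  have egs : e (x ⊗ₜ 1 - 1 ⊗ₜ y) = g s := by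
    rw [he, map_sub, hmt, hmt, ho₁, ho₂, mul_one, one_mul, hx, hy]
    linear_combination (norm := module) hhalf' • g s
  have := BioctonionDecomposition.signs_ofEquiv (e := e) hmm hmc hxs hys
  rwa [es, egs] at this

end

/-! ### Rationality of the sign change -/

/-- An endomorphism `g` of the skew elements with `L_s L_{g s}` scalar for all `s` is a multiple of
the sign change. -/
theorem SkewClifford.exists_eq_smul {F : Type u} [Field F] {B : Type u} [NonAssocRing B]
    [Module F B] [SMulCommClass F B B] [IsScalarTower F B B] {τ J : B →ₗ[F] B} {q : B → F}
    (h : SkewClifford τ J q) (g : B →ₗ[F] B)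
    (hg : ∀ s ∈ skew τ, ∃ c : F, ∀ x, s * (g s * x) = c • x) :
    ∃ δ : F, ∀ s ∈ skew τ, g s = δ • J s := by
  obtain ⟨p, hp, hqp⟩ := h.exists_ne_zero
  -- an element `y` for which `L_p L_y` is scalar is a multiple of `J p`
  have hcancel : ∀ (y : B) (c : F), (∀ x, p * (y * x) = c • x) → y = (c * (q p)⁻¹) • J p := by
    intro y c hy
    have h1 := h.mul_mul' hp (y * 1)
    rw [hy, mul_one, h.q_map hp, mul_smul_comm, mul_one] at h1
    rw [mul_comm, mul_smul, h1, smul_smul, inv_mul_cancel₀ hqp, one_smul]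
  obtain ⟨c, hc⟩ := hg p hp
  set δ := c * (q p)⁻¹ with hδ
  have hgp : g p = δ • J p := hcancel _ _ hc
  refine ⟨δ, fun s hs ↦ ?_⟩
  obtain ⟨c₁, hc₁⟩ := hg s hs
  obtain ⟨c₂, hc₂⟩ := hg (s + p) (add_mem hs hp)
  -- the difference of the two maps vanishes at `p`, so the defining relation for `s + p` says that
  -- `L_p` is scalar on it
  set w := g s - δ • J s with hw
  have hws : ∀ x, s * (w * x) = (c₁ - δ * q s) • x := by
    intro x
    rw [hw, sub_mul, mul_sub, hc₁, smul_mul_assoc, mul_smul_comm, h.mul_mul s hs]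
    module
  have hwp : ∀ x, p * (w * x) = (c₂ - δ * q (s + p) - (c₁ - δ * q s)) • x := by
    intro x
    have e := h.mul_mul (s + p) (add_mem hs hp) x
    have e' := hc₂ x
    have hw' : g (s + p) = w + δ • J (s + p) := by rw [map_add, map_add, hgp, hw]; module
    rw [hw', add_mul w, mul_add, smul_mul_assoc, mul_smul_comm, e, add_mul, hws] at e'
    linear_combination (norm := module) e'
  have hwJ := hcancel _ _ hwp
  generalize (c₂ - δ * q (s + p) - (c₁ - δ * q s)) * (q p)⁻¹ = μ at hwJ
  suffices w = 0 by rwa [hw, sub_eq_zero] at this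
  by_cases hμ : μ = 0
  · rw [hwJ, hμ, zero_smul]
  -- then `L_s L_{J p}` is scalar, so `s` is a multiple of `p`, where the two maps agree
  have hsp : s = ((μ * q p)⁻¹ * (c₁ - δ * q s)) • p := by
    have e := hws p
    have e₁ := h.mul_mul' hp 1
    rw [mul_one, h.q_map hp] at e₁
    rw [hwJ, smul_mul_assoc, e₁, smul_smul, mul_smul_comm, mul_one] at e
    rw [mul_smul, ← e, smul_smul, inv_mul_cancel₀ (mul_ne_zero hμ hqp), one_smul]
  rw [hw, hsp, map_smul, map_smul, hgp]
  module

section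

variable {k : Type u} [Field k] {A : Type u} [NonAssocRing A] [Module k A] [SMulCommClass k A A]
  [IsScalarTower k A A] {σ : A →ₗ[k] A} {K : Type u} [Field K] [Algebra k K]

omit [SMulCommClass k A A] [IsScalarTower k A A] in
/-- Linear functionals on the field of scalars separate the elements of a scalar extension. -/
theorem exists_rTensor_ne_zero {x : K ⊗[k] A} (hx : x ≠ 0) :
    ∃ ρ : K →ₗ[k] k, TensorProduct.lid k A (ρ.rTensor A x) ≠ 0 := by
  let β := Module.Free.chooseBasis k K
  by_contra! h
  apply hx
  apply (TensorProduct.equivFinsuppOfBasisLeft β).injective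
  rw [map_zero]
  ext i
  rw [TensorProduct.equivFinsuppOfBasisLeft_apply]
  exact h (β.coord i)

/-- The property that `L_s L_{f s}` is scalar for skew `s` is inherited by scalar extensions. -/
theorem baseChange_mul_mul (h2 : (2 : K) ≠ 0) (hσ : IsInvolution σ) (f : A →ₗ[k] A)
    (hf : ∀ s ∈ skew σ, ∃ c : k, ∀ x, s * (f s * x) = c • x) :
    ∀ s ∈ skew (σ.baseChange K), ∃ c : K, ∀ x, s * (f.baseChange K s * x) = c • x := by
  let g := f.baseChange K
  -- the polar form of the relation is bilinear, so it can be checked on a spanning set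
  have hpol : ∀ s ∈ skew σ, ∀ t ∈ skew σ, ∃ c : K, ∀ x : K ⊗[k] A,
      (1 ⊗ₜ s) * (g (1 ⊗ₜ t) * x) + (1 ⊗ₜ t) * (g (1 ⊗ₜ s) * x) = c • x := by
    intro s hs t ht
    obtain ⟨c₁, hc₁⟩ := hf s hs
    obtain ⟨c₂, hc₂⟩ := hf t ht
    obtain ⟨c, hc⟩ := hf (s + t) (add_mem hs ht)
    refine ⟨algebraMap k K (c - c₁ - c₂), fun x ↦ ?_⟩
    induction x using TensorProduct.induction_on with
    | zero => simp only [mul_zero, smul_zero, add_zero]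
    | add x y hx hy =>
      rw [smul_add, ← hx, ← hy]
      simp only [mul_add]
      abel
    | tmul a x =>
      simp only [g, LinearMap.baseChange_tmul, Algebra.TensorProduct.tmul_mul_tmul, one_mul]
      rw [← TensorProduct.tmul_add, algebraMap_smul, ← TensorProduct.tmul_smul]
      congr 1
      have e := hc x
      simp only [map_add, add_mul, mul_add, hc₁, hc₂] at e
      linear_combination (norm := module) e
  have hpol' : ∀ t ∈ skew σ, ∀ u ∈ skew (σ.baseChange K), ∃ c : K, ∀ x : K ⊗[k] A,
      u * (g (1 ⊗ₜ t) * x) + (1 ⊗ₜ t) * (g u * x) = c • x := by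
    intro t ht u hu
    refine Submodule.span_induction ?_ ?_ ?_ ?_ (mem_span_of_mem_skew h2 hσ hu)
    · rintro _ ⟨s, hs, rfl⟩; exact hpol s hs t ht
    · exact ⟨0, fun x ↦ by simp only [map_zero, zero_mul, mul_zero, add_zero, zero_smul]⟩
    · rintro u v - - ⟨a, ha⟩ ⟨b, hb⟩
      refine ⟨a + b, fun x ↦ ?_⟩
      rw [add_smul, ← ha, ← hb, map_add]
      simp only [add_mul, mul_add]
      abel
    · rintro r u - ⟨a, ha⟩
      refine ⟨r * a, fun x ↦ ?_⟩
      rw [mul_smul, ← ha, map_smul, smul_mul_assoc, smul_mul_assoc, mul_smul_comm, smul_add]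
  have hpol'' : ∀ u ∈ skew (σ.baseChange K), ∀ v ∈ skew (σ.baseChange K), ∃ c : K,
      ∀ x : K ⊗[k] A, u * (g v * x) + v * (g u * x) = c • x := by
    intro u hu v hv
    refine Submodule.span_induction ?_ ?_ ?_ ?_ (mem_span_of_mem_skew h2 hσ hv)
    · rintro _ ⟨s, hs, rfl⟩; exact hpol' s hs u hu
    · exact ⟨0, fun x ↦ by simp only [map_zero, zero_mul, mul_zero, add_zero, zero_smul]⟩
    · rintro v w - - ⟨a, ha⟩ ⟨b, hb⟩
      refine ⟨a + b, fun x ↦ ?_⟩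
      rw [add_smul, ← ha, ← hb, map_add]
      simp only [add_mul, mul_add]
      abel
    · rintro r v - ⟨a, ha⟩
      refine ⟨r * a, fun x ↦ ?_⟩
      rw [mul_smul, ← ha, map_smul, smul_mul_assoc, smul_mul_assoc, mul_smul_comm, smul_add]
  intro s hs
  obtain ⟨c, hc⟩ := hpol'' s hs s hs
  refine ⟨2⁻¹ * c, fun x ↦ ?_⟩
  rw [mul_smul, ← hc, ← two_smul K, smul_smul, inv_mul_cancel₀ h2, one_smul]

/-- Up to a scalar whose square lies in the ground field, the sign change of a decomposition over
an extension field is defined over the ground field: a `k`-linear component of it satisfies the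
relation which determines the sign change up to scalars. -/
theorem BioctonionDecomposition.exists_rational_natural (h2 : (2 : K) ≠ 0) (hσ : IsInvolution σ)
    (D : BioctonionDecomposition (σ.baseChange K)) : ∃ (f : A →ₗ[k] A) (d : k) (δ : K), δ ≠ 0 ∧
      δ ^ 2 = algebraMap k K d ∧ (∀ s ∈ skew σ, f s ∈ skew σ) ∧
      ∀ s ∈ skew σ, (1 : K) ⊗ₜ[k] f s = δ • D.natural (1 ⊗ₜ s) := by
  obtain ⟨q, hq⟩ := D.exists_skewClifford h2
  have hinj := one_tmul_injective (F := k) K A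
  obtain ⟨s₀, hs₀, hne⟩ : ∃ s ∈ skew σ, s ≠ 0 := by
    by_contra! h
    obtain ⟨p, hp, hqp⟩ := hq.exists_ne_zero
    have hp0 : p = 0 := by
      have := mem_span_of_mem_skew h2 hσ hp
      rw [Submodule.span_eq_bot.2 ?_] at this
      · exact this
      · rintro _ ⟨s, hs, rfl⟩; rw [h s hs, TensorProduct.tmul_zero]
    exact hq.ne_zero_of_q_ne_zero D.one_ne_zero hp hqp hp0
  have hne' : D.natural ((1 : K) ⊗ₜ[k] s₀) ≠ 0 := fun h ↦ hne (hinj (by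
    change (1 : K) ⊗ₜ[k] s₀ = 1 ⊗ₜ 0
    rw [← D.natural_natural (1 ⊗ₜ s₀), h, map_zero, TensorProduct.tmul_zero]))
  obtain ⟨ρ, hρ⟩ := exists_rTensor_ne_zero hne'
  let Φ : K ⊗[k] A →ₗ[k] A := (TensorProduct.lid k A).toLinearMap ∘ₗ ρ.rTensor A
  have hΦ : ∀ (a : K) (x : A), Φ (a ⊗ₜ x) = ρ a • x := fun a x ↦ by simp [Φ]
  have hΦl : ∀ (a : A) (x : K ⊗[k] A), Φ ((1 ⊗ₜ a) * x) = a * Φ x := by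
    intro a x
    induction x using TensorProduct.induction_on with
    | zero => simp only [mul_zero, map_zero]
    | add x y hx hy => rw [mul_add, map_add, hx, hy, map_add, mul_add]
    | tmul c x => rw [Algebra.TensorProduct.tmul_mul_tmul, one_mul, hΦ, hΦ, mul_smul_comm]
  have hΦr : ∀ (a : A) (x : K ⊗[k] A), Φ (x * (1 ⊗ₜ a)) = Φ x * a := by
    intro a x
    induction x using TensorProduct.induction_on with
    | zero => simp only [zero_mul, map_zero]
    | add x y hx hy => rw [add_mul, map_add, hx, hy, map_add, add_mul]
    | tmul c x => rw [Algebra.TensorProduct.tmul_mul_tmul, mul_one, hΦ, hΦ, smul_mul_assoc]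
  let f : A →ₗ[k] A := Φ ∘ₗ D.natural.restrictScalars k ∘ₗ TensorProduct.mk k K A 1
  have hf : ∀ s, f s = Φ (D.natural (1 ⊗ₜ s)) := fun _ ↦ rfl
  have hfm : ∀ s ∈ skew σ, ∃ c : k, ∀ x, s * (f s * x) = c • x := by
    intro s hs
    refine ⟨ρ (q (1 ⊗ₜ s)), fun x ↦ ?_⟩
    rw [hf, ← hΦr, ← hΦl, hq.mul_mul _ (one_tmul_mem_skew hs), TensorProduct.smul_tmul',
      smul_eq_mul, mul_one, hΦ]
  obtain ⟨δ, hδ⟩ := hq.exists_eq_smul (f.baseChange K) (baseChange_mul_mul h2 hσ f hfm)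
  have hfδ : ∀ s ∈ skew σ, (1 : K) ⊗ₜ[k] f s = δ • D.natural (1 ⊗ₜ s) := fun s hs ↦
    hδ _ (one_tmul_mem_skew hs)
  have hmem : ∀ s ∈ skew σ, f s ∈ skew σ := by
    intro s hs
    apply hinj
    change (1 : K) ⊗ₜ[k] σ (f s) = 1 ⊗ₜ (-f s)
    rw [← LinearMap.baseChange_tmul, TensorProduct.tmul_neg, hfδ s hs]
    exact (skew (σ.baseChange K)).smul_mem δ
      (D.natural_mem_skew h2 (one_tmul_mem_skew (K := K) hs))
  obtain ⟨φ, hφ⟩ := Module.Projective.exists_dual_eq_one k hne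
  refine ⟨f, φ (f (f s₀)), δ, ?_, ?_, hmem, hfδ⟩
  · rintro rfl
    apply hρ
    have := hfδ s₀ hs₀
    rw [zero_smul] at this
    exact hinj (this.trans (TensorProduct.tmul_zero _ _).symm)
  · have h1 := hfδ _ (hmem _ hs₀)
    rw [hfδ s₀ hs₀, map_smul, D.natural_natural, smul_smul, TensorProduct.smul_tmul', smul_eq_mul,
      mul_one] at h1
    have := congrArg (TensorProduct.rid k K ∘ φ.lTensor K) h1
    simp only [Function.comp_apply, LinearMap.lTensor_tmul, TensorProduct.rid_tmul, hφ, one_smul]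
      at this
    rw [sq, ← this, Algebra.smul_def, mul_one]

end

/-! ### Existence of the `♮`-map and dimensions -/

theorem BioctonionDecomposition.Signs.smul {F : Type u} [Field F] {B : Type u} [NonAssocRing B]
    [Module F B] {τ : B →ₗ[F] B} {D : BioctonionDecomposition τ} {δ : F} {x y : B}
    (h : D.Signs δ x y) (c : F) : D.Signs (c * δ) x (c • y) := by
  obtain ⟨s₁, s₂, h₁, h₂, hx, hy⟩ := h
  exact ⟨s₁, s₂, h₁, h₂, hx, by rw [map_smul, hy, smul_smul]⟩

section Tower

variable {k : Type u} [Field k] {A : Type u} [NonAssocRing A] [Module k A] [SMulCommClass k A A]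
  [IsScalarTower k A A] {σ : A →ₗ[k] A} (E K : Type u) [Field E] [Field K] [Algebra k E]
  [Algebra k K] [Algebra E K] [IsScalarTower k E K]

/-- A decomposition of `K ⊗ A`, regarded as a scalar extension of `E ⊗ A`. -/
noncomputable def BioctonionDecomposition.expand (D : BioctonionDecomposition (σ.baseChange K)) :
    BioctonionDecomposition (B := K ⊗[E] (E ⊗[k] A)) ((σ.baseChange E).baseChange K) :=
  D.congr (B' := K ⊗[E] (E ⊗[k] A)) (τ' := (σ.baseChange E).baseChange K)
    (TensorProduct.AlgebraTensorModule.cancelBaseChange k E K K A)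
    (fun x y ↦ by
      obtain ⟨x, rfl⟩ :=
        (TensorProduct.AlgebraTensorModule.cancelBaseChange k E K K A).symm.surjective x
      obtain ⟨y, rfl⟩ :=
        (TensorProduct.AlgebraTensorModule.cancelBaseChange k E K K A).symm.surjective y
      rw [LinearEquiv.apply_symm_apply, LinearEquiv.apply_symm_apply, ← LinearEquiv.eq_symm_apply]
      induction x using TensorProduct.induction_on with
      | zero => rw [zero_mul, map_zero]; exact (zero_mul (M₀ := K ⊗[E] (E ⊗[k] A)) _)
      | add x x' h h' => rw [add_mul, map_add, map_add, ← h, ← h', add_mul]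
      | tmul a x =>
      induction y using TensorProduct.induction_on with
      | zero => rw [mul_zero, map_zero]; exact (mul_zero (M₀ := K ⊗[E] (E ⊗[k] A)) _)
      | add x x' h h' => rw [mul_add, map_add, map_add, ← h, ← h', mul_add]
      | tmul b y =>
        simp only [Algebra.TensorProduct.tmul_mul_tmul,
          TensorProduct.AlgebraTensorModule.cancelBaseChange_symm_tmul, one_mul])
    (fun x ↦ by
      obtain ⟨x, rfl⟩ :=
        (TensorProduct.AlgebraTensorModule.cancelBaseChange k E K K A).symm.surjective x
      rw [LinearEquiv.apply_symm_apply, ← LinearEquiv.eq_symm_apply]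
      induction x using TensorProduct.induction_on with
      | zero => simp only [map_zero]
      | add x x' h h' => simp only [map_add, h, h']
      | tmul a x =>
        simp only [LinearMap.baseChange_tmul,
          TensorProduct.AlgebraTensorModule.cancelBaseChange_symm_tmul])

theorem BioctonionDecomposition.natural_expand (D : BioctonionDecomposition (σ.baseChange K))
    (x : K ⊗[E] (E ⊗[k] A)) :
    TensorProduct.AlgebraTensorModule.cancelBaseChange k E K K A ((D.expand E K).natural x) =
      D.natural (TensorProduct.AlgebraTensorModule.cancelBaseChange k E K K A x) :=
  LinearEquiv.apply_symm_apply _ _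

end Tower

section

variable {k : Type u} [Field k] {A : Type u} [NonAssocRing A] [Module k A] [SMulCommClass k A A]
  [IsScalarTower k A A] {σ : A →ₗ[k] A}

/-- Every bi-octonion algebra has a `♮`-map. -/
theorem IsBioctonion.exists_isNatural (h2 : (2 : k) ≠ 0) (hA : IsBioctonion σ) :
    ∃ f d, IsNatural σ f d := by
  obtain ⟨hσ, K, _, _, ⟨D⟩⟩ := hA
  have h2K : (2 : K) ≠ 0 := ofNat_ne_zero_of_algebra h2
  obtain ⟨f, d, δ, hδ0, hδ, hmem, hf⟩ := D.exists_rational_natural h2K hσ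
  by_cases hd : IsSquare d
  · obtain ⟨e, rfl⟩ := hd
    obtain ⟨e, he⟩ : ∃ e : k, algebraMap k K e = δ := by
      rw [map_mul, ← sq, sq_eq_sq_iff_eq_or_eq_neg] at hδ
      obtain h | h := hδ
      · exact ⟨e, h.symm⟩
      · exact ⟨-e, by rw [map_neg, h]⟩
    obtain ⟨D', hD'⟩ := D.exists_descent h2 hσ (e⁻¹ • f) fun s hs ↦ by
      rw [LinearMap.smul_apply, TensorProduct.tmul_smul, ← algebraMap_smul K, hf s hs, smul_smul,
        map_inv₀, he, inv_mul_cancel₀ hδ0, one_smul]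
    exact ⟨(e⁻¹ • f).restrict fun s hs ↦ (skew σ).smul_mem _ (hmem s hs), 1,
      .decomposable _ D' fun s ↦ hD' s s.2⟩
  · let p : Polynomial k := Polynomial.X ^ 2 - Polynomial.C d
    have hp : Irreducible p := by
      refine (X_pow_sub_C_irreducible_iff_of_prime Nat.prime_two).2 fun b hb ↦ hd ⟨b, ?_⟩
      rw [← hb, sq]
    have : Fact (Irreducible p) := ⟨hp⟩
    let E := AdjoinRoot p
    let φ : E →ₐ[k] K := AdjoinRoot.liftAlgHom p (Algebra.ofId k K) δ (by
      simp [p, hδ])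
    let _ : Algebra E K := φ.toRingHom.toAlgebra
    have : IsScalarTower k E K := IsScalarTower.of_algebraMap_eq fun x ↦ (φ.commutes x).symm
    let r : E := AdjoinRoot.root p
    have hr : algebraMap E K r = δ := AdjoinRoot.liftAlgHom_root _ _ _ _
    have hr0 : r ≠ 0 := fun h ↦ hδ0 (by rw [← hr, h, map_zero])
    have hr2 : r ^ 2 = algebraMap k E d := by
      apply (algebraMap E K).injective
      rw [map_pow, hr, hδ, ← IsScalarTower.algebraMap_apply]
    have h2E : (2 : E) ≠ 0 := ofNat_ne_zero_of_algebra h2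
    have hE : Module.finrank k E = 2 := by
      rw [(AdjoinRoot.powerBasis hp.ne_zero).finrank, AdjoinRoot.powerBasis_dim,
        Polynomial.natDegree_X_pow_sub_C]
    obtain ⟨D', hD'⟩ := (D.expand E K).exists_descent h2E (hσ.baseChange E)
      (r⁻¹ • f.baseChange E) fun s hs ↦ by
        refine Submodule.span_induction ?_ ?_ ?_ ?_ (mem_span_of_mem_skew h2E hσ hs)
        · rintro _ ⟨t, ht, rfl⟩
          apply (TensorProduct.AlgebraTensorModule.cancelBaseChange k E K K A).injective
          rw [BioctonionDecomposition.natural_expand, LinearMap.smul_apply,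
            LinearMap.baseChange_tmul, TensorProduct.smul_tmul',
            TensorProduct.AlgebraTensorModule.cancelBaseChange_tmul,
            TensorProduct.AlgebraTensorModule.cancelBaseChange_tmul, one_smul, smul_eq_mul,
            mul_one, Algebra.smul_def, mul_one, map_inv₀, hr]
          have := hf t ht
          rw [← mul_one δ⁻¹, ← smul_eq_mul, ← TensorProduct.smul_tmul', this, smul_smul,
            inv_mul_cancel₀ hδ0, one_smul]
        · simp only [map_zero, TensorProduct.tmul_zero]
        · intro x y _ _ hx hy
          simp only [map_add, TensorProduct.tmul_add, hx, hy]
        · intro c x _ hx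
          rw [map_smul, TensorProduct.tmul_smul, hx, TensorProduct.tmul_smul,
            ← algebraMap_smul K c, ← algebraMap_smul K c, map_smul]
    refine ⟨f.restrict hmem, d, .quadratic _ d E hd hE r hr2 D' fun s ↦ ?_⟩
    have := (hD' _ (one_tmul_mem_skew s.2)).smul r
    rwa [mul_one, LinearMap.smul_apply, smul_smul, mul_inv_cancel₀ hr0, one_smul] at this

end

section Dimension

variable {F : Type u} [Field F]

theorem OctonionAlgebra.finrank_skew (C : OctonionAlgebra F) (h2 : (2 : F) ≠ 0) :
    Module.finrank F (skew C.conj) = 7 := by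
  have hk : skew C.conj = LinearMap.ker (C.bil.flip 1) := by
    ext s
    exact OctonionAlgebra.conj_eq_neg_iff
  have h := LinearMap.finrank_range_add_finrank_ker (C.bil.flip 1)
  have hs : LinearMap.range (C.bil.flip 1) = ⊤ := by
    apply LinearMap.range_eq_top.2
    apply LinearMap.surjective
    intro h0
    have := LinearMap.congr_fun h0 1
    change C.bil 1 1 = 0 at this
    rw [C.bil_self, C.norm_one, mul_one] at this
    exact h2 this
  rw [hs, finrank_top, Module.finrank_self, C.finrank_eq, ← hk] at h
  omega

variable {B : Type u} [NonAssocRing B] [Module F B] {τ : B →ₗ[F] B}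

theorem BioctonionDecomposition.finrank_eq (D : BioctonionDecomposition τ) :
    Module.finrank F B = 64 := by
  rw [D.iso.finrank_eq, Module.finrank_tensorProduct, D.C₁.finrank_eq, D.C₂.finrank_eq]

/-- The skew elements are the sums of skew elements of the two factors. -/
theorem BioctonionDecomposition.finrank_skew (D : BioctonionDecomposition τ) (h2 : (2 : F) ≠ 0) :
    Module.finrank F (skew τ) = 14 := by
  let m : (skew D.C₁.conj × skew D.C₂.conj) →ₗ[F] B := D.iso.symm.toLinearMap ∘ₗ
    LinearMap.coprod ((TensorProduct.mk F D.C₁ D.C₂).flip 1 ∘ₗ (skew D.C₁.conj).subtype)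
      (TensorProduct.mk F D.C₁ D.C₂ 1 ∘ₗ (skew D.C₂.conj).subtype)
  have hm : ∀ x, D.iso (m x) = (x.1 : D.C₁) ⊗ₜ[F] (1 : D.C₂) + (1 : D.C₁) ⊗ₜ[F] (x.2 : D.C₂) :=
    fun x ↦ D.iso.apply_symm_apply _
  have hr : LinearMap.range m = skew τ := by
    ext x
    constructor
    · rintro ⟨y, rfl⟩
      exact D.mem_skew_of_eq y.1.2 y.2.2 (hm y)
    · intro hx
      obtain ⟨s₁, s₂, h₁, h₂, h⟩ := D.exists_of_mem_skew h2 hx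
      exact ⟨⟨⟨s₁, h₁⟩, ⟨s₂, h₂⟩⟩, D.iso.injective ((hm _).trans h.symm)⟩
  have hi : Function.Injective m := by
    rw [← LinearMap.ker_eq_bot, LinearMap.ker_eq_bot']
    rintro ⟨⟨s₁, h₁⟩, ⟨s₂, h₂⟩⟩ h
    -- applying the sign change separates the two summands
    have e := hm ⟨⟨s₁, h₁⟩, ⟨s₂, h₂⟩⟩
    have e' := D.iso_natural_eq h₂ e
    rw [h, map_zero] at e
    rw [h, map_zero, map_zero] at e'
    have a₁ : (2 : F) • s₁ ⊗ₜ[F] (1 : D.C₂) = 0 := by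
      linear_combination (norm := module) -e - e'
    have a₂ : (2 : F) • (1 : D.C₁) ⊗ₜ[F] s₂ = 0 := by
      linear_combination (norm := module) -e + e'
    have b₁ : s₁ = 0 := D.C₁.tmul_one_injective D.C₂
      (((smul_eq_zero.1 a₁).resolve_left h2).trans (TensorProduct.zero_tmul _ _).symm)
    have b₂ : s₂ = 0 := D.C₁.one_tmul_injective D.C₂
      (((smul_eq_zero.1 a₂).resolve_left h2).trans (TensorProduct.tmul_zero _ _).symm)
    subst b₁ b₂
    rfl
  rw [← hr, LinearMap.finrank_range_of_inj hi, Module.finrank_prod, D.C₁.finrank_skew h2,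
    D.C₂.finrank_skew h2]

variable {k : Type u} [Field k] {A : Type u} [NonAssocRing A] [Module k A] [SMulCommClass k A A]
  [IsScalarTower k A A] {σ : A →ₗ[k] A} {K : Type u} [Field K] [Algebra k K]

theorem finrank_skew_baseChange (h2 : (2 : K) ≠ 0) (hσ : IsInvolution σ) :
    Module.finrank K (skew (σ.baseChange K)) = Module.finrank k (skew σ) := by
  have hr : LinearMap.range ((skew σ).subtype.baseChange K) = skew (σ.baseChange K) := by
    apply le_antisymm
    · rintro _ ⟨x, rfl⟩
      induction x using TensorProduct.induction_on with
      | zero => rw [map_zero]; exact zero_mem _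
      | add x y hx hy => rw [map_add]; exact add_mem hx hy
      | tmul a s =>
        rw [LinearMap.baseChange_tmul, ← mul_one a, ← smul_eq_mul, ← TensorProduct.smul_tmul']
        exact Submodule.smul_mem _ _ (one_tmul_mem_skew s.2)
    · intro x hx
      refine Submodule.span_le.2 ?_ (mem_span_of_mem_skew h2 hσ hx)
      rintro _ ⟨s, hs, rfl⟩
      exact ⟨1 ⊗ₜ ⟨s, hs⟩, rfl⟩
  rw [← hr, LinearMap.finrank_range_of_inj, Module.finrank_baseChange]
  exact Module.Flat.lTensor_preserves_injective_linearMap _ (Submodule.subtype_injective _)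

end Dimension

/-! ### The norm and the matrix factorization -/

section

variable {k : Type u} [Field k] {A : Type u} [NonAssocRing A] [Module k A] [SMulCommClass k A A]
  [IsScalarTower k A A] {σ : A →ₗ[k] A}

/-- In both cases of its definition, a `♮`-map is a multiple of a sign change over an extension
field. -/
theorem IsNatural.exists_signs (h2 : (2 : k) ≠ 0) {f : skew σ →ₗ[k] skew σ} {d : k}
    (h : IsNatural σ f d) : d ≠ 0 ∧ ∃ (E : Type u) (_ : Field E) (_ : Algebra k E)
      (D : BioctonionDecomposition (σ.baseChange E)) (δ : E), δ ^ 2 = algebraMap k E d ∧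
        ∀ s : skew σ, D.Signs δ (1 ⊗ₜ (s : A)) (1 ⊗ₜ (f s : A)) := by
  cases h with
  | decomposable D hf =>
    have h2' : (2 : AlgebraicClosure k) ≠ 0 := ofNat_ne_zero_of_algebra h2
    exact ⟨one_ne_zero, AlgebraicClosure k, inferInstance, inferInstance,
      D.baseChange (AlgebraicClosure k) h2', algebraMap k _ 1, by rw [map_one, one_pow],
      fun s ↦ (hf s).baseChange (AlgebraicClosure k) h2'⟩
  | quadratic d E hd hE δ hδ D hf =>
    refine ⟨?_, E, inferInstance, inferInstance, D, δ, hδ, hf⟩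
    rintro rfl
    exact hd (IsSquare.zero)

/-- A bi-octonion algebra is decomposable over some algebraically closed field. -/
theorem IsBioctonion.exists_isAlgClosed (h2 : (2 : k) ≠ 0) (hA : IsBioctonion σ) :
    ∃ (Ω : Type u) (_ : Field Ω) (_ : Algebra k Ω), IsAlgClosed Ω ∧
      Nonempty (BioctonionDecomposition (σ.baseChange Ω)) := by
  obtain ⟨-, L, _, _, ⟨D⟩⟩ := hA
  exact ⟨AlgebraicClosure L, inferInstance, inferInstance, inferInstance,
    ⟨D.extend L (AlgebraicClosure L) (ofNat_ne_zero_of_algebra h2)⟩⟩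

theorem IsBioctonion.finrank_eq (hA : IsBioctonion σ) : Module.finrank k A = 64 := by
  obtain ⟨-, L, _, _, ⟨D⟩⟩ := hA
  rw [← Module.finrank_baseChange (R := L), D.finrank_eq]

theorem IsBioctonion.finrank_skew (h2 : (2 : k) ≠ 0) (hA : IsBioctonion σ) :
    Module.finrank k (skew σ) = 14 := by
  obtain ⟨hσ, L, _, _, ⟨D⟩⟩ := hA
  have h2' : (2 : L) ≠ 0 := ofNat_ne_zero_of_algebra h2
  rw [← finrank_skew_baseChange h2' hσ, D.finrank_skew h2']

variable {ι : Type*} [Fintype ι] (b : Module.Basis ι k A) {N N' : MvPolynomial ι k}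

/-- A normalized octic form that detects conjugate-invertibility is the norm. -/
theorem IsBioctonion.isNorm (h2 : (2 : k) ≠ 0) (hA : IsBioctonion σ) (hN : N.IsHomogeneous 8)
    (h : DetectsInvertibility σ b N) (h1 : MvPolynomial.eval (b.repr 1) N = 1) :
    IsNorm σ b N := by
  obtain ⟨Ω, _, _, _, ⟨D⟩⟩ := hA.exists_isAlgClosed h2
  exact ⟨⟨8, hN, fun n' N' hN' h' ↦
    eight_le_of_detectsInvertibility hA.1 b (ofNat_ne_zero_of_algebra h2) D hN' h'⟩, h, h1⟩

theorem IsBioctonion.eq_of_isNorm (h2 : (2 : k) ≠ 0) (hA : IsBioctonion σ)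
    (hN : N.IsHomogeneous 8) (h : DetectsInvertibility σ b N)
    (h1 : MvPolynomial.eval (b.repr 1) N = 1) (hN' : IsNorm σ b N') : N' = N := by
  obtain ⟨Ω, _, _, _, ⟨D⟩⟩ := hA.exists_isAlgClosed h2
  have h2' : (2 : Ω) ≠ 0 := ofNat_ne_zero_of_algebra h2
  obtain ⟨⟨n, hn, hmin⟩, h', h1'⟩ := hN'
  obtain rfl : n = 8 := le_antisymm (hmin 8 N hN h)
    (eight_le_of_detectsInvertibility hA.1 b h2' D hn h')
  exact eq_of_detectsInvertibility hA.1 b h2' D hn hN h' h h1' h1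

end

theorem mainTheorem12 {k : Type u} [Field k] (h2 : (2 : k) ≠ 0) (h3 : (3 : k) ≠ 0)
    {A : Type u} [NonAssocRing A] [Module k A] [SMulCommClass k A A] [IsScalarTower k A A]
    (σ : A →ₗ[k] A) (hA : IsBioctonion σ) :
    Module.finrank k A = 64 ∧ Module.finrank k (skew σ) = 14 ∧
    (∃ f d, IsNatural σ f d) ∧
    ∀ b : Module.Basis (Fin 64) k A,
      (∃! N : MvPolynomial (Fin 64) k, IsNorm σ b N) ∧
      ∀ N : MvPolynomial (Fin 64) k, IsNorm σ b N →
        N.IsHomogeneous 8 ∧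
        ∀ (f : skew σ →ₗ[k] skew σ) (d : k), IsNatural σ f d →
          (∀ x : A, opM hA.1 f x ∘ₗ opM hA.1 f x =
            (d * MvPolynomial.eval (b.repr x) N) • LinearMap.id) ∧
          ∀ c : Module.Basis (Fin 14) k (skew σ),
            ∃ P : Matrix (Fin 14) (Fin 14) (MvPolynomial (Fin 64) k),
              (∀ i j, (P i j).IsHomogeneous 4) ∧
              (∀ x : A, P.map (MvPolynomial.eval (b.repr x)) =
                LinearMap.toMatrix c c (opM hA.1 f x)) ∧
              (d⁻¹ • P) * P = N • (1 : Matrix (Fin 14) (Fin 14) (MvPolynomial (Fin 64) k)) := by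
  have h6 : (6 : k) ≠ 0 := by
    rw [show (6 : k) = 2 * 3 by norm_num]; exact mul_ne_zero h2 h3
  refine ⟨hA.finrank_eq, hA.finrank_skew h2, hA.exists_isNatural h2, fun b ↦ ?_⟩
  have : Module.Finite k A := Module.Finite.of_basis b
  let c₀ : Module.Basis (Fin 14) k (skew σ) := Module.finBasisOfFinrankEq k _ (hA.finrank_skew h2)
  have key : ∀ N, IsNorm σ b N → N.IsHomogeneous 8 ∧
      ∀ (f : skew σ →ₗ[k] skew σ) (d : k), IsNatural σ f d → d ≠ 0 ∧
        ∀ c : Module.Basis (Fin 14) k (skew σ),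
          quarticMatrix hA.1 f b c * quarticMatrix hA.1 f b c = (MvPolynomial.C d * N) • 1 := by
    intro N hN
    have hf : ∀ (f : skew σ →ₗ[k] skew σ) (d : k), IsNatural σ f d → d ≠ 0 ∧
        ∀ c : Module.Basis (Fin 14) k (skew σ), N.IsHomogeneous 8 ∧
          quarticMatrix hA.1 f b c * quarticMatrix hA.1 f b c = (MvPolynomial.C d * N) • 1 := by
      intro f d hfd
      obtain ⟨hd, E, _, _, D, δ, hδ, hs⟩ := hfd.exists_signs h2
      refine ⟨hd, fun c ↦ ?_⟩
      obtain ⟨N', h8, hdet, h1, hP⟩ := exists_detecting_form hA.1 b c h2 h3 D hd hδ hs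
      obtain rfl := hA.eq_of_isNorm b h2 h8 hdet h1 hN
      exact ⟨h8, hP⟩
    obtain ⟨f₀, d₀, hf₀⟩ := hA.exists_isNatural h2
    exact ⟨((hf f₀ d₀ hf₀).2 c₀).1, fun f d h ↦ ⟨(hf f d h).1, fun c ↦ ((hf f d h).2 c).2⟩⟩
  refine ⟨?_, fun N hN ↦ ⟨(key N hN).1, fun f d hfd ↦ ?_⟩⟩
  · obtain ⟨f, d, hfd⟩ := hA.exists_isNatural h2
    obtain ⟨hd, E, _, _, D, δ, hδ, hs⟩ := hfd.exists_signs h2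
    obtain ⟨N, h8, hdet, h1, -⟩ := exists_detecting_form hA.1 b c₀ h2 h3 D hd hδ hs
    exact ⟨N, hA.isNorm b h2 h8 hdet h1, fun N' hN' ↦ hA.eq_of_isNorm b h2 h8 hdet h1 hN'⟩
  obtain ⟨hd, hP⟩ := (key N hN).2 f d hfd
  refine ⟨fun x ↦ ?_, fun c ↦ ⟨quarticMatrix hA.1 f b c, quarticMatrix_isHomogeneous hA.1 f b c,
    quarticMatrix_map_eval hA.1 f b c h6, ?_⟩⟩
  · apply (LinearMap.toMatrix c₀ c₀).injective
    rw [LinearMap.toMatrix_comp c₀ c₀ c₀, ← quarticMatrix_map_eval hA.1 f b c₀ h6, ← Matrix.map_mul,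
      hP, map_smul, LinearMap.toMatrix_id]
    ext i j
    simp [Matrix.one_apply, apply_ite (MvPolynomial.eval (b.repr x))]
  · rw [Matrix.smul_mul, hP, ← algebraMap_smul (MvPolynomial (Fin 64) k) d⁻¹, smul_smul,
      MvPolynomial.algebraMap_eq, ← mul_assoc, ← map_mul, inv_mul_cancel₀ hd, map_one, one_mul]
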